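/- Let $\lambda,\mu,\sigma^2,C_{\rm L},C_{\rm N},\alpha_{\rm L},\alpha_{\rm N},M>0$, $m,\beta\ge 0$, $0<\theta_b\le 2\pi$ and an integer $K\ge 1$ be given, and put $p(r)=e^{-\beta r}$. A user is at the origin of $\mathbb R^2$. The line-of-sight (LOS) and the non-line-of-sight (NLOS) access points form independent Poisson point processes $\Phi_{\rm L},\Phi_{\rm N}$ on $\mathbb R^2$ with intensities $\lambda p(|x|)$ and $\lambda(1-p(|x|))$; the points of $\Phi=\Phi_{\rm L}\cup\Phi_{\rm N}$ are indexed by increasing distance $r_1<r_2<\cdots$ from the origin, and the first $K$ of them serve the user. Independently of the access points, let $(\xi_l)_l$ be independent complex fading coefficients with $|\xi_l|^2$ exponentially distributed with mean $\mu$ (Rayleigh fading), and, independent of these, let $(\Theta_l)_l$ be independent angles uniform on $(-\pi,\pi]$; the antenna gain of an interfering link is $G_l=M$ if $|\Theta_l|<\theta_b/2$ and $G_l=m$ otherwise, so that $\mathbb P(G_l=M)=\theta_b/2\pi$ if $M\ne m$. Serving links have gain $M$ and are treated as LOS, so that $$\gamma=\frac{\sum_{k=1}^K M C_{\rm L}r_k^{-\alpha_{\rm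 L}}|\xi_k|^2}{I_{\rm L}+I_{\rm N}+\sigma^2},\qquad I_j=\sum_{l>K,\;l\in\Phi_j}G_l C_j r_l^{-\alpha_j}|\xi_l|^2\in[0,\infty]\quad(j={\rm L},{\rm N}),$$ with $\gamma=0$ if $I_{\rm L}+I_{\rm N}=\infty$. Let $H(x)=1-1/(1+x)$, $a_1=M$, $a_2=m$, $b_1=\theta_b/2\pi$, $b_2=1-\theta_b/2\pi$, and, for $\bm r=(r_1,\dots,r_K)\in\mathcal D=\{0<r_1\le\cdots\le r_K\}$ and $s>0$, $$V_{\rm L}(s)=2\pi\lambda\sum_{n=1}^2 b_n\int_{r_K}^\infty H(\mu s a_nC_{\rm L}x^{-\alpha_{\rm L}})\,p(x)\,x\,dx,$$ $$V_{\rm N}(s)=2\pi\lambda\sum_{n=1}^2 b_n\int_{r_K}^\infty H(\mu s a_nC_{\rm N}x^{-\alpha_{\rm N}})\,(1-p(x))\,x\,dx$$ (values in $[0,\infty]$, with $e^{-\infty}=0$). Then $\log_2(1+\gamma)$ is integrable, and the conditional ergodic capacity $C_{\rm cond}(\bm r)=\mathbb E[\log_2(1+\gamma)\mid r_1,\dots,r_K]$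 is almost surely given by $$C_{\rm cond}(\bm r)=\frac1{\ln 2}\int_0^\infty \frac{e^{-s\sigma^2}}{s}\,e^{-(V_{\rm L}(s)+V_{\rm N}(s))}\Bigl(1-\prod_{k=1}^K\bigl(1-H(\mu sMC_{\rm L}r_k^{-\alpha_{\rm L}})\bigr)\Bigr)ds .$$ The distances $(r_1,\dots,r_K)$ have joint density $(2\pi\lambda)^K r_1\cdots r_K e^{-\pi\lambda r_K^2}$ on $\mathcal D$, and the ergodic capacity $C=\mathbb E[\log_2(1+\gamma)]$ is $$C=\frac{(2\pi\lambda)^K}{\ln2}\int_{\mathcal D} r_1\cdots r_K e^{-\pi\lambda r_K^2}\int_0^\infty\frac{e^{-s\sigma^2}}{s}\,e^{-(V_{\rm L}(s)+V_{\rm N}(s))}\Bigl(1-\prod_{k=1}^K\bigl(1-H(\mu sMC_{\rm L}r_k^{-\alpha_{\rm L}})\bigr)\Bigr)ds\,d\bm r ,$$ all these integrals (over $s$ and over $\bm r$) being absolutely convergent. -/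

import Mathlib

open MeasureTheory ProbabilityTheory Set
open scoped ENNReal

noncomputable section

/-- The parameters of the virtual-cell network: `K` serving access points (APs), AP density `lam`,
blockage parameter `beta`, path-loss intercepts and exponents of line-of-sight (`CL`, `alphaL`) and
non-line-of-sight (`CN`, `alphaN`) links, main-lobe gain `M`, side-lobe gain `m`, beamwidth `thetaB`,
normalized noise power `sigma2`, and mean `mu` of the exponential fading power. -/
structure VCParams where
  K : ℕ
  K_pos : 0 < K
  lam : ℝ
  lam_pos : 0 < lam
  beta : ℝ
  beta_nonneg : 0 ≤ beta
  CL : ℝ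
  CL_pos : 0 < CL
  CN : ℝ
  CN_pos : 0 < CN
  alphaL : ℝ
  alphaL_pos : 0 < alphaL
  alphaN : ℝ
  alphaN_pos : 0 < alphaN
  M : ℝ
  M_pos : 0 < M
  m : ℝ
  m_nonneg : 0 ≤ m
  thetaB : ℝ
  thetaB_pos : 0 < thetaB
  thetaB_le : thetaB ≤ 2 * Real.pi
  sigma2 : ℝ
  sigma2_pos : 0 < sigma2
  mu : ℝ
  mu_pos : 0 < mu

/-- The plane in which the APs are deployed; the user is at the origin. -/
abbrev Plane : Type := EuclideanSpace ℝ (Fin 2)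

/-- `Phi` is a Poisson point process with intensity measure `Lam`: the number of points in a set of
finite intensity is Poisson, and the numbers of points in disjoint sets are independent. -/
structure IsPoissonProcess {Ω E : Type*} [MeasurableSpace Ω] [MeasurableSpace E]
    (Phi : Ω → Measure E) (Lam : Measure E) (P : Measure Ω) : Prop where
  count_law : ∀ B : Set E, MeasurableSet B → Lam B < ∞ →
    HasLaw (fun ω => Phi ω B)
      ((poissonMeasure (Lam B).toNNReal).map (fun n : ℕ => (n : ℝ≥0∞))) P
  indep : ∀ (n : ℕ) (B : Fin n → Set E), (∀ i, MeasurableSet (B i)) →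
    Pairwise (fun i j => Disjoint (B i) (B j)) →
    iIndepFun (fun i ω => Phi ω (B i)) P

namespace VCParams

variable (N : VCParams)

/-- LOS probability function. -/
def p (r : ℝ) : ℝ := Real.exp (-N.beta * r)

/-- Sectored antenna gain at angle `θ` from boresight. -/
def antennaGain (θ : ℝ) : ℝ := if |θ| < N.thetaB / 2 then N.M else N.m

/-- Path loss of a LOS link of length `r`. -/
def pathLossL (r : ℝ) : ℝ := N.CL * r ^ (-N.alphaL)

/-- Path loss of an NLOS link of length `r`. -/
def pathLossN (r : ℝ) : ℝ := N.CN * r ^ (-N.alphaN)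

/-- Intensity measure of the LOS APs, with density `lam * p(|x|)`. -/
def intensityL : Measure Plane :=
  volume.withDensity (fun x => ENNReal.ofReal (N.lam * N.p ‖x‖))

/-- Intensity measure of the NLOS APs, with density `lam * (1 - p(|x|))`. -/
def intensityN : Measure Plane :=
  volume.withDensity (fun x => ENNReal.ofReal (N.lam * (1 - N.p ‖x‖)))

end VCParams

/-- The point process (as a random counting measure) of those APs `X k` with `los k = b`. -/
def apProcess {Ω : Type*} (X : ℕ → Ω → Plane) (los : ℕ → Ω → Bool) (b : Bool) (ω : Ω) :
    Measure Plane :=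
  Measure.sum (fun k => if los k ω = b then Measure.dirac (X k ω) else 0)

/-- A virtual-cell network with Rayleigh fading on the probability space `(Ω, P)`.
The APs are indexed by `ℕ` in increasing order of distance from the user, so that the serving APs
are those with index `k < K`. -/
structure RayleighNetwork (N : VCParams) {Ω : Type*} [MeasurableSpace Ω] (P : Measure Ω) where
  /-- Location of the `k`-th nearest AP. -/
  X : ℕ → Ω → Plane
  /-- Whether the `k`-th nearest AP belongs to the LOS or to the NLOS process. -/
  los : ℕ → Ω → Bool
  /-- Angle of departure of the link from the `k`-th nearest AP (used for interfering links). -/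
  Θ : ℕ → Ω → ℝ
  /-- Complex fading coefficient of the link from the `k`-th nearest AP. -/
  ξ : ℕ → Ω → ℂ
  measurable_X : ∀ k, Measurable (X k)
  measurable_los : ∀ k, Measurable (los k)
  measurable_Θ : ∀ k, Measurable (Θ k)
  measurable_ξ : ∀ k, Measurable (ξ k)
  ordered : ∀ᵐ ω ∂P, StrictMono (fun k => ‖X k ω‖)
  poissonL : IsPoissonProcess (apProcess X los true) N.intensityL P
  poissonN : IsPoissonProcess (apProcess X los false) N.intensityN P
  indep_LN : IndepFun (apProcess X los true) (apProcess X los false) P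
  angle_uniform : ∀ k, pdf.IsUniform (Θ k) (Ioc (-Real.pi) Real.pi) P volume
  fading_law : ∀ k, HasLaw (fun ω => ‖ξ k ω‖ ^ 2) (expMeasure N.mu⁻¹) P
  angle_indep : iIndepFun Θ P
  fading_indep : iIndepFun ξ P
  indep_angle_fading : IndepFun (fun ω k => Θ k ω) (fun ω k => ξ k ω) P
  indep_ap_marks :
    IndepFun (fun ω k => (X k ω, los k ω)) (fun ω k => (Θ k ω, ξ k ω)) P

namespace RayleighNetwork

variable {N : VCParams} {Ω : Type*} [MeasurableSpace Ω] {P : Measure Ω}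
  (S : RayleighNetwork N P)

/-- Distances of the `K` nearest (serving) APs. -/
def servingDist (ω : Ω) : Fin N.K → ℝ := fun k => ‖S.X k ω‖

/-- Desired signal power; the serving links are LOS with the maximal antenna gain. -/
def signal (ω : Ω) : ℝ :=
  ∑ k : Fin N.K, N.M * N.pathLossL (S.servingDist ω k) * ‖S.ξ k ω‖ ^ 2

/-- Interference power from the LOS APs outside the virtual cell (possibly infinite). -/
def interferenceL (ω : Ω) : ℝ≥0∞ :=
  ∑' l : ℕ, if N.K ≤ l ∧ S.los l ω = true then
    ENNReal.ofReal (N.antennaGain (S.Θ l ω) * N.pathLossL ‖S.X l ω‖ * ‖S.ξ l ω‖ ^ 2) else 0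

/-- Interference power from the NLOS APs outside the virtual cell (possibly infinite). -/
def interferenceN (ω : Ω) : ℝ≥0∞ :=
  ∑' l : ℕ, if N.K ≤ l ∧ S.los l ω = false then
    ENNReal.ofReal (N.antennaGain (S.Θ l ω) * N.pathLossN ‖S.X l ω‖ * ‖S.ξ l ω‖ ^ 2) else 0

/-- The SINR of the user; it is `0` where the interference is infinite. -/
def sinr (ω : Ω) : ℝ :=
  (ENNReal.ofReal (S.signal ω) /
    (S.interferenceL ω + S.interferenceN ω + ENNReal.ofReal N.sigma2)).toReal

/-- Spectral efficiency `log₂ (1 + SINR)`. -/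
def rate (ω : Ω) : ℝ := Real.logb 2 (1 + S.sinr ω)

/-- Ergodic capacity `E[log₂ (1 + SINR)]`. -/
def ergodicCapacity : ℝ := ∫ ω, S.rate ω ∂P

/-- Conditional ergodic capacity `E[log₂ (1 + SINR) | r₁, …, r_K]`, given the serving distances. -/
def condErgodicCapacity : Ω → ℝ :=
  P[S.rate | MeasurableSpace.comap S.servingDist inferInstance]

end RayleighNetwork

/-- `H(x) = 1 - 1 / (1 + x)`. -/
def rayleighH (x : ℝ) : ℝ := 1 - 1 / (1 + x)

/-- `exp (-v)` for `v ∈ [0, ∞]`, with `exp (-∞) = 0`. -/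
def expNeg (v : ℝ≥0∞) : ℝ := if v = ∞ then 0 else Real.exp (-v.toReal)

namespace VCParams

variable (N : VCParams)

/-- Values of the interfering antenna gain. -/
def a : Fin 2 → ℝ := ![N.M, N.m]

/-- Probabilities of the values of the interfering antenna gain. -/
def b : Fin 2 → ℝ := ![N.thetaB / (2 * Real.pi), 1 - N.thetaB / (2 * Real.pi)]

/-- The largest serving distance `r_K`. -/
def rK (r : Fin N.K → ℝ) : ℝ := r ⟨N.K - 1, Nat.sub_lt N.K_pos Nat.one_pos⟩

/-- Interference exponent of the LOS APs. -/
def VL (r : Fin N.K → ℝ) (s : ℝ) : ℝ≥0∞ :=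
  ENNReal.ofReal (2 * Real.pi * N.lam) * ∑ n, ENNReal.ofReal (N.b n) *
    ∫⁻ x in Ioi (N.rK r),
      ENNReal.ofReal (rayleighH (N.mu * s * N.a n * N.CL * x ^ (-N.alphaL)) * N.p x * x)

/-- Interference exponent of the NLOS APs. -/
def VN (r : Fin N.K → ℝ) (s : ℝ) : ℝ≥0∞ :=
  ENNReal.ofReal (2 * Real.pi * N.lam) * ∑ n, ENNReal.ofReal (N.b n) *
    ∫⁻ x in Ioi (N.rK r),
      ENNReal.ofReal (rayleighH (N.mu * s * N.a n * N.CN * x ^ (-N.alphaN)) * (1 - N.p x) * x)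

/-- Integrand of the capacity formula. -/
def capacityIntegrand (r : Fin N.K → ℝ) (s : ℝ) : ℝ :=
  Real.exp (-s * N.sigma2) / s * expNeg (N.VL r s + N.VN r s) *
    (1 - ∏ k, (1 - rayleighH (N.mu * s * N.M * N.CL * r k ^ (-N.alphaL))))

/-- The domain `0 < r₁ ≤ ⋯ ≤ r_K`. -/
def D : Set (Fin N.K → ℝ) := {r | (∀ k, 0 < r k) ∧ Monotone r}

/-- The function `(2πλ)^K r₁ ⋯ r_K exp (-πλ r_K²)`. -/
def distDensity (r : Fin N.K → ℝ) : ℝ :=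
  (2 * Real.pi * N.lam) ^ N.K * (∏ k, r k) * Real.exp (-Real.pi * N.lam * N.rK r ^ 2)

end VCParams

end

/-!
The distances and types (LOS or NLOS) of the access points form a single Poisson process on
`ℝ × Bool`, by superposition of the two given processes (`isPoissonProcess_distType`); its intensity
gives mass `π * lam * (t ^ 2 - s ^ 2)` to distances between `s` and `t`, whatever the blockage.

The core is a strong Markov property (`setLIntegral_eneg_tsum_ge`): conditionally on the `K`
smallest distances, the points beyond the `K`-th one form a Poisson process on the rest of the
space. For a deterministic radius `s` in place of the `K`-th distance, the points beyond `s` are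
independent of all counts inside radius `s`, and lower orthant events `R_j ≤ t_j ≤ s` are count
events. The random radius is approximated from above by radii with countably many values, and
dominated convergence passes to the limit. The exponentials are written with
`eneg v = exp (-v) ∈ [0, ∞]`, which is continuous on `[0, ∞]`, so that infinite sums and infinite
interference need no separate treatment there.

* With a test function that is infinite on a ball, the Markov property gives the conditional law of
  the next distance, and by induction the joint density of the serving distances
  (`map_dist_eq_withDensity`).
* Integrating out the independent gains and fading powers first turns the Laplace transform of
  signal plus interference into a functional of distances and types alone, to which the Markov
  property applies. This yields the factors `∏ 1 / (1 + μ s M C_L r_k ^ (-α_L))` and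
  `exp (-(V_L + V_N))` (`lintegral_mul_eneg_signal_add_interference`).
* Frullani's integral `log (1 + y / c) = ∫ exp (-s * c) / s * (1 - exp (-s * y)) ds` and Tonelli's
  theorem convert the Laplace transforms into the mean of `log (1 + γ)` over every event determined
  by the serving distances (`setLIntegral_log_one_add_sinr`), which characterizes the conditional
  expectation.

The rate is integrable because `log (1 + γ)` is at most a sum of terms
`1 + α_L / r_1 + const * ‖ξ_k‖ ^ 2`, and `1 / r_1` has finite mean under the density
`2 π λ r * exp (-π λ r ^ 2)` (`integrable_rate`).
-/

open Filter Topology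

/-! ### The function `exp (-v)` on `[0, ∞]` -/

/-- `exp (-v)` for `v ∈ [0, ∞]`, as an extended nonnegative number, so that it can be used under
lower Lebesgue integrals. -/
noncomputable def eneg (v : ℝ≥0∞) : ℝ≥0∞ := ENNReal.ofReal (expNeg v)

theorem expNeg_nonneg (v : ℝ≥0∞) : 0 ≤ expNeg v := by
  unfold expNeg; split_ifs <;> positivity

/-- The relation to Mathlib's `EReal.exp`, from which monotonicity and continuity of `eneg`
follow. -/
theorem eneg_eq_ereal_exp (v : ℝ≥0∞) : eneg v = EReal.exp (-(v : EReal)) := by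
  unfold eneg expNeg
  split_ifs with h
  · simp [h]
  · lift v to NNReal using h
    have : -(((v : ℝ≥0∞)) : EReal) = ((-(v : ℝ) : ℝ) : EReal) := by
      rw [EReal.coe_neg]; rfl
    rw [this, EReal.exp_coe]
    simp

theorem eneg_toReal (v : ℝ≥0∞) : (eneg v).toReal = expNeg v :=
  ENNReal.toReal_ofReal (expNeg_nonneg v)

@[simp] theorem eneg_zero : eneg 0 = 1 := by simp [eneg, expNeg]

@[simp] theorem eneg_top : eneg ∞ = 0 := by simp [eneg, expNeg]

theorem eneg_ofReal {x : ℝ} (hx : 0 ≤ x) :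
    eneg (ENNReal.ofReal x) = ENNReal.ofReal (Real.exp (-x)) := by
  simp [eneg, expNeg, hx]

theorem eneg_add (v w : ℝ≥0∞) : eneg (v + w) = eneg v * eneg w := by
  by_cases hv : v = ∞
  · simp [hv]
  by_cases hw : w = ∞
  · simp [hw]
  have : v + w ≠ ∞ := by simp [hv, hw]
  simp only [eneg, expNeg, hv, hw, this, if_false]
  rw [← ENNReal.ofReal_mul (by positivity), ← Real.exp_add, ENNReal.toReal_add hv hw]
  ring_nf

theorem eneg_antitone : Antitone eneg := by
  intro v w h
  rw [eneg_eq_ereal_exp, eneg_eq_ereal_exp]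
  exact EReal.exp_monotone (EReal.neg_le_neg_iff.2 (by exact_mod_cast h))

theorem eneg_le_one (v : ℝ≥0∞) : eneg v ≤ 1 := by
  rw [← eneg_zero]; exact eneg_antitone (zero_le)

@[fun_prop] theorem continuous_eneg : Continuous eneg := by
  have : eneg = fun v : ℝ≥0∞ => EReal.exp (-(v : EReal)) := funext eneg_eq_ereal_exp
  rw [this]
  exact ENNReal.continuous_exp.comp (continuous_neg.comp continuous_coe_ennreal_ereal)

@[fun_prop] theorem measurable_eneg : Measurable eneg := continuous_eneg.measurable

theorem eneg_sum {ι : Type*} (s : Finset ι) (f : ι → ℝ≥0∞) :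
    eneg (∑ i ∈ s, f i) = ∏ i ∈ s, eneg (f i) := by
  classical
  induction s using Finset.induction_on with
  | empty => simp
  | insert a s ha ih => rw [Finset.sum_insert ha, Finset.prod_insert ha, eneg_add, ih]

theorem eneg_nsmul (n : ℕ) (c : ℝ≥0∞) : eneg (c * n) = eneg c ^ n := by
  have := eneg_sum (Finset.range n) (fun _ => c)
  simpa [mul_comm] using this

theorem one_sub_eneg (v : ℝ≥0∞) : 1 - eneg v = ENNReal.ofReal (1 - expNeg v) := by
  rw [ENNReal.ofReal_sub _ (expNeg_nonneg v)]; simp [eneg]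

theorem expNeg_le_one (v : ℝ≥0∞) : expNeg v ≤ 1 := by
  have := eneg_le_one v
  rw [← eneg_toReal]
  exact ENNReal.toReal_le_of_le_ofReal (by norm_num) (by simpa using this)

/-- Expectations of `exp (-f)` pass to pointwise limits of `f`. -/
theorem tendsto_lintegral_mul_eneg {Ω : Type*} [MeasurableSpace Ω] {P : Measure Ω}
    [IsFiniteMeasure P] {g : Ω → ℝ≥0∞} (hg : Measurable g) (hg1 : ∀ ω, g ω ≤ 1)
    {F : ℕ → Ω → ℝ≥0∞} {f : Ω → ℝ≥0∞} (hF : ∀ n, Measurable (F n))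
    (h : ∀ᵐ ω ∂P, Tendsto (fun n => F n ω) atTop (𝓝 (f ω))) :
    Tendsto (fun n => ∫⁻ ω, g ω * eneg (F n ω) ∂P) atTop (𝓝 (∫⁻ ω, g ω * eneg (f ω) ∂P)) := by
  refine tendsto_lintegral_of_dominated_convergence (fun _ => 1)
    (fun n => hg.mul (measurable_eneg.comp (hF n))) (fun n => ?_) (by simp) ?_
  · exact Eventually.of_forall fun ω => mul_le_one' (hg1 ω) (eneg_le_one _)
  · filter_upwards [h] with ω hω
    exact ENNReal.Tendsto.const_mul ((continuous_eneg.tendsto _).comp hω)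
      (Or.inr ((hg1 ω).trans_lt ENNReal.one_lt_top).ne)

/-! ### Independence and the Poisson distribution -/

/-- If the families `X` and `Y` are independent of each other and each consists of independent
random variables, then the pairs `(X i, Y i)` are independent. -/
theorem iIndepFun_prodMk {Ω ι : Type*} {α β : ι → Type*} [MeasurableSpace Ω] {P : Measure Ω}
    [∀ i, MeasurableSpace (α i)] [∀ i, MeasurableSpace (β i)]
    {X : ∀ i, Ω → α i} {Y : ∀ i, Ω → β i} (hXm : ∀ i, Measurable (X i))
    (hYm : ∀ i, Measurable (Y i))
    (hX : iIndepFun X P) (hY : iIndepFun Y P)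
    (hXY : IndepFun (fun ω i => X i ω) (fun ω i => Y i ω) P) :
    iIndepFun (fun i ω => (X i ω, Y i ω)) P := by
  rw [iIndepFun_iff_iIndep]
  have := hX.isProbabilityMeasure
  refine iIndepSets.iIndep (fun i => ((hXm i).prodMk (hYm i)).comap_le)
    (fun i => (fun s => (fun ω => (X i ω, Y i ω)) ⁻¹' s) ''
      (image2 (· ×ˢ ·) {s | MeasurableSet s} {t | MeasurableSet t})) ?_ ?_ ?_
  · intro i
    exact isPiSystem_prod.comap _
  · intro i
    rw [← generateFrom_prod, MeasurableSpace.comap_generateFrom]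
  · rw [iIndepSets_iff]
    intro S f hf
    choose! g hg using hf
    have hg1 : ∀ i ∈ S, ∃ A B, MeasurableSet A ∧ MeasurableSet B ∧ A ×ˢ B = g i := by
      intro i hi
      obtain ⟨A, hA, B, hB, h⟩ := (hg i hi).1
      exact ⟨A, B, hA, hB, h⟩
    choose! A B hA hB hAB using hg1
    have hf : ∀ i ∈ S, f i = X i ⁻¹' A i ∩ Y i ⁻¹' B i := by
      intro i hi
      rw [← (hg i hi).2, ← hAB i hi]; rfl
    have key : ∀ T : Finset ι, T ⊆ S → P (⋂ i ∈ T, f i) =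
        (∏ i ∈ T, P (X i ⁻¹' A i)) * ∏ i ∈ T, P (Y i ⁻¹' B i) := by
      intro T hT
      have e : (⋂ i ∈ T, f i) = (⋂ i ∈ T, X i ⁻¹' A i) ∩ (⋂ i ∈ T, Y i ⁻¹' B i) := by
        ext ω; simp only [mem_iInter, mem_inter_iff, ← forall₂_and]
        exact forall₂_congr fun i hi => by rw [hf i (hT hi)]; rfl
      rw [e, ← hX.measure_inter_preimage_eq_mul T (fun i hi => hA i (hT hi)),
        ← hY.measure_inter_preimage_eq_mul T (fun i hi => hB i (hT hi))]
      have h1 := indepFun_iff_measure_inter_preimage_eq_mul.1 hXY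
        (⋂ i ∈ T, (fun x => x i) ⁻¹' A i) (⋂ i ∈ T, (fun x => x i) ⁻¹' B i)
        (T.measurableSet_biInter fun i hi => measurable_pi_apply i (hA i (hT hi)))
        (T.measurableSet_biInter fun i hi => measurable_pi_apply i (hB i (hT hi)))
      simp only [preimage_iInter] at h1; exact h1
    rw [key S subset_rfl, ← Finset.prod_mul_distrib]
    refine Finset.prod_congr rfl fun i hi => ?_
    have := key {i} (by simpa using hi)
    simpa using this.symm

/-- The Laplace transform of the Poisson distribution, at `c ∈ [0, ∞]`. -/
theorem lintegral_eneg_poisson (r : NNReal) (c : ℝ≥0∞) :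
    ∫⁻ v, eneg (c * v) ∂((poissonMeasure r).map (fun n : ℕ => (n : ℝ≥0∞))) =
      eneg ((1 - eneg c) * r) := by
  rw [lintegral_map (by fun_prop) (by fun_prop), lintegral_countable']
  set q := expNeg c with hq
  have hq0 : 0 ≤ q := expNeg_nonneg c
  have h1 : ∀ n : ℕ, eneg (c * n) * poissonMeasure r {n} =
      ENNReal.ofReal (Real.exp (-r) * ((r * q) ^ n / n.factorial)) := by
    intro n
    rw [eneg_nsmul, poissonMeasure_singleton, eneg, ← hq, ← ENNReal.ofReal_pow hq0,
      ← ENNReal.ofReal_mul (by positivity)]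
    congr 1; rw [mul_pow]; ring
  have h2 : HasSum (fun n : ℕ => Real.exp (-r) * ((r * q) ^ n / n.factorial))
      (Real.exp (-r) * Real.exp (r * q)) := by
    rw [Real.exp_eq_exp_ℝ]
    exact (NormedSpace.expSeries_div_hasSum_exp (r * q)).mul_left _
  simp_rw [h1]
  rw [← ENNReal.ofReal_tsum_of_nonneg (fun n => by positivity) h2.summable, h2.tsum_eq,
    one_sub_eneg, ← hq, ← Real.exp_add]
  have : (ENNReal.ofReal (1 - q) * r : ℝ≥0∞) = ENNReal.ofReal ((1 - q) * r) := by
    rw [ENNReal.ofReal_mul (by linarith [expNeg_le_one c])]; simp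
  have h3 : 0 ≤ (1 - q) * (r : ℝ) := mul_nonneg (by linarith [expNeg_le_one c]) r.2
  rw [this, eneg_ofReal h3]
  congr 2; ring

/-! ### Poisson processes: independence and the Laplace functional -/

theorem ProbabilityTheory.iIndepFun.indepFun_sum {Ω α β γ : Type*} [MeasurableSpace Ω]
    [MeasurableSpace γ] [Fintype α] [Fintype β] {P : Measure Ω} {Z : α ⊕ β → Ω → γ}
    (hZ : iIndepFun Z P) (hZm : ∀ i, Measurable (Z i)) :
    IndepFun (fun ω a => Z (Sum.inl a) ω) (fun ω b => Z (Sum.inr b) ω) P := by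
  classical
  have h0 := hZ.indepFun_finset (Finset.univ.map Function.Embedding.inl)
    (Finset.univ.map Function.Embedding.inr) (by rw [Finset.disjoint_left]; simp) hZm
  exact h0.comp
    (φ := fun z a => z ⟨Sum.inl a, by simp⟩) (ψ := fun z b => z ⟨Sum.inr b, by simp⟩)
    (measurable_pi_lambda _ fun a => measurable_pi_apply _)
    (measurable_pi_lambda _ fun b => measurable_pi_apply _)

/-- A function of one block of a finite independent family, times a product over the other block,
has a factorizing integral. -/
theorem ProbabilityTheory.iIndepFun.lintegral_mul_prod {Ω α β γ : Type*} [MeasurableSpace Ω]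
    [MeasurableSpace γ] [Fintype α] [Fintype β] {P : Measure Ω} {Z : α ⊕ β → Ω → γ}
    (hZ : iIndepFun Z P) (hZm : ∀ i, Measurable (Z i)) {φ : (α → γ) → ℝ≥0∞} (hφ : Measurable φ)
    {ψ : β → γ → ℝ≥0∞} (hψ : ∀ b, Measurable (ψ b)) :
    ∫⁻ ω, φ (fun a => Z (Sum.inl a) ω) * ∏ b, ψ b (Z (Sum.inr b) ω) ∂P =
      (∫⁻ ω, φ (fun a => Z (Sum.inl a) ω) ∂P) * ∏ b, ∫⁻ ω, ψ b (Z (Sum.inr b) ω) ∂P := by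
  have h1 : iIndepFun (fun b ω => ψ b (Z (Sum.inr b) ω)) P :=
    (hZ.precomp (g := Sum.inr) Sum.inr_injective).comp ψ hψ
  rw [← lintegral_prod_eq_prod_lintegral_of_indepFun Finset.univ _ h1
    (fun b => (hψ b).comp (hZm _))]
  refine lintegral_mul_eq_lintegral_mul_lintegral_of_indepFun
    (hφ.comp (measurable_pi_lambda _ fun a => hZm _))
    (Finset.measurable_prod _ fun b _ => (hψ b).comp (hZm _)) ?_
  have hm : Measurable fun z : β → γ => ∏ b, ψ b (z b) :=
    Finset.measurable_prod _ fun b _ => (hψ b).comp (measurable_pi_apply b)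
  exact (hZ.indepFun_sum hZm).comp hφ hm

namespace IsPoissonProcess

variable {Ω E : Type*} [MeasurableSpace Ω] [MeasurableSpace E] {Phi : Ω → Measure E}
  {Lam : Measure E} {P : Measure Ω}

/-- The counts of a Poisson process in the cells of a finite measurable partition are
independent. -/
theorem iIndepFun_fiber (h : IsPoissonProcess Phi Lam P) {ι : Type*} [Fintype ι] (κ : E → ι)
    (hκ : ∀ i, MeasurableSet (κ ⁻¹' {i})) : iIndepFun (fun i ω => Phi ω (κ ⁻¹' {i})) P := by
  have e := Fintype.equivFin ι
  have h1 := h.indep (Fintype.card ι) (fun j => κ ⁻¹' {e.symm j}) (fun j => hκ _) ?_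
  · have h2 := h1.precomp (g := e) e.injective
    simpa using h2
  · intro i j hij
    refine Disjoint.preimage _ ?_
    simpa using hij

theorem lintegral_eneg_count (h : IsPoissonProcess Phi Lam P) {B : Set E} (hB : MeasurableSet B)
    (hB' : Lam B < ∞) (c : ℝ≥0∞) :
    ∫⁻ ω, eneg (c * Phi ω B) ∂P = eneg ((1 - eneg c) * Lam B) := by
  have h1 := (h.count_law B hB hB').lintegral_comp (f := fun v => eneg (c * v)) (by fun_prop)
  rw [h1, lintegral_eneg_poisson, ENNReal.coe_toNNReal hB'.ne]

/-- The version of `IsPoissonProcess.lintegral_indicator_mul_eneg` for simple functions. -/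
theorem lintegral_indicator_mul_eneg_simpleFunc (h : IsPoissonProcess Phi Lam P)
    (hPhi : Measurable Phi) {n : ℕ} {S : Set E} (hS : MeasurableSet S) {B : Fin n → Set E}
    (hB : ∀ j, MeasurableSet (B j)) (hBS : ∀ j, B j ⊆ S) {T : Set (Fin n → ℝ≥0∞)}
    (hT : MeasurableSet T) (f : SimpleFunc E ℝ≥0∞) (hf : ∀ x ∈ S, f x = 0)
    (hfin : ∀ c, c ≠ 0 → Lam (f ⁻¹' {c}) < ∞) :
    ∫⁻ ω, T.indicator 1 (fun j => Phi ω (B j)) * eneg (∫⁻ x, f x ∂(Phi ω)) ∂P =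
      P {ω | (fun j => Phi ω (B j)) ∈ T} * eneg (∫⁻ x, (1 - eneg (f x)) ∂Lam) := by
  classical
  -- The fibres of `κ` are the atoms generated by the sets `B j` inside `S`, and the level sets
  -- of `f` outside `S`.
  let κ : E → Finset (Fin n) ⊕ f.range := fun x =>
    if x ∈ S then Sum.inl (Finset.univ.filter fun j => x ∈ B j)
    else Sum.inr ⟨f x, f.mem_range_self x⟩
  have hκl : ∀ J, κ ⁻¹' {Sum.inl J} = S ∩ {x | ∀ j, x ∈ B j ↔ j ∈ J} := by
    intro J; ext x
    by_cases hx : x ∈ S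
    · simp [κ, hx, Finset.ext_iff]
    · simp [κ, hx]
  have hκr : ∀ c, κ ⁻¹' {Sum.inr c} = Sᶜ ∩ f ⁻¹' {c.1} := by
    intro c; ext x
    by_cases hx : x ∈ S
    · simp [κ, hx]
    · simp [κ, hx, Subtype.ext_iff]
  have hκ : ∀ i, MeasurableSet (κ ⁻¹' {i}) := by
    rintro (J | c)
    · rw [hκl]
      refine hS.inter ?_
      rw [Set.ofPred_forall]
      refine MeasurableSet.iInter fun j => ?_
      by_cases hj : j ∈ J
      · simpa [hj] using hB j
      · simp only [hj, iff_false]; exact (hB j).compl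
    · rw [hκr]; exact hS.compl.inter (f.measurableSet_fiber _)
  have hκr' : ∀ c : f.range, c.1 ≠ 0 → κ ⁻¹' {Sum.inr c} = f ⁻¹' {c.1} := by
    intro c hc
    rw [hκr, inter_eq_right]
    intro x hx hxS
    exact hc (by rw [← hf x hxS]; exact hx.symm)
  have hBκ : ∀ j, B j = κ ⁻¹' (((Finset.univ.filter fun J : Finset (Fin n) => j ∈ J).map
      Function.Embedding.inl : Finset (Finset (Fin n) ⊕ f.range)) : Set _) := by
    intro j; ext x
    by_cases hx : x ∈ S
    · simp [κ, hx]
    · simpa [κ, hx] using fun hj => hx (hBS j hj)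
  let Z : Finset (Fin n) ⊕ f.range → Ω → ℝ≥0∞ := fun i ω => Phi ω (κ ⁻¹' {i})
  have hZm : ∀ i, Measurable (Z i) := fun i => (Measure.measurable_coe (hκ i)).comp hPhi
  have hZ : iIndepFun Z P := h.iIndepFun_fiber κ hκ
  have hcount : ∀ ω j, Phi ω (B j) =
      ∑ J ∈ Finset.univ.filter (fun J : Finset (Fin n) => j ∈ J), Z (Sum.inl J) ω := by
    intro ω j
    rw [hBκ j, ← sum_measure_preimage_singleton _ (fun y _ => hκ y), Finset.sum_map]
    rfl
  have hint : ∀ μ : Measure E, ∀ g : ℝ≥0∞ → ℝ≥0∞, g 0 = 0 →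
      ∫⁻ x, g (f x) ∂μ = ∑ c : f.range, g c * μ (κ ⁻¹' {Sum.inr c}) := by
    intro μ g hg
    have := (f.map g).lintegral_eq_lintegral μ
    rw [SimpleFunc.map_lintegral] at this
    simp only [SimpleFunc.coe_map, Function.comp] at this
    rw [this, ← Finset.sum_coe_sort]
    refine Finset.sum_congr rfl fun c _ => ?_
    by_cases hc : c.1 = 0
    · simp [hc, hg]
    · rw [hκr' c hc]
  have hright : ∀ ω, eneg (∫⁻ x, f x ∂(Phi ω)) = ∏ c : f.range, eneg (c * Z (Sum.inr c) ω) := by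
    intro ω
    have h1 := hint (Phi ω) (fun v => v) rfl
    rw [h1, eneg_sum]
  have hmeasB : Measurable fun ω => (fun j => Phi ω (B j)) :=
    measurable_pi_lambda _ fun j => (Measure.measurable_coe (hB j)).comp hPhi
  have hφ : Measurable fun z : Finset (Fin n) → ℝ≥0∞ =>
      T.indicator (1 : (Fin n → ℝ≥0∞) → ℝ≥0∞) (fun j => ∑ J ∈ Finset.univ.filter
        (fun J : Finset (Fin n) => j ∈ J), z J) :=
    (measurable_one.indicator hT).comp
      (measurable_pi_lambda _ fun j => Finset.measurable_sum _ fun J _ => measurable_pi_apply J)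
  have hfac := hZ.lintegral_mul_prod hZm hφ (ψ := fun (c : f.range) v => eneg (c.1 * v))
    (fun c => measurable_eneg.comp (measurable_const.mul measurable_id))
  have hE : ∫⁻ ω, T.indicator (1 : (Fin n → ℝ≥0∞) → ℝ≥0∞) (fun j => Phi ω (B j)) ∂P =
      P {ω | (fun j => Phi ω (B j)) ∈ T} := by
    have : (fun ω => T.indicator (1 : (Fin n → ℝ≥0∞) → ℝ≥0∞) (fun j => Phi ω (B j))) =
      {ω | (fun j => Phi ω (B j)) ∈ T}.indicator 1 := by
      ext ω; simp [indicator]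
    have hm : MeasurableSet {ω | (fun j => Phi ω (B j)) ∈ T} := hmeasB hT
    rw [this, lintegral_indicator_one hm]
  rw [← hE]
  simp_rw [hright, hcount]
  rw [hfac]
  congr 1
  rw [hint Lam (fun v => 1 - eneg v) (by simp), eneg_sum]
  refine Finset.prod_congr rfl fun c _ => ?_
  by_cases hc : c.1 = 0
  · have := hZ.isProbabilityMeasure
    simp [hc]
  · exact h.lintegral_eneg_count (hκ _) (by rw [hκr' c hc]; exact hfin _ hc) _

/-- The Laplace functional of a Poisson process outside a set `S`, and its independence of the
numbers of points in finitely many subsets of `S`. -/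
theorem lintegral_indicator_mul_eneg [SigmaFinite Lam] (h : IsPoissonProcess Phi Lam P)
    (hPhi : Measurable Phi) {n : ℕ} {S : Set E} (hS : MeasurableSet S) {B : Fin n → Set E}
    (hB : ∀ j, MeasurableSet (B j)) (hBS : ∀ j, B j ⊆ S) {T : Set (Fin n → ℝ≥0∞)}
    (hT : MeasurableSet T) {u : E → ℝ≥0∞} (hu : Measurable u) (hu0 : ∀ x ∈ S, u x = 0) :
    ∫⁻ ω, T.indicator 1 (fun j => Phi ω (B j)) * eneg (∫⁻ x, u x ∂(Phi ω)) ∂P =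
      P {ω | (fun j => Phi ω (B j)) ∈ T} * eneg (∫⁻ x, (1 - eneg (u x)) ∂Lam) := by
  have : IsProbabilityMeasure P := (h.indep 0 (fun _ => ∅) (by simp)
    (by intro i; exact i.elim0)).isProbabilityMeasure
  let f : ℕ → SimpleFunc E ℝ≥0∞ := fun k => (SimpleFunc.eapprox u k).restrict (spanningSets Lam k)
  have hf_apply : ∀ k x, f k x = (spanningSets Lam k).indicator (SimpleFunc.eapprox u k) x :=
    fun k x => SimpleFunc.restrict_apply _ (measurableSet_spanningSets Lam k) x
  have hmono : Monotone fun k x => f k x := by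
    intro k l hkl x
    simp only [hf_apply]
    refine (indicator_le_indicator_of_subset (monotone_spanningSets Lam hkl) (by simp) x).trans
      (indicator_le_indicator (SimpleFunc.monotone_eapprox u hkl x))
  have hmonox : ∀ x, Monotone fun k => f k x := fun x k l hkl => hmono hkl x
  have hlim : ∀ x, Tendsto (fun k => f k x) atTop (𝓝 (u x)) := by
    intro x
    have h1 : Tendsto (fun k => SimpleFunc.eapprox u k x) atTop (𝓝 (u x)) := by
      rw [← SimpleFunc.iSup_eapprox_apply hu x]
      exact tendsto_atTop_iSup fun a b hab => SimpleFunc.monotone_eapprox u hab x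
    refine h1.congr' ?_
    filter_upwards [eventually_ge_atTop (spanningSetsIndex Lam x)] with k hk
    rw [hf_apply, indicator_of_mem (mem_spanningSets_of_index_le Lam x hk)]
  have hle : ∀ k x, f k x ≤ u x := fun k x => (hmonox x).ge_of_tendsto (hlim x) k
  have hsimple : ∀ k, _ := fun k =>
    h.lintegral_indicator_mul_eneg_simpleFunc hPhi hS hB hBS hT (f k)
      (fun x hx => le_antisymm ((hle k x).trans (hu0 x hx).le) zero_le) (by
        intro c hc
        refine (measure_mono ?_).trans_lt (measure_spanningSets_lt_top Lam k)
        intro x hx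
        by_contra hx'
        rw [mem_preimage, hf_apply, indicator_of_notMem hx'] at hx
        exact hc hx.symm)
  have hmeasB : Measurable fun ω => (fun j => Phi ω (B j)) :=
    measurable_pi_lambda _ fun j => (Measure.measurable_coe (hB j)).comp hPhi
  have hL := tendsto_lintegral_mul_eneg (P := P)
    (g := fun ω => T.indicator 1 (fun j => Phi ω (B j)))
    (F := fun k ω => ∫⁻ x, f k x ∂(Phi ω)) (f := fun ω => ∫⁻ x, u x ∂(Phi ω))
    ((measurable_one.indicator hT).comp hmeasB)
    (fun ω => indicator_le_self' (by simp) _)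
    (fun k => (Measure.measurable_lintegral (f k).measurable).comp hPhi)
    (Eventually.of_forall fun ω => lintegral_tendsto_of_tendsto_of_monotone
      (fun k => (f k).measurable.aemeasurable)
      (Eventually.of_forall fun x => hmonox x) (Eventually.of_forall hlim))
  have hR : Tendsto (fun k => ∫⁻ x, (1 - eneg (f k x)) ∂Lam) atTop
      (𝓝 (∫⁻ x, (1 - eneg (u x)) ∂Lam)) := by
    refine lintegral_tendsto_of_tendsto_of_monotone
      (fun k => (measurable_const.sub (measurable_eneg.comp (f k).measurable)).aemeasurable)
      (Eventually.of_forall fun x a b hab => ?_) (Eventually.of_forall fun x => ?_)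
    · exact tsub_le_tsub_left (eneg_antitone (hmono hab x)) 1
    · exact ENNReal.Tendsto.sub tendsto_const_nhds ((continuous_eneg.tendsto _).comp (hlim x))
        (Or.inl ENNReal.one_ne_top)
  simp_rw [hsimple] at hL
  exact tendsto_nhds_unique hL (ENNReal.Tendsto.const_mul ((continuous_eneg.tendsto _).comp hR)
    (Or.inr (measure_ne_top _ _)))

end IsPoissonProcess

/-! ### The strong Markov property at the `K`-th nearest point -/

/-- Integrals over `{t < ρ}` are continuous from the right in `t`. -/
theorem tendsto_lintegral_restrict_of_ge {E : Type*} [MeasurableSpace E] {Lam : Measure E}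
    {ρ : E → ℝ} {v : E → ℝ≥0∞} (hv : Measurable v) (hρ : Measurable ρ)
    {τ : ℕ → ℝ} {t : ℝ} (hτ : ∀ n, t ≤ τ n) (hlim : Tendsto τ atTop (𝓝 t)) :
    Tendsto (fun n => ∫⁻ x in {x | τ n < ρ x}, v x ∂Lam) atTop
      (𝓝 (∫⁻ x in {x | t < ρ x}, v x ∂Lam)) := by
  have hs : ∀ s : ℝ, MeasurableSet {x | s < ρ x} := fun s => measurableSet_lt measurable_const hρ
  refine tendsto_of_le_liminf_of_limsup_le ?_ ?_
  · simp_rw [← lintegral_indicator (hs _)]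
    refine le_trans (lintegral_mono fun x => ?_)
      (lintegral_liminf_le fun n => hv.indicator (hs (τ n)))
    refine le_liminf_of_le (by isBoundedDefault) ?_
    by_cases hx : t < ρ x
    · filter_upwards [hlim.eventually_lt_const hx] with n hn
      rw [indicator_of_mem (by exact hx), indicator_of_mem (by exact hn)]
    · rw [indicator_of_notMem (by exact hx)]; simp
  · refine limsup_le_of_le (by isBoundedDefault) (Eventually.of_forall fun n => ?_)
    exact lintegral_mono_set fun x hx => lt_of_le_of_lt (hτ n) hx

section PointMeasure

variable {Ω E : Type*} [MeasurableSpace E]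

/-- The counting measure of the random points `Y 0, Y 1, …`. -/
noncomputable def pointMeasure (Y : ℕ → Ω → E) (ω : Ω) : Measure E :=
  Measure.sum fun k => Measure.dirac (Y k ω)

theorem lintegral_pointMeasure (Y : ℕ → Ω → E) (ω : Ω) {f : E → ℝ≥0∞} (hf : Measurable f) :
    ∫⁻ x, f x ∂(pointMeasure Y ω) = ∑' k, f (Y k ω) := by
  rw [pointMeasure, lintegral_sum_measure]
  exact tsum_congr fun k => lintegral_dirac' _ hf

theorem pointMeasure_apply (Y : ℕ → Ω → E) (ω : Ω) {B : Set E} (hB : MeasurableSet B) :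
    pointMeasure Y ω B = ∑' k, B.indicator 1 (Y k ω) := by
  rw [← lintegral_indicator_one hB, lintegral_pointMeasure _ _ (measurable_one.indicator hB)]

variable [MeasurableSpace Ω]

theorem measurable_pointMeasure {Y : ℕ → Ω → E} (hY : ∀ k, Measurable (Y k)) :
    Measurable (pointMeasure Y) := by
  refine Measure.measurable_of_measurable_coe _ fun B hB => ?_
  simp_rw [pointMeasure_apply Y _ hB]
  exact Measurable.tsum fun k => (measurable_one.indicator hB).comp (hY k)

/-- At least `k + 1` points lie within distance `t` exactly if the point with index `k` does. -/
theorem succ_le_tsum_indicator_iff {R : ℕ → ℝ} (hR : StrictMono R) (t : ℝ) (k : ℕ) :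
    ((k + 1 : ℕ) : ℝ≥0∞) ≤ ∑' j, (Iic t).indicator (1 : ℝ → ℝ≥0∞) (R j) ↔ R k ≤ t := by
  constructor
  · intro h
    by_contra! hk
    have h1 : ∑' j, (Iic t).indicator (1 : ℝ → ℝ≥0∞) (R j) =
        ∑ j ∈ Finset.range k, (Iic t).indicator (1 : ℝ → ℝ≥0∞) (R j) := by
      refine tsum_eq_sum fun j hj => indicator_of_notMem ?_ _
      rw [Finset.mem_range, not_lt] at hj
      simpa using hk.trans_le (hR.monotone hj)
    have h2 : ∑ j ∈ Finset.range k, (Iic t).indicator (1 : ℝ → ℝ≥0∞) (R j) ≤ k := by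
      calc _ ≤ ∑ j ∈ Finset.range k, (1 : ℝ≥0∞) :=
            Finset.sum_le_sum fun j _ => indicator_le_self' (f := (1 : ℝ → ℝ≥0∞)) (by simp) _
        _ = k := by simp
    have h3 := h.trans (h1.le.trans h2)
    have h4 : k + 1 ≤ k := by exact_mod_cast h3
    omega
  · intro h
    calc ((k + 1 : ℕ) : ℝ≥0∞) = ∑ j ∈ Finset.range (k + 1), 1 := by simp
      _ = ∑ j ∈ Finset.range (k + 1), (Iic t).indicator (1 : ℝ → ℝ≥0∞) (R j) := by
          refine Finset.sum_congr rfl fun j hj => ?_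
          rw [indicator_of_mem]; · rfl
          exact (hR.monotone (Nat.lt_succ_iff.1 (Finset.mem_range.1 hj))).trans h
      _ ≤ _ := ENNReal.sum_le_tsum _

variable {Y : ℕ → Ω → E} {Lam : Measure E} {P : Measure Ω} [SigmaFinite Lam]
  {ρ : E → ℝ}

/-- The case of lower orthants in `setLIntegral_eneg_of_le`: the events `ρ (Y j) ≤ t j` are events
about the numbers of points within distances `t j ≤ s`. -/
theorem setLIntegral_eneg_of_Iic (h : IsPoissonProcess (pointMeasure Y) Lam P)
    (hY : ∀ k, Measurable (Y k)) (hρ : Measurable ρ)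
    (hord : ∀ᵐ ω ∂P, StrictMono fun k => ρ (Y k ω)) {K : ℕ} {u : E → ℝ≥0∞} (hu : Measurable u)
    (s : ℝ) (t : Fin K → ℝ) (ht : ∀ j, t j ≤ s) :
    ∫⁻ ω in {ω | ∀ j : Fin K, ρ (Y j ω) ≤ t j},
        eneg (∑' l, {x | s < ρ x}.indicator u (Y l ω)) ∂P =
      P {ω | ∀ j : Fin K, ρ (Y j ω) ≤ t j} *
        eneg (∫⁻ x in {x | s < ρ x}, (1 - eneg (u x)) ∂Lam) := by
  have hs : MeasurableSet {x | s < ρ x} := measurableSet_lt measurable_const hρ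
  let T : Set (Fin K → ℝ≥0∞) := {z | ∀ j : Fin K, (((j : ℕ) + 1 : ℕ) : ℝ≥0∞) ≤ z j}
  have hT : MeasurableSet T := by
    have : T = ⋂ j : Fin K, {z | (((j : ℕ) + 1 : ℕ) : ℝ≥0∞) ≤ z j} := by ext; simp [T]
    rw [this]
    exact MeasurableSet.iInter fun j => measurableSet_le measurable_const (measurable_pi_apply j)
  have hB : ∀ j, MeasurableSet {x | ρ x ≤ t j} := fun j => measurableSet_le hρ measurable_const
  have key := h.lintegral_indicator_mul_eneg (measurable_pointMeasure hY) (S := {x | ρ x ≤ s})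
    (B := fun j => {x | ρ x ≤ t j}) (measurableSet_le hρ measurable_const) hB
    (fun j x hx => le_trans hx (ht j)) hT (hu.indicator hs)
    (fun x hx => indicator_of_notMem (by simpa using hx) _)
  have hmeas : MeasurableSet {ω | ∀ j : Fin K, ρ (Y j ω) ≤ t j} := by
    have : {ω | ∀ j : Fin K, ρ (Y j ω) ≤ t j} = ⋂ j : Fin K, {ω | ρ (Y j ω) ≤ t j} := by
      ext; simp
    rw [this]
    exact MeasurableSet.iInter fun j => measurableSet_le (hρ.comp (hY _)) measurable_const
  have hiff : ∀ᵐ ω ∂P, (fun j => pointMeasure Y ω {x | ρ x ≤ t j}) ∈ T ↔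
      ω ∈ {ω | ∀ j : Fin K, ρ (Y j ω) ≤ t j} := by
    filter_upwards [hord] with ω hω
    refine forall_congr' fun j : Fin K => ?_
    simp only [pointMeasure_apply _ _ (hB j)]
    exact succ_le_tsum_indicator_iff hω (t j) j
  have hP : P {ω | (fun j => pointMeasure Y ω {x | ρ x ≤ t j}) ∈ T} =
      P {ω | ∀ j : Fin K, ρ (Y j ω) ≤ t j} := by
    refine measure_congr ?_
    filter_upwards [hiff] with ω hω
    exact propext hω
  have hR : ∫⁻ x, (1 - eneg ({x | s < ρ x}.indicator u x)) ∂Lam =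
      ∫⁻ x in {x | s < ρ x}, (1 - eneg (u x)) ∂Lam := by
    rw [← lintegral_indicator hs]
    refine lintegral_congr fun x => ?_
    by_cases hx : x ∈ {x | s < ρ x}
    · rw [indicator_of_mem hx, indicator_of_mem hx]
    · rw [indicator_of_notMem hx, indicator_of_notMem hx]; simp
  rw [hP, hR] at key
  rw [← key, ← lintegral_indicator hmeas]
  refine lintegral_congr_ae ?_
  filter_upwards [hiff] with ω hω
  rw [lintegral_pointMeasure _ _ (hu.indicator hs)]
  by_cases hx : ω ∈ {ω | ∀ j : Fin K, ρ (Y j ω) ≤ t j}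
  · rw [indicator_of_mem hx, indicator_of_mem (hω.2 hx)]; simp
  · rw [indicator_of_notMem hx, indicator_of_notMem (fun h => hx (hω.1 h))]; simp

variable [IsProbabilityMeasure P]

/-- Given a set `A` of values of the `K` smallest distances, all of them at most `s`, the points
at distance more than `s` are independent of the event that these distances lie in `A`. -/
theorem setLIntegral_eneg_of_le (h : IsPoissonProcess (pointMeasure Y) Lam P)
    (hY : ∀ k, Measurable (Y k)) (hρ : Measurable ρ)
    (hord : ∀ᵐ ω ∂P, StrictMono fun k => ρ (Y k ω)) {K : ℕ} {u : E → ℝ≥0∞} (hu : Measurable u)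
    (s : ℝ) {A : Set (Fin K → ℝ)} (hA : MeasurableSet A)
    (hAs : ∀ r ∈ A, Monotone r → ∀ j, r j ≤ s) :
    ∫⁻ ω in (fun ω (j : Fin K) => ρ (Y j ω)) ⁻¹' A,
        eneg (∑' l, {x | s < ρ x}.indicator u (Y l ω)) ∂P =
      P ((fun ω (j : Fin K) => ρ (Y j ω)) ⁻¹' A) *
        eneg (∫⁻ x in {x | s < ρ x}, (1 - eneg (u x)) ∂Lam) := by
  set R : Ω → Fin K → ℝ := fun ω j => ρ (Y j ω) with hRdef
  have hR : Measurable R := measurable_pi_lambda _ fun j => hρ.comp (hY _)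
  set c := eneg (∫⁻ x in {x | s < ρ x}, (1 - eneg (u x)) ∂Lam)
  set g : Ω → ℝ≥0∞ := fun ω => eneg (∑' l, {x | s < ρ x}.indicator u (Y l ω)) with hg
  have hs : MeasurableSet {x | s < ρ x} := measurableSet_lt measurable_const hρ
  have hgm : Measurable g := measurable_eneg.comp
    (Measurable.tsum fun l => (hu.indicator hs).comp (hY l))
  have hgfin : ∫⁻ ω, g ω ∂P ≠ ∞ := by
    refine ((lintegral_mono (g := fun _ => 1) fun ω => eneg_le_one _).trans_lt ?_).ne
    simp
  let D : Set (Fin K → ℝ) := {r | ∀ j, r j ≤ s}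
  have hD : MeasurableSet D := by
    have : D = ⋂ j : Fin K, {r | r j ≤ s} := by ext; simp [D]
    rw [this]
    exact MeasurableSet.iInter fun j => measurableSet_le (measurable_pi_apply j) measurable_const
  let μ₁ := ((P.withDensity g).map R).restrict D
  let μ₂ := c • ((P.map R).restrict D)
  have : IsFiniteMeasure (P.withDensity g) := isFiniteMeasure_withDensity hgfin
  have hμ₁ : ∀ B, MeasurableSet B → μ₁ B = ∫⁻ ω in R ⁻¹' (B ∩ D), g ω ∂P := by
    intro B hB
    rw [Measure.restrict_apply hB, Measure.map_apply hR (hB.inter hD),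
      withDensity_apply _ (hR (hB.inter hD))]
  have hμ₂ : ∀ B, MeasurableSet B → μ₂ B = P (R ⁻¹' (B ∩ D)) * c := by
    intro B hB
    rw [Measure.smul_apply, Measure.restrict_apply hB, Measure.map_apply hR (hB.inter hD),
      smul_eq_mul, mul_comm]
  -- The two finite measures agree on lower orthants, by independence of counts.
  have horth : ∀ t : Fin K → ℝ, (∀ j, t j ≤ s) →
      ∫⁻ ω in R ⁻¹' {r | ∀ j, r j ≤ t j}, g ω ∂P = P (R ⁻¹' {r | ∀ j, r j ≤ t j}) * c :=
    fun t ht => setLIntegral_eneg_of_Iic h hY hρ hord hu s t ht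
  have heq : μ₁ = μ₂ := by
    refine ext_of_generate_finite (pi univ '' pi univ fun _ => range Iic) ?_ ?_ ?_ ?_
    · refine (generateFrom_eq_pi (C := fun _ : Fin K => range (Iic : ℝ → Set ℝ)) ?_ ?_).symm
      · intro i; rw [← borel_eq_generateFrom_Iic]; exact (BorelSpace.measurable_eq).symm
      · intro i
        refine ⟨fun n : ℕ => Iic (n : ℝ), fun n => mem_range_self _, ?_⟩
        ext x; simpa using exists_nat_ge x
    · exact IsPiSystem.pi fun i => isPiSystem_Iic
    · rintro B ⟨C, hC, rfl⟩
      choose a ha using fun i => hC i (mem_univ i)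
      have hBm : MeasurableSet (pi univ C) := by
        refine MeasurableSet.univ_pi fun i => ?_
        rw [← ha i]; exact measurableSet_Iic
      have : pi univ C ∩ D = {r | ∀ j, r j ≤ min (a j) s} := by
        ext r
        simp only [mem_inter_iff, mem_univ_pi, ← ha, mem_Iic, D, mem_ofPred_eq, le_min_iff,
          forall_and]
      rw [hμ₁ _ hBm, hμ₂ _ hBm, this]
      exact horth _ fun j => min_le_right _ _
    · rw [hμ₁ _ .univ, hμ₂ _ .univ, univ_inter]
      exact horth (fun _ => s) fun _ => le_rfl
  have hAD : R ⁻¹' (A ∩ D) =ᵐ[P] R ⁻¹' A := by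
    filter_upwards [hord] with ω hω
    refine propext ⟨fun hx => hx.1, fun hx => ⟨hx, hAs _ hx ?_⟩⟩
    exact fun i j hij => hω.monotone hij
  rw [← setLIntegral_congr hAD, ← measure_congr hAD, ← hμ₁ A hA, heq, hμ₂ A hA]

/-- **Strong Markov property** of a Poisson process at its `K`-th nearest point: given the `K`
smallest distances, the remaining points form a Poisson process on the part of the space that
lies further away than the `K`-th point. -/
theorem setLIntegral_eneg_tsum_ge (h : IsPoissonProcess (pointMeasure Y) Lam P)
    (hY : ∀ k, Measurable (Y k)) (hρ : Measurable ρ)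
    (hord : ∀ᵐ ω ∂P, StrictMono fun k => ρ (Y k ω)) {K : ℕ} (hK : 0 < K) {u : E → ℝ≥0∞}
    (hu : Measurable u) {A : Set (Fin K → ℝ)} (hA : MeasurableSet A) :
    ∫⁻ ω in (fun ω (j : Fin K) => ρ (Y j ω)) ⁻¹' A,
        eneg (∑' l, if K ≤ l then u (Y l ω) else 0) ∂P =
      ∫⁻ ω in (fun ω (j : Fin K) => ρ (Y j ω)) ⁻¹' A,
        eneg (∫⁻ x in {x | ρ (Y (K - 1) ω) < ρ x}, (1 - eneg (u x)) ∂Lam) ∂P := by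
  set R : Ω → Fin K → ℝ := fun ω j => ρ (Y j ω) with hRdef
  have hR : Measurable R := measurable_pi_lambda _ fun j => hρ.comp (hY _)
  set V : ℝ → ℝ≥0∞ := fun t => ∫⁻ x in {x | t < ρ x}, (1 - eneg (u x)) ∂Lam with hV
  have hVm : Measurable V := by
    refine Antitone.measurable fun s t hst => lintegral_mono_set fun x hx => ?_
    exact lt_of_le_of_lt hst hx
  have hs : ∀ s : ℝ, MeasurableSet {x | s < ρ x} := fun s => measurableSet_lt measurable_const hρ
  let Q : Ω → ℝ := fun ω => ρ (Y (K - 1) ω)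
  have hQ : Measurable Q := hρ.comp (hY _)
  -- Discretisation of the `K`-th distance from above.
  let N : ℕ → Ω → ℤ := fun n ω => ⌈((n : ℝ) + 1) * Q ω⌉
  let τ : ℕ → Ω → ℝ := fun n ω => (N n ω : ℝ) / ((n : ℝ) + 1)
  have hN : ∀ n, Measurable (N n) := fun n => (measurable_const.mul hQ).ceil
  have hτm : ∀ n, Measurable (τ n) := fun n =>
    ((measurable_from_top (f := fun z : ℤ => (z : ℝ))).comp (hN n)).div_const _
  have hpos : ∀ n : ℕ, (0 : ℝ) < (n : ℝ) + 1 := fun n => by positivity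
  have hτge : ∀ n ω, Q ω ≤ τ n ω := fun n ω => by
    rw [le_div_iff₀ (hpos n), mul_comm]; exact Int.le_ceil _
  have hτle : ∀ n ω, τ n ω ≤ Q ω + 1 / ((n : ℝ) + 1) := fun n ω => by
    rw [div_le_iff₀ (hpos n), add_mul, div_mul_cancel₀ _ (hpos n).ne', mul_comm (Q ω)]
    exact (Int.ceil_lt_add_one _).le
  have hτlim : ∀ ω, Tendsto (fun n => τ n ω) atTop (𝓝 (Q ω)) := fun ω => by
    refine tendsto_of_tendsto_of_tendsto_of_le_of_le tendsto_const_nhds ?_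
      (fun n => hτge n ω) (fun n => hτle n ω)
    simpa using tendsto_const_nhds.add (tendsto_one_div_add_atTop_nhds_zero_nat (𝕜 := ℝ))
  have hdisc : ∀ n, ∫⁻ ω in R ⁻¹' A, eneg (∑' l, {x | τ n ω < ρ x}.indicator u (Y l ω)) ∂P =
      ∫⁻ ω in R ⁻¹' A, eneg (V (τ n ω)) ∂P := by
    intro n
    have hU : R ⁻¹' A = ⋃ i : ℤ, R ⁻¹' A ∩ N n ⁻¹' {i} := by
      rw [← inter_iUnion, ← preimage_iUnion, iUnion_of_singleton, preimage_univ, inter_univ]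
    have hUm : ∀ i : ℤ, MeasurableSet (R ⁻¹' A ∩ N n ⁻¹' {i}) := fun i =>
      (hR hA).inter (hN n (measurableSet_singleton i))
    have hUd : Pairwise (Function.onFun Disjoint fun i : ℤ => R ⁻¹' A ∩ N n ⁻¹' {i}) := by
      intro i j hij
      refine Disjoint.mono inter_subset_right inter_subset_right ?_
      exact Disjoint.preimage _ (by simpa using hij)
    rw [hU, lintegral_iUnion hUm hUd, lintegral_iUnion hUm hUd]
    refine tsum_congr fun i => ?_
    have hτi : ∀ ω ∈ R ⁻¹' A ∩ N n ⁻¹' {i}, τ n ω = (i : ℝ) / ((n : ℝ) + 1) := by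
      rintro ω ⟨-, hω⟩
      have : N n ω = i := hω
      simp only [τ, this]
    rw [setLIntegral_congr_fun (g := fun ω => eneg (∑' l,
        {x | (i : ℝ) / ((n : ℝ) + 1) < ρ x}.indicator u (Y l ω))) (hUm i)
        (fun ω hω => by simp only [hτi ω hω]),
      setLIntegral_congr_fun (f := fun ω => eneg (V (τ n ω)))
        (g := fun _ => eneg (V ((i : ℝ) / ((n : ℝ) + 1)))) (hUm i)
        (fun ω hω => by simp only [hτi ω hω]), setLIntegral_const]
    let last : Fin K := ⟨K - 1, Nat.sub_lt hK Nat.one_pos⟩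
    have hset : R ⁻¹' A ∩ N n ⁻¹' {i} =
        R ⁻¹' (A ∩ {r | ⌈((n : ℝ) + 1) * r last⌉ = i}) := rfl
    have hAi : MeasurableSet (A ∩ {r : Fin K → ℝ | ⌈((n : ℝ) + 1) * r last⌉ = i}) :=
      hA.inter ((measurable_const.mul (measurable_pi_apply last)).ceil (measurableSet_singleton i))
    rw [hset, mul_comm]
    refine setLIntegral_eneg_of_le h hY hρ hord hu _ hAi ?_
    rintro r ⟨-, hr⟩ hmono j
    have hr : ⌈((n : ℝ) + 1) * r last⌉ = i := hr
    have hj : j ≤ last := Fin.le_def.2 (Nat.le_sub_one_of_lt j.2)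
    refine (hmono hj).trans ?_
    rw [le_div_iff₀ (hpos n), mul_comm, ← hr]
    exact Int.le_ceil _
  have hL := tendsto_lintegral_mul_eneg (P := P.restrict (R ⁻¹' A)) (g := 1)
    (F := fun n ω => ∑' l, {x | τ n ω < ρ x}.indicator u (Y l ω))
    (f := fun ω => ∑' l, if K ≤ l then u (Y l ω) else 0) measurable_one (fun _ => le_rfl)
    (fun n => Measurable.tsum fun l => ?_) ?_
  · have hr := tendsto_lintegral_mul_eneg (P := P.restrict (R ⁻¹' A)) (g := 1)
      (F := fun n ω => V (τ n ω)) (f := fun ω => V (Q ω)) measurable_one (fun _ => le_rfl)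
      (fun n => hVm.comp (hτm n)) (Eventually.of_forall fun ω =>
        tendsto_lintegral_restrict_of_ge (by fun_prop) hρ (fun n => hτge n ω) (hτlim ω))
    simp only [Pi.one_apply, one_mul] at hL hr
    simp_rw [hdisc] at hL
    exact tendsto_nhds_unique hL hr
  · have : (fun ω => {x | τ n ω < ρ x}.indicator u (Y l ω)) =
        {ω | τ n ω < ρ (Y l ω)}.indicator fun ω => u (Y l ω) := rfl
    rw [this]
    exact (hu.comp (hY l)).indicator (measurableSet_lt (hτm n) (hρ.comp (hY l)))
  · refine ae_restrict_of_ae ?_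
    filter_upwards [hord] with ω hω
    refine tendsto_const_nhds.congr' ?_
    have hlt : Q ω < ρ (Y K ω) := hω (Nat.sub_lt hK Nat.one_pos)
    filter_upwards [(hτlim ω).eventually_lt_const hlt] with n hn
    refine tsum_congr fun l => ?_
    split_ifs with hl
    · rw [indicator_of_mem]
      exact hn.trans_le (hω.monotone hl)
    · rw [indicator_of_notMem]
      have : ρ (Y l ω) ≤ Q ω := hω.monotone (Nat.le_sub_one_of_lt (not_le.1 hl))
      exact not_lt.2 (this.trans (hτge n ω))

end PointMeasure

/-! ### The joint law of the smallest distances -/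

/-- The last entry of `r`, or `0` if `r` is empty. -/
noncomputable def lastDist (K : ℕ) (r : Fin K → ℝ) : ℝ :=
  if h : 0 < K then r ⟨K - 1, Nat.sub_lt h Nat.one_pos⟩ else 0

@[fun_prop] theorem measurable_lastDist (K : ℕ) : Measurable (lastDist K) := by
  unfold lastDist
  split_ifs with h
  · exact measurable_pi_apply _
  · exact measurable_const

/-- The `K`-tuples of positive, weakly increasing distances. -/
def orderedDist (K : ℕ) : Set (Fin K → ℝ) := {r | (∀ k, 0 < r k) ∧ Monotone r}

theorem measurableSet_orderedDist (K : ℕ) : MeasurableSet (orderedDist K) := by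
  have : orderedDist K = (⋂ k, {r | 0 < r k}) ∩ ⋂ i, ⋂ j, ⋂ _ : i ≤ j, {r | r i ≤ r j} := by
    ext r; simp [orderedDist, Monotone]
  rw [this]
  refine (MeasurableSet.iInter fun k => measurableSet_lt measurable_const
    (measurable_pi_apply k)).inter ?_
  exact MeasurableSet.iInter fun i => MeasurableSet.iInter fun j => MeasurableSet.iInter fun _ =>
    measurableSet_le (measurable_pi_apply i) (measurable_pi_apply j)

theorem lastDist_nonneg {K : ℕ} {r : Fin K → ℝ} (h : ∀ k, 0 ≤ r k) : 0 ≤ lastDist K r := by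
  unfold lastDist
  split_ifs with hK
  · exact h _
  · exact le_rfl

/-- The joint density of the `K` smallest distances, for a Poisson process with `c * t ^ 2`
expected points in the ball of radius `t`. -/
noncomputable def orderedDensity (c : ℝ) (K : ℕ) (r : Fin K → ℝ) : ℝ≥0∞ :=
  (orderedDist K).indicator
    (fun r => ENNReal.ofReal ((2 * c) ^ K * (∏ k, r k) * Real.exp (-c * lastDist K r ^ 2))) r

/-- The conditional density of the next distance, given that the last one is `s`. -/
noncomputable def nextDensity (c s x : ℝ) : ℝ≥0∞ :=
  {x | 0 < x ∧ s ≤ x}.indicator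
    (fun x => ENNReal.ofReal (2 * c * x * Real.exp (-c * (x ^ 2 - s ^ 2)))) x

theorem measurable_orderedDensity (c : ℝ) (K : ℕ) : Measurable (orderedDensity c K) := by
  refine Measurable.indicator ?_ (measurableSet_orderedDist K)
  have := measurable_lastDist K
  fun_prop

theorem measurable_nextDensity (c : ℝ) : Measurable fun q : ℝ × ℝ => nextDensity c q.1 q.2 := by
  have : (fun q : ℝ × ℝ => nextDensity c q.1 q.2) = {q : ℝ × ℝ | 0 < q.2 ∧ q.1 ≤ q.2}.indicator
      fun q => ENNReal.ofReal (2 * c * q.2 * Real.exp (-c * (q.2 ^ 2 - q.1 ^ 2))) := rfl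
  rw [this]
  refine Measurable.indicator (by fun_prop) ?_
  exact (measurableSet_lt measurable_const measurable_snd).inter
    (measurableSet_le measurable_fst measurable_snd)

theorem lintegral_Ioi_gaussian {c : ℝ} (hc : 0 < c) {a : ℝ} (ha : 0 ≤ a) (s : ℝ) :
    ∫⁻ x in Ioi a, ENNReal.ofReal (2 * c * x * Real.exp (-c * (x ^ 2 - s ^ 2))) =
      ENNReal.ofReal (Real.exp (-c * (a ^ 2 - s ^ 2))) := by
  have hd : ∀ x ∈ Ici a, HasDerivAt (fun x => -Real.exp (-c * (x ^ 2 - s ^ 2)))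
      (2 * c * x * Real.exp (-c * (x ^ 2 - s ^ 2))) x := by
    intro x _
    have h1 : HasDerivAt (fun x : ℝ => -c * (x ^ 2 - s ^ 2)) (-c * (2 * x)) x := by
      simpa using ((hasDerivAt_pow 2 x).sub_const (s ^ 2)).const_mul (-c)
    have h2 := h1.exp.neg
    have e : -(Real.exp (-c * (x ^ 2 - s ^ 2)) * (-c * (2 * x))) =
        2 * c * x * Real.exp (-c * (x ^ 2 - s ^ 2)) := by ring
    rw [e] at h2
    exact h2
  have hpos : ∀ x ∈ Ioi a, 0 ≤ 2 * c * x * Real.exp (-c * (x ^ 2 - s ^ 2)) := by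
    intro x hx
    have : 0 ≤ x := ha.trans (le_of_lt hx)
    positivity
  have hlim : Tendsto (fun x => -Real.exp (-c * (x ^ 2 - s ^ 2))) atTop (𝓝 0) := by
    rw [← neg_zero]
    refine (Real.tendsto_exp_atBot.comp ?_).neg
    refine Tendsto.const_mul_atTop_of_neg (by linarith) ?_
    exact tendsto_atTop_add_const_right _ _ (tendsto_pow_atTop two_ne_zero)
  have hint := integrableOn_Ioi_deriv_of_nonneg' hd hpos hlim
  rw [← ofReal_integral_eq_lintegral_ofReal hint
    ((ae_restrict_iff' measurableSet_Ioi).2 (Eventually.of_forall hpos)),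
    integral_Ioi_of_hasDerivAt_of_nonneg' hd hpos hlim]
  simp

/-- The tail of the conditional law of the next distance: no point lies between `s` and
`max t s`. -/
theorem lintegral_nextDensity {c : ℝ} (hc : 0 < c) {s : ℝ} (hs : 0 ≤ s) (t : ℝ) :
    ∫⁻ x in Ioi t, nextDensity c s x = eneg (ENNReal.ofReal (c * (max t s ^ 2 - s ^ 2))) := by
  have hm : MeasurableSet {x : ℝ | 0 < x ∧ s ≤ x} :=
    (measurableSet_lt measurable_const measurable_id).inter
      (measurableSet_le measurable_const measurable_id)
  have h1 : ∫⁻ x in Ioi t, nextDensity c s x = ∫⁻ x in {x : ℝ | 0 < x ∧ s ≤ x} ∩ Ioi t,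
      ENNReal.ofReal (2 * c * x * Real.exp (-c * (x ^ 2 - s ^ 2))) := by
    simp only [nextDensity]
    rw [setLIntegral_indicator hm]
  have h2 : ({x : ℝ | 0 < x ∧ s ≤ x} ∩ Ioi t : Set ℝ) =ᵐ[volume] Ioi (max t s) := by
    have : ∀ᵐ x : ℝ, x ≠ s := by simp [ae_iff, measure_singleton]
    filter_upwards [this] with x hx
    refine propext ⟨fun h => max_lt h.2 (lt_of_le_of_ne h.1.2 hx.symm), fun h => ?_⟩
    have h' : t < x ∧ s < x := max_lt_iff.1 h
    exact ⟨⟨hs.trans_lt h'.2, h'.2.le⟩, h'.1⟩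
  have hms : s ≤ max t s := le_max_right _ _
  rw [h1, setLIntegral_congr h2, lintegral_Ioi_gaussian hc (hs.trans hms), eneg_ofReal]
  · congr 2; ring
  · have : s ^ 2 ≤ max t s ^ 2 := by gcongr
    exact mul_nonneg hc.le (by linarith)

theorem orderedDensity_succ {c : ℝ} (hc : 0 < c) (K : ℕ) (r : Fin (K + 1) → ℝ) :
    orderedDensity c (K + 1) r = orderedDensity c K (fun k => r k.castSucc) *
      nextDensity c (lastDist K fun k => r k.castSucc) (r (Fin.last K)) := by
  have hlast : lastDist (K + 1) r = r (Fin.last K) := by simp [lastDist, Fin.last]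
  have hiff : r ∈ orderedDist (K + 1) ↔ (fun k : Fin K => r k.castSucc) ∈ orderedDist K ∧
      (0 < r (Fin.last K) ∧ lastDist K (fun k => r k.castSucc) ≤ r (Fin.last K)) := by
    constructor
    · rintro ⟨h0, hm⟩
      refine ⟨⟨fun k => h0 _, fun i j hij => hm (by simpa using hij)⟩, h0 _, ?_⟩
      unfold lastDist
      split_ifs
      · exact hm (Fin.le_last _)
      · exact (h0 _).le
    · rintro ⟨⟨h0, hm⟩, hl0, hl⟩
      refine ⟨fun k => Fin.lastCases hl0 h0 k, ?_⟩
      intro i j hij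
      induction j using Fin.lastCases with
      | last =>
        induction i using Fin.lastCases with
        | last => exact le_rfl
        | cast i =>
          refine le_trans ?_ hl
          have hK : 0 < K := i.pos
          simp only [lastDist, hK, dif_pos]
          exact hm (Fin.le_def.2 (Nat.le_sub_one_of_lt i.2))
      | cast j =>
        induction i using Fin.lastCases with
        | last => exact absurd hij (by simp)
        | cast i => exact hm (by simpa using hij)
  unfold orderedDensity nextDensity
  by_cases h : r ∈ orderedDist (K + 1)
  · obtain ⟨h1, h2⟩ := hiff.1 h
    rw [indicator_of_mem h, indicator_of_mem h1, indicator_of_mem (by exact h2),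
      ← ENNReal.ofReal_mul ?_]
    · congr 1
      rw [hlast, Fin.prod_univ_castSucc, pow_succ]
      have : Real.exp (-c * r (Fin.last K) ^ 2) =
          Real.exp (-c * lastDist K (fun k => r k.castSucc) ^ 2) *
          Real.exp (-c * (r (Fin.last K) ^ 2 - lastDist K (fun k => r k.castSucc) ^ 2)) := by
        rw [← Real.exp_add]; congr 1; ring
      rw [this]; ring
    · have : 0 ≤ ∏ k : Fin K, r k.castSucc := Finset.prod_nonneg fun k _ => (h1.1 k).le
      positivity
  · rw [indicator_of_notMem h]
    by_cases h1 : (fun k : Fin K => r k.castSucc) ∈ orderedDist K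
    · rw [indicator_of_notMem (s := {x : ℝ | 0 < x ∧ _}) (fun h2 => h (hiff.2 ⟨h1, h2⟩)), mul_zero]
    · rw [indicator_of_notMem h1, zero_mul]

section PointMeasure

variable {Ω E : Type*} [MeasurableSpace Ω] [MeasurableSpace E]
variable {Y : ℕ → Ω → E} {Lam : Measure E} {P : Measure Ω} [SigmaFinite Lam]
  [IsProbabilityMeasure P] {ρ : E → ℝ}

/-- The conditional law of the next distance, given the `K` smallest ones. -/
theorem measure_inter_next_gt (h : IsPoissonProcess (pointMeasure Y) Lam P)
    (hY : ∀ k, Measurable (Y k)) (hρ : Measurable ρ)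
    (hord : ∀ᵐ ω ∂P, StrictMono fun k => ρ (Y k ω)) (hnn : ∀ k ω, 0 ≤ ρ (Y k ω)) {c : ℝ}
    (hLam : ∀ s t, 0 ≤ s → s ≤ t →
      Lam {x | s < ρ x ∧ ρ x ≤ t} = ENNReal.ofReal (c * (t ^ 2 - s ^ 2)))
    (hLam0 : Lam {x | ρ x ≤ 0} = 0) (K : ℕ) {A : Set (Fin K → ℝ)} (hA : MeasurableSet A) (t : ℝ) :
    P ((fun ω (j : Fin K) => ρ (Y j ω)) ⁻¹' A ∩ {ω | t < ρ (Y K ω)}) =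
      ∫⁻ ω in (fun ω (j : Fin K) => ρ (Y j ω)) ⁻¹' A,
        eneg (ENNReal.ofReal (c * (max t (lastDist K fun j => ρ (Y j ω)) ^ 2 -
          (lastDist K fun j => ρ (Y j ω)) ^ 2))) ∂P := by
  set R : Ω → Fin K → ℝ := fun ω j => ρ (Y j ω) with hRdef
  have hR : Measurable R := measurable_pi_lambda _ fun j => hρ.comp (hY _)
  have hct : MeasurableSet {x | ρ x ≤ t} := measurableSet_le hρ measurable_const
  -- With infinite weight on `{ρ ≤ t}`, the Laplace functional is the probability of no points.
  let u : E → ℝ≥0∞ := {x | ρ x ≤ t}.indicator fun _ => ∞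
  have hu : Measurable u := measurable_const.indicator hct
  have hgt : MeasurableSet {ω | t < ρ (Y K ω)} := measurableSet_lt measurable_const (hρ.comp (hY K))
  have hue : ∀ x, 1 - eneg (u x) = {x | ρ x ≤ t}.indicator 1 x := by
    intro x
    by_cases hx : x ∈ {x | ρ x ≤ t}
    · simp only [u]; rw [indicator_of_mem hx, indicator_of_mem hx]; simp
    · simp only [u]; rw [indicator_of_notMem hx, indicator_of_notMem hx]; simp
  have hV : ∀ s, ∫⁻ x in {x | s < ρ x}, (1 - eneg (u x)) ∂Lam = Lam {x | s < ρ x ∧ ρ x ≤ t} := by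
    intro s
    simp_rw [hue]
    rw [setLIntegral_indicator hct]
    simp only [Pi.one_apply, lintegral_const, MeasurableSet.univ, Measure.restrict_apply,
      univ_inter, one_mul]
    congr 1; ext x; exact and_comm
  have hLam' : ∀ s, 0 ≤ s → Lam {x | s < ρ x ∧ ρ x ≤ t} =
      ENNReal.ofReal (c * (max t s ^ 2 - s ^ 2)) := by
    intro s hs
    rcases le_total s t with hst | hst
    · rw [hLam s t hs hst, max_eq_left hst]
    · rw [max_eq_right hst]
      have : {x | s < ρ x ∧ ρ x ≤ t} = ∅ := by
        ext x; simp only [mem_ofPred_eq, mem_empty_iff_false, iff_false, not_and, not_le]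
        intro hx; exact hst.trans_lt hx
      simp [this]
  have hsum : ∀ᵐ ω ∂P, eneg (∑' l, if K ≤ l then u (Y l ω) else 0) =
      {ω | t < ρ (Y K ω)}.indicator 1 ω := by
    filter_upwards [hord] with ω hω
    by_cases hx : ω ∈ {ω | t < ρ (Y K ω)}
    · rw [indicator_of_mem hx]
      have : (∑' l, if K ≤ l then u (Y l ω) else 0) = 0 := by
        rw [ENNReal.tsum_eq_zero]
        intro l
        split_ifs with hl
        · refine indicator_of_notMem ?_ _
          exact not_le.2 (lt_of_lt_of_le hx (hω.monotone hl))
        · rfl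
      simp [this]
    · rw [indicator_of_notMem hx]
      have : (∑' l, if K ≤ l then u (Y l ω) else 0) = ∞ := by
        refine ENNReal.tsum_eq_top_of_eq_top ⟨K, ?_⟩
        simp only [le_refl, if_true]
        have hx' : Y K ω ∈ {x | ρ x ≤ t} := not_lt.1 (show ¬ t < ρ (Y K ω) from hx)
        exact indicator_of_mem hx' _
      simp [this]
  have hlhs : P (R ⁻¹' A ∩ {ω | t < ρ (Y K ω)}) =
      ∫⁻ ω in R ⁻¹' A, eneg (∑' l, if K ≤ l then u (Y l ω) else 0) ∂P := by
    rw [lintegral_congr_ae (ae_restrict_of_ae hsum), lintegral_indicator_one hgt,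
      Measure.restrict_apply hgt, inter_comm]
  rw [hlhs]
  rcases Nat.eq_zero_or_pos K with rfl | hK
  · have hlast : ∀ r : Fin 0 → ℝ, lastDist 0 r = 0 := fun r => rfl
    simp_rw [hlast, ← hLam' 0 le_rfl]
    rcases A.eq_empty_or_nonempty with rfl | hne
    · simp
    · have hall : A = univ := Subsingleton.eq_univ_of_nonempty hne
      have h1 := setLIntegral_eneg_of_Iic (K := 0) h hY hρ hord hu (-1) (fun _ => 0) (by simp)
      rw [hall, preimage_univ, Measure.restrict_univ]
      simp only [IsEmpty.forall_iff, ofPred_true, Measure.restrict_univ, measure_univ,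
        one_mul] at h1
      have h2 : ∀ ω, (∑' l, {x | -1 < ρ x}.indicator u (Y l ω)) =
          ∑' l, if 0 ≤ l then u (Y l ω) else 0 := by
        intro ω
        refine tsum_congr fun l => ?_
        rw [if_pos (Nat.zero_le _), indicator_of_mem]
        exact lt_of_lt_of_le (by norm_num) (hnn l ω)
      simp_rw [h2] at h1
      rw [h1, lintegral_const, measure_univ, mul_one, hV]
      congr 1
      refine measure_congr ?_
      have h0 : ∀ᵐ x ∂Lam, ¬ ρ x ≤ 0 := by
        rw [ae_iff]; simpa using hLam0
      filter_upwards [h0] with x hx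
      refine propext ⟨fun hx' => ⟨not_le.1 hx, hx'.2⟩, fun hx' => ⟨?_, hx'.2⟩⟩
      exact lt_trans (by norm_num) hx'.1
  · rw [setLIntegral_eneg_tsum_ge h hY hρ hord hK hu hA]
    refine lintegral_congr fun ω => ?_
    have hl : lastDist K (R ω) = ρ (Y (K - 1) ω) := by simp [lastDist, hK, R]
    rw [hV, hLam' _ (hnn _ _), ← hl]

/-- The joint density of the `K` smallest distances of a Poisson process with `c * t ^ 2` expected
points in the ball of radius `t`. -/
theorem map_dist_eq_withDensity (h : IsPoissonProcess (pointMeasure Y) Lam P)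
    (hY : ∀ k, Measurable (Y k)) (hρ : Measurable ρ)
    (hord : ∀ᵐ ω ∂P, StrictMono fun k => ρ (Y k ω)) (hnn : ∀ k ω, 0 ≤ ρ (Y k ω)) {c : ℝ}
    (hc : 0 < c)
    (hLam : ∀ s t, 0 ≤ s → s ≤ t →
      Lam {x | s < ρ x ∧ ρ x ≤ t} = ENNReal.ofReal (c * (t ^ 2 - s ^ 2)))
    (hLam0 : Lam {x | ρ x ≤ 0} = 0) (K : ℕ) :
    P.map (fun ω (j : Fin K) => ρ (Y j ω)) = volume.withDensity (orderedDensity c K) := by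
  have hR : ∀ K : ℕ, Measurable fun ω (j : Fin K) => ρ (Y j ω) :=
    fun K => measurable_pi_lambda _ fun j => hρ.comp (hY _)
  induction K with
  | zero =>
    have hm : MeasurableSet (univ : Set (Fin 0 → ℝ)) := .univ
    have h1 : ∀ r, orderedDensity c 0 r = 1 := by
      intro r
      have : r ∈ orderedDist 0 := ⟨fun k => k.elim0, fun i => i.elim0⟩
      rw [orderedDensity, indicator_of_mem this]
      simp [lastDist]
    ext A hA
    rcases A.eq_empty_or_nonempty with rfl | hne
    · simp
    · rw [Subsingleton.eq_univ_of_nonempty hne, Measure.map_apply (hR 0) hm, preimage_univ,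
        measure_univ, withDensity_apply _ hm]
      simp [h1, volume_pi]
  | succ K ih =>
    let e := MeasurableEquiv.piFinSuccAbove (fun _ : Fin (K + 1) => ℝ) (Fin.last K)
    have he : MeasurePreserving e := volume_preserving_piFinSuccAbove _ _
    have heR : ∀ ω, e (fun j : Fin (K + 1) => ρ (Y j ω)) =
        (ρ (Y K ω), fun j : Fin K => ρ (Y j ω)) := by
      intro ω
      refine Prod.ext ?_ ?_
      · simp [e]
      · funext j
        simp [e, Fin.init]
    let f : ℝ × (Fin K → ℝ) → ℝ≥0∞ := fun q =>
      orderedDensity c K q.2 * nextDensity c (lastDist K q.2) q.1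
    have hnext : Measurable fun q : ℝ × (Fin K → ℝ) => nextDensity c (lastDist K q.2) q.1 :=
      (measurable_nextDensity c).comp (((measurable_lastDist K).comp measurable_snd).prodMk
        measurable_fst)
    have hf : Measurable f := ((measurable_orderedDensity c K).comp measurable_snd).mul hnext
    have hfe : ∀ r, orderedDensity c (K + 1) r = f (e r) := by
      intro r
      rw [orderedDensity_succ hc]
      simp only [f, e, MeasurableEquiv.piFinSuccAbove_apply]
      simp [Fin.insertNthEquiv, Fin.init_def]
    have hZm : Measurable fun ω => (ρ (Y K ω), fun j : Fin K => ρ (Y j ω)) :=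
      (hρ.comp (hY K)).prodMk (hR K)
    have hrect : ∀ (t : ℝ) (A : Set (Fin K → ℝ)), MeasurableSet A →
        P.map (fun ω => (ρ (Y K ω), fun j : Fin K => ρ (Y j ω))) (Ioi t ×ˢ A) =
          (volume.withDensity f) (Ioi t ×ˢ A) := by
      intro t A hA
      have hm : MeasurableSet (Ioi t ×ˢ A) := measurableSet_Ioi.prod hA
      rw [Measure.map_apply hZm hm, withDensity_apply _ hm]
      have hset : (fun ω => (ρ (Y K ω), fun j : Fin K => ρ (Y j ω))) ⁻¹' (Ioi t ×ˢ A) =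
          (fun ω (j : Fin K) => ρ (Y j ω)) ⁻¹' A ∩ {ω | t < ρ (Y K ω)} := by
        ext ω; exact and_comm
      rw [hset, measure_inter_next_gt h hY hρ hord hnn hLam hLam0 K hA t]
      have hg : Measurable fun r : Fin K → ℝ => eneg (ENNReal.ofReal
          (c * (max t (lastDist K r) ^ 2 - lastDist K r ^ 2))) := by
        have := measurable_lastDist K
        fun_prop
      rw [← setLIntegral_map (f := fun r => eneg (ENNReal.ofReal
        (c * (max t (lastDist K r) ^ 2 - lastDist K r ^ 2)))) hA hg (hR K), ih,
        setLIntegral_withDensity_eq_setLIntegral_mul _ (measurable_orderedDensity c K) hg hA,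
        Measure.volume_eq_prod, ← Measure.prod_restrict, lintegral_prod_symm' _ hf]
      refine lintegral_congr fun r => ?_
      simp only [f, Pi.mul_apply]
      have hn : Measurable fun x => nextDensity c (lastDist K r) x :=
        (measurable_nextDensity c).comp measurable_prodMk_left
      rw [lintegral_const_mul _ hn]
      by_cases hr : r ∈ orderedDist K
      · rw [lintegral_nextDensity hc (lastDist_nonneg fun k => (hr.1 k).le)]
      · rw [orderedDensity, indicator_of_notMem hr, zero_mul, zero_mul]
    have hspan : (⋃ n : ℕ, Ioi (-(n : ℝ))) = univ := by
      ext x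
      simp only [mem_iUnion, mem_Ioi, mem_univ, iff_true]
      obtain ⟨n, hn⟩ := exists_nat_gt (-x)
      exact ⟨n, by linarith⟩
    have hprod : P.map (fun ω => (ρ (Y K ω), fun j : Fin K => ρ (Y j ω))) =
        volume.withDensity f := by
      have := Measure.isProbabilityMeasure_map (μ := P) hZm.aemeasurable
      refine Measure.ext_of_generateFrom_of_iUnion
        (image2 (· ×ˢ ·) (range Ioi) {A | MeasurableSet A})
        (fun n : ℕ => Ioi (-(n : ℝ)) ×ˢ univ) ?_ ?_ ?_ ?_ (fun _ => measure_ne_top _ _) ?_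
      · refine (generateFrom_eq_prod ?_ MeasurableSpace.generateFrom_measurableSet ?_
          isCountablySpanning_measurableSet).symm
        · rw [← borel_eq_generateFrom_Ioi]; exact (BorelSpace.measurable_eq).symm
        · exact ⟨fun n : ℕ => Ioi (-(n : ℝ)), fun n => mem_range_self _, hspan⟩
      · exact isPiSystem_Ioi.prod MeasurableSpace.isPiSystem_measurableSet
      · rw [← iUnion_prod_const, hspan, univ_prod_univ]
      · intro n
        exact ⟨_, mem_range_self _, univ, by simp, rfl⟩
      · rintro _ ⟨_, ⟨t, rfl⟩, A, hA, rfl⟩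
        exact hrect t A hA
    have hmap : P.map (fun ω (j : Fin (K + 1)) => ρ (Y j ω)) =
        (volume.withDensity f).map e.symm := by
      rw [← hprod, Measure.map_map e.symm.measurable hZm]
      congr 1
      funext ω
      simp only [Function.comp, ← heR, MeasurableEquiv.symm_apply_apply]
    rw [hmap]
    ext B hB
    rw [Measure.map_apply e.symm.measurable hB,
      withDensity_apply _ (e.symm.measurable hB), withDensity_apply _ hB,
      ← he.setLIntegral_comp_preimage (e.symm.measurable hB) hf, ← preimage_comp]
    simp [hfe]

end PointMeasure

/-! ### The access points as one Poisson process of distances and types -/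

/-- Polar coordinates in the plane, for radial functions. -/
theorem lintegral_norm_plane {f : ℝ → ℝ≥0∞} (hf : Measurable f) :
    ∫⁻ x : Plane, f ‖x‖ = ∫⁻ r in Ioi (0 : ℝ), ENNReal.ofReal (2 * Real.pi * r) * f r := by
  let μ : Measure Plane := volume
  have hdim : Module.finrank ℝ Plane = 2 := by simp
  have hball : μ (Metric.ball 0 1) = ENNReal.ofReal Real.pi := by
    simp [μ]
  calc ∫⁻ x : Plane, f ‖x‖
      = ∫⁻ x : ({(0)}ᶜ : Set Plane), f ‖x.1‖ ∂(μ.comap (↑)) := by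
        rw [lintegral_subtype_comap (measurableSet_singleton (0 : Plane)).compl fun x => f ‖x‖,
          restrict_compl_singleton]
    _ = ∫⁻ q, f q.2 ∂μ.toSphere.prod (.volumeIoiPow (Module.finrank ℝ Plane - 1)) := by
        rw [← μ.measurePreserving_homeomorphUnitSphereProd.lintegral_comp (by fun_prop)]
        simp
    _ = μ.toSphere univ *
          ∫⁻ r : Ioi (0 : ℝ), f r ∂(.volumeIoiPow (Module.finrank ℝ Plane - 1)) := by
        rw [lintegral_prod _ (by fun_prop)]
        simp only [lintegral_const]
        rw [mul_comm]
    _ = _ := by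
        rw [μ.toSphere_apply_univ, hball, hdim, Measure.volumeIoiPow,
          lintegral_withDensity_eq_lintegral_mul _ (by fun_prop) (by fun_prop)]
        simp only [Pi.mul_apply]
        have h1 : ∫⁻ r : Ioi (0 : ℝ), ENNReal.ofReal ((r : ℝ) ^ (2 - 1)) * f r
            ∂(Measure.comap Subtype.val volume) =
            ∫⁻ r in Ioi (0 : ℝ), ENNReal.ofReal (r ^ (2 - 1)) * f r :=
          lintegral_subtype_comap measurableSet_Ioi fun r => ENNReal.ofReal (r ^ (2 - 1)) * f r
        rw [h1, ← lintegral_const_mul _ (by fun_prop)]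
        refine setLIntegral_congr_fun measurableSet_Ioi fun r hr => ?_
        have hr : 0 < r := hr
        rw [← mul_assoc]
        congr 1
        rw [ENNReal.ofReal_mul (by positivity), ENNReal.ofReal_mul (by positivity)]
        simp

namespace VCParams

variable (N : VCParams)

/-- The probability that an access point at distance `r` is of the given type (`true` for LOS). -/
noncomputable def typeProb (c : Bool) (r : ℝ) : ℝ := if c then N.p r else 1 - N.p r

/-- The path loss of a link of length `r` of the given type (`true` for LOS). -/
noncomputable def pathLoss (c : Bool) (r : ℝ) : ℝ := if c then N.pathLossL r else N.pathLossN r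

/-- The density of the intensity measure of distances and types of the access points. -/
noncomputable def radialDensity (c : Bool) (r : ℝ) : ℝ :=
  2 * Real.pi * N.lam * N.typeProb c r * r

/-- The intensity measure of the process of distances and types of the access points. -/
noncomputable def radialIntensity : Measure (ℝ × Bool) :=
  ((volume.restrict (Ioi 0)).prod Measure.count).withDensity
    fun q => ENNReal.ofReal (N.radialDensity q.2 q.1)

instance : SigmaFinite N.radialIntensity := by
  unfold radialIntensity; exact SigmaFinite.withDensity_ofReal _

@[fun_prop] theorem measurable_p : Measurable N.p := by unfold p; fun_prop

theorem p_pos (r : ℝ) : 0 < N.p r := Real.exp_pos _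

theorem p_le_one {r : ℝ} (hr : 0 ≤ r) : N.p r ≤ 1 := by
  refine Real.exp_le_one_iff.2 ?_
  have := mul_nonneg N.beta_nonneg hr
  linarith

theorem typeProb_nonneg (c : Bool) {r : ℝ} (hr : 0 ≤ r) : 0 ≤ N.typeProb c r := by
  cases c
  · simpa [typeProb] using N.p_le_one hr
  · exact (N.p_pos r).le

@[fun_prop] theorem measurable_typeProb (c : Bool) : Measurable (N.typeProb c) := by
  unfold typeProb; cases c <;> simp <;> fun_prop

theorem measurable_radialDensity : Measurable fun q : ℝ × Bool => N.radialDensity q.2 q.1 := by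
  refine measurable_from_prod_countable_left fun c => ?_
  simp only [radialDensity]
  fun_prop

theorem lintegral_radialIntensity {g : ℝ × Bool → ℝ≥0∞} (hg : Measurable g) :
    ∫⁻ q, g q ∂N.radialIntensity =
      ∑ c, ∫⁻ r in Ioi (0 : ℝ), ENNReal.ofReal (N.radialDensity c r) * g (r, c) := by
  have hm : Measurable fun q : ℝ × Bool => ENNReal.ofReal (N.radialDensity q.2 q.1) :=
    N.measurable_radialDensity.ennreal_ofReal
  rw [radialIntensity, lintegral_withDensity_eq_lintegral_mul _ hm hg,
    lintegral_prod_symm' _ (hm.mul hg), lintegral_count, tsum_fintype]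
  rfl

/-- The intensity measure of the access points of the given type. -/
noncomputable def intensity (c : Bool) : Measure Plane := if c then N.intensityL else N.intensityN

theorem intensity_eq (c : Bool) : N.intensity c =
    volume.withDensity fun x => ENNReal.ofReal (N.lam * N.typeProb c ‖x‖) := by
  cases c <;> simp [intensity, intensityL, intensityN, typeProb]

theorem lintegral_norm_intensity (c : Bool) {g : ℝ → ℝ≥0∞} (hg : Measurable g) :
    ∫⁻ x, g ‖x‖ ∂N.intensity c =
      ∫⁻ r in Ioi (0 : ℝ), ENNReal.ofReal (N.radialDensity c r) * g r := by
  have hm : Measurable fun r => ENNReal.ofReal (N.lam * N.typeProb c r) := by fun_prop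
  have hm' : Measurable fun x : Plane => ENNReal.ofReal (N.lam * N.typeProb c ‖x‖) :=
    hm.comp measurable_norm
  have hg' : Measurable fun x : Plane => g ‖x‖ := hg.comp measurable_norm
  rw [intensity_eq, lintegral_withDensity_eq_lintegral_mul _ hm' hg']
  simp only [Pi.mul_apply]
  rw [lintegral_norm_plane (f := fun r => ENNReal.ofReal (N.lam * N.typeProb c r) * g r)
    (hm.mul hg)]
  refine setLIntegral_congr_fun measurableSet_Ioi fun r hr => ?_
  have hr : 0 < r := hr
  simp only [radialDensity]
  rw [← mul_assoc, ← ENNReal.ofReal_mul (by positivity)]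
  congr 2; ring

theorem radialIntensity_apply {B : Set (ℝ × Bool)} (hB : MeasurableSet B) :
    N.radialIntensity B = ∑ c, N.intensity c {x | (‖x‖, c) ∈ B} := by
  have hc : ∀ c, MeasurableSet {r : ℝ | (r, c) ∈ B} := fun c => measurable_prodMk_right hB
  rw [← lintegral_indicator_one hB,
    N.lintegral_radialIntensity (measurable_one.indicator hB)]
  refine Finset.sum_congr rfl fun c _ => ?_
  have := N.lintegral_norm_intensity c (measurable_one.indicator (hc c))
  have h2 : MeasurableSet {x : Plane | (‖x‖, c) ∈ B} := measurable_norm (hc c)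
  rw [← lintegral_indicator_one h2]
  exact this.symm

/-- The blockage probabilities cancel from the total intensity. -/
theorem radialIntensity_annulus {s t : ℝ} (hs : 0 ≤ s) (hst : s ≤ t) :
    N.radialIntensity {q | s < q.1 ∧ q.1 ≤ t} =
      ENNReal.ofReal (Real.pi * N.lam * (t ^ 2 - s ^ 2)) := by
  have hB : MeasurableSet {q : ℝ × Bool | s < q.1 ∧ q.1 ≤ t} :=
    (measurableSet_lt measurable_const measurable_fst).inter
      (measurableSet_le measurable_fst measurable_const)
  rw [← lintegral_indicator_one hB, N.lintegral_radialIntensity (measurable_one.indicator hB),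
    Fintype.sum_bool, ← lintegral_add_left]
  · have h1 : ∀ r ∈ Ioi (0 : ℝ), ENNReal.ofReal (N.radialDensity true r) *
          {q : ℝ × Bool | s < q.1 ∧ q.1 ≤ t}.indicator 1 (r, true) +
        ENNReal.ofReal (N.radialDensity false r) *
          {q : ℝ × Bool | s < q.1 ∧ q.1 ≤ t}.indicator 1 (r, false) =
        (Ioc s t).indicator (fun r => ENNReal.ofReal (2 * Real.pi * N.lam * r)) r := by
      intro r hr
      have hr : 0 < r := hr
      have h2 : ∀ c, ({q : ℝ × Bool | s < q.1 ∧ q.1 ≤ t}.indicator 1 (r, c) : ℝ≥0∞) =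
          (Ioc s t).indicator 1 r := fun c => rfl
      have hl := N.lam_pos
      have hn : ∀ c, 0 ≤ N.radialDensity c r := fun c => by
        have := N.typeProb_nonneg c hr.le
        unfold radialDensity
        positivity
      rw [h2, h2, ← add_mul, ← ENNReal.ofReal_add (hn _) (hn _)]
      by_cases hx : r ∈ Ioc s t
      · rw [indicator_of_mem hx, indicator_of_mem hx]
        simp only [Pi.one_apply, mul_one, radialDensity, typeProb]
        congr 1
        simp only [if_true, Bool.false_eq_true, if_false]
        ring
      · rw [indicator_of_notMem hx, indicator_of_notMem hx, mul_zero]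
    rw [setLIntegral_congr_fun measurableSet_Ioi h1, setLIntegral_indicator measurableSet_Ioc]
    have h3 : Ioc s t ∩ Ioi 0 = Ioc s t := by
      rw [inter_eq_left]; exact fun x hx => hs.trans_lt hx.1
    have hl := N.lam_pos
    have hcont : Continuous fun r : ℝ => 2 * Real.pi * N.lam * r := by fun_prop
    rw [h3, ← ofReal_integral_eq_lintegral_ofReal
      (hcont.integrableOn_Icc.mono_set Ioc_subset_Icc_self)
      ((ae_restrict_iff' measurableSet_Ioc).2 (Eventually.of_forall fun r hr => ?_)),
      ← intervalIntegral.integral_of_le hst]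
    · rw [intervalIntegral.integral_const_mul, integral_id]
      congr 1; ring
    · have : 0 ≤ r := hs.trans hr.1.le
      simp only [Pi.zero_apply]
      positivity
  · refine Measurable.mul ?_ ((measurable_one.indicator hB).comp measurable_prodMk_right)
    exact (N.measurable_radialDensity.comp measurable_prodMk_right).ennreal_ofReal

theorem radialIntensity_nonpos : N.radialIntensity {q | q.1 ≤ 0} = 0 := by
  have hB : MeasurableSet {q : ℝ × Bool | q.1 ≤ 0} :=
    measurableSet_le measurable_fst measurable_const
  rw [← lintegral_indicator_one hB, N.lintegral_radialIntensity (measurable_one.indicator hB)]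
  refine Finset.sum_eq_zero fun c _ => ?_
  rw [setLIntegral_congr_fun (g := fun _ => 0) measurableSet_Ioi]
  · simp
  · intro r hr
    have hr : 0 < r := hr
    have : (r, c) ∉ {q : ℝ × Bool | q.1 ≤ 0} := fun h : r ≤ 0 => absurd h (not_le.2 hr)
    simp only
    rw [indicator_of_notMem this, mul_zero]

end VCParams

namespace RayleighNetwork

variable {N : VCParams} {Ω : Type*} [MeasurableSpace Ω] {P : Measure Ω}
  (S : RayleighNetwork N P)

/-- Distance and type of the `k`-th nearest access point. -/
noncomputable def distType (k : ℕ) (ω : Ω) : ℝ × Bool := (‖S.X k ω‖, S.los k ω)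

theorem measurable_distType (k : ℕ) : Measurable (S.distType k) :=
  (S.measurable_X k).norm.prodMk (S.measurable_los k)

theorem apProcess_apply (c : Bool) (ω : Ω) {B : Set Plane} (hB : MeasurableSet B) :
    apProcess S.X S.los c ω B = ∑' k, if S.los k ω = c then B.indicator 1 (S.X k ω) else 0 := by
  rw [apProcess, Measure.sum_apply _ hB]
  refine tsum_congr fun k => ?_
  split_ifs
  · exact Measure.dirac_apply' _ hB
  · simp

theorem measurable_apMeasure (c : Bool) : Measurable (apProcess S.X S.los c) := by
  refine Measure.measurable_of_measurable_coe _ fun B hB => ?_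
  simp_rw [S.apProcess_apply c _ hB]
  refine Measurable.tsum fun k => Measurable.ite ?_ ?_ measurable_const
  · exact S.measurable_los k (measurableSet_singleton c)
  · exact (measurable_one.indicator hB).comp (S.measurable_X k)

theorem pointMeasure_distType_apply (ω : Ω) {B : Set (ℝ × Bool)} (hB : MeasurableSet B) :
    pointMeasure S.distType ω B = apProcess S.X S.los true ω {x | (‖x‖, true) ∈ B} +
      apProcess S.X S.los false ω {x | (‖x‖, false) ∈ B} := by
  have hc : ∀ c, MeasurableSet {x : Plane | (‖x‖, c) ∈ B} := fun c =>
    measurable_norm.prodMk measurable_const hB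
  rw [pointMeasure_apply _ _ hB, S.apProcess_apply _ _ (hc _), S.apProcess_apply _ _ (hc _),
    ← ENNReal.tsum_add]
  refine tsum_congr fun k => ?_
  rcases h : S.los k ω with _ | _
  · simp only [Bool.false_eq_true, if_false, if_true, zero_add, distType, h]; rfl
  · simp only [Bool.true_eq_false, if_false, if_true, add_zero, distType, h]; rfl

/-- Superposition of the LOS and NLOS processes. -/
theorem isPoissonProcess_distType :
    IsPoissonProcess (pointMeasure S.distType) N.radialIntensity P where
  count_law B hB hfin := by
    have hc : ∀ c, MeasurableSet {x : Plane | (‖x‖, c) ∈ B} := fun c =>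
      measurable_norm.prodMk measurable_const hB
    have hsum : N.radialIntensity B = N.intensityL {x | (‖x‖, true) ∈ B} +
        N.intensityN {x | (‖x‖, false) ∈ B} := by
      rw [N.radialIntensity_apply hB, Fintype.sum_bool]; rfl
    have hfin' := hfin
    rw [hsum, ENNReal.add_lt_top] at hfin'
    have hi : IndepFun (fun ω => apProcess S.X S.los true ω {x | (‖x‖, true) ∈ B})
        (fun ω => apProcess S.X S.los false ω {x | (‖x‖, false) ∈ B}) P :=
      S.indep_LN.comp (Measure.measurable_coe (hc true)) (Measure.measurable_coe (hc false))
    have h := IndepFun.hasLaw_add_map_cast_poissonMeasure (R := ℝ≥0∞) hi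
      (S.poissonL.count_law _ (hc true) hfin'.1) (S.poissonN.count_law _ (hc false) hfin'.2)
    rw [hsum, ENNReal.toNNReal_add hfin'.1.ne hfin'.2.ne]
    refine h.congr (Eventually.of_forall fun ω => ?_)
    exact S.pointMeasure_distType_apply ω hB
  indep n B hB hd := by
    have hc : ∀ i c, MeasurableSet {x : Plane | (‖x‖, c) ∈ B i} := fun i c =>
      measurable_norm.prodMk measurable_const (hB i)
    have hd' : ∀ c, Pairwise fun i j =>
        Disjoint {x : Plane | (‖x‖, c) ∈ B i} {x : Plane | (‖x‖, c) ∈ B j} := fun c i j hij =>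
      Disjoint.preimage (fun x : Plane => (‖x‖, c)) (hd hij)
    have hm : ∀ c i, Measurable fun ω => apProcess S.X S.los c ω {x | (‖x‖, c) ∈ B i} :=
      fun c i => (Measure.measurable_coe (hc i c)).comp (S.measurable_apMeasure c)
    have hφ : ∀ c, Measurable fun (μ : Measure Plane) i => μ {x | (‖x‖, c) ∈ B i} := fun c =>
      measurable_pi_lambda _ fun i => Measure.measurable_coe (hc i c)
    have hi : IndepFun (fun ω i => apProcess S.X S.los true ω {x | (‖x‖, true) ∈ B i})
        (fun ω i => apProcess S.X S.los false ω {x | (‖x‖, false) ∈ B i}) P :=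
      S.indep_LN.comp (hφ true) (hφ false)
    have h := iIndepFun_prodMk (hm true) (hm false)
      (S.poissonL.indep n _ (fun i => hc i true) (hd' true))
      (S.poissonN.indep n _ (fun i => hc i false) (hd' false))
      hi
    have h2 := h.comp (fun _ q => q.1 + q.2) (fun _ => measurable_fst.add measurable_snd)
    convert h2 using 3 with i ω
    exact S.pointMeasure_distType_apply _ (hB i)

end RayleighNetwork

/-! ### Integrating out fading and antenna gains -/

/-- The inverse of `eneg` on `[0, 1]`. -/
noncomputable def negLog (v : ℝ≥0∞) : ℝ≥0∞ :=
  if v = 0 then ∞ else ENNReal.ofReal (-Real.log v.toReal)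

theorem eneg_negLog {v : ℝ≥0∞} (hv : v ≤ 1) : eneg (negLog v) = v := by
  unfold negLog
  split_ifs with h
  · simp [h]
  · have htop : v ≠ ∞ := (hv.trans_lt ENNReal.one_lt_top).ne
    have hpos : 0 < v.toReal := ENNReal.toReal_pos h htop
    have hle : v.toReal ≤ 1 := ENNReal.toReal_le_of_le_ofReal (by norm_num) (by simpa using hv)
    rw [eneg_ofReal (by linarith [Real.log_nonpos hpos.le hle]), neg_neg, Real.exp_log hpos,
      ENNReal.ofReal_toReal htop]

@[fun_prop] theorem measurable_negLog : Measurable negLog := by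
  unfold negLog
  refine Measurable.ite (measurableSet_singleton 0) measurable_const ?_
  exact (Real.measurable_log.comp ENNReal.measurable_toReal).neg.ennreal_ofReal

section Marks

variable {Ω γ 𝒴 : Type*} [MeasurableSpace Ω] [MeasurableSpace γ] [MeasurableSpace 𝒴]
  {P : Measure Ω}

theorem lintegral_eneg_le_one [IsProbabilityMeasure P] (f : Ω → ℝ≥0∞) :
    ∫⁻ ω, eneg (f ω) ∂P ≤ 1 := by
  refine (lintegral_mono (g := fun _ => 1) fun ω => eneg_le_one _).trans ?_
  simp

/-- The Laplace transform of an infinite sum of independent nonnegative random variables. -/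
theorem lintegral_eneg_tsum {W : ℕ → Ω → γ} (hW : iIndepFun W P) (hWm : ∀ l, Measurable (W l))
    {g : ℕ → γ → ℝ≥0∞} (hg : ∀ l, Measurable (g l)) :
    ∫⁻ ω, eneg (∑' l, g l (W l ω)) ∂P = eneg (∑' l, negLog (∫⁻ ω, eneg (g l (W l ω)) ∂P)) := by
  have := hW.isProbabilityMeasure
  have hL := tendsto_lintegral_mul_eneg (P := P) (g := 1)
    (F := fun n ω => ∑ l ∈ Finset.range n, g l (W l ω)) (f := fun ω => ∑' l, g l (W l ω))
    measurable_one (fun _ => le_rfl)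
    (fun n => Finset.measurable_sum _ fun l _ => (hg l).comp (hWm l))
    (Eventually.of_forall fun ω => ENNReal.tendsto_nat_tsum _)
  have hR := (continuous_eneg.tendsto _).comp
    (ENNReal.tendsto_nat_tsum fun l => negLog (∫⁻ ω, eneg (g l (W l ω)) ∂P))
  simp only [Pi.one_apply, one_mul] at hL
  refine tendsto_nhds_unique hL (hR.congr fun n => ?_)
  simp only [Function.comp, eneg_sum]
  have h1 : iIndepFun (fun l ω => eneg (g l (W l ω))) P :=
    hW.comp (fun l w => eneg (g l w)) fun l => measurable_eneg.comp (hg l)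
  rw [lintegral_prod_eq_prod_lintegral_of_indepFun _ _ h1
    fun l => measurable_eneg.comp ((hg l).comp (hWm l))]
  exact Finset.prod_congr rfl fun l _ => eneg_negLog (lintegral_eneg_le_one _)

/-- Independent marks `W` are integrated out given `Z`: each summand is replaced by the negative
logarithm of its Laplace transform, so that the exponent is again a sum of functions of `Z`. -/
theorem lintegral_mul_eneg_tsum {W : ℕ → Ω → γ} (hW : iIndepFun W P) (hWm : ∀ l, Measurable (W l))
    {Z : Ω → 𝒴} (hZ : Measurable Z) (hZW : IndepFun Z (fun ω l => W l ω) P)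
    {h : 𝒴 → ℝ≥0∞} (hh : Measurable h) {G : ℕ → 𝒴 → γ → ℝ≥0∞}
    (hG : ∀ l, Measurable fun q : 𝒴 × γ => G l q.1 q.2) :
    ∫⁻ ω, h (Z ω) * eneg (∑' l, G l (Z ω) (W l ω)) ∂P =
      ∫⁻ ω, h (Z ω) * eneg (∑' l, negLog (∫⁻ ω', eneg (G l (Z ω) (W l ω')) ∂P)) ∂P := by
  have := hW.isProbabilityMeasure
  have hWm' : Measurable fun ω l => W l ω := measurable_pi_lambda _ hWm
  have hF : Measurable fun q : 𝒴 × (ℕ → γ) => h q.1 * eneg (∑' l, G l q.1 (q.2 l)) := by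
    refine (hh.comp measurable_fst).mul (measurable_eneg.comp (Measurable.tsum fun l => ?_))
    exact (hG l).comp (measurable_fst.prodMk ((measurable_pi_apply l).comp measurable_snd))
  have hlaw := (indepFun_iff_map_prod_eq_prod_map_map hZ.aemeasurable hWm'.aemeasurable).1 hZW
  have hGl : ∀ l z, Measurable (G l z) := fun l z => (hG l).comp measurable_prodMk_left
  have hin : ∀ z, ∫⁻ w, h z * eneg (∑' l, G l z (w l)) ∂(P.map fun ω l => W l ω) =
      h z * eneg (∑' l, negLog (∫⁻ ω', eneg (G l z (W l ω')) ∂P)) := by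
    intro z
    have hm : Measurable fun w : ℕ → γ => eneg (∑' l, G l z (w l)) :=
      measurable_eneg.comp (Measurable.tsum fun l => (hGl l z).comp (measurable_pi_apply l))
    rw [lintegral_const_mul _ hm, lintegral_map hm hWm', lintegral_eneg_tsum hW hWm (hGl · z)]
  have hm2 : Measurable fun z => h z * eneg (∑' l, negLog (∫⁻ ω', eneg (G l z (W l ω')) ∂P)) := by
    refine hh.mul (measurable_eneg.comp (Measurable.tsum fun l => measurable_negLog.comp ?_))
    refine Measurable.lintegral_prod_right' (f := fun q : 𝒴 × Ω => eneg (G l q.1 (W l q.2))) ?_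
    exact measurable_eneg.comp ((hG l).comp (measurable_fst.prodMk ((hWm l).comp measurable_snd)))
  calc ∫⁻ ω, h (Z ω) * eneg (∑' l, G l (Z ω) (W l ω)) ∂P
      = ∫⁻ q, h q.1 * eneg (∑' l, G l q.1 (q.2 l)) ∂(P.map fun ω => (Z ω, fun l => W l ω)) :=
        (lintegral_map hF (hZ.prodMk hWm')).symm
    _ = ∫⁻ z, ∫⁻ w, h z * eneg (∑' l, G l z (w l)) ∂(P.map fun ω l => W l ω) ∂(P.map Z) := by
        rw [hlaw, lintegral_prod _ hF.aemeasurable]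
    _ = _ := by
        simp_rw [hin]
        rw [lintegral_map hm2 hZ]

/-- If two weights have the same integral over every event `R ∈ A`, then they have the same
integral against every function of `R`. -/
theorem lintegral_comp_mul_eq_of_setLIntegral {R : Ω → 𝒴} (hR : Measurable R) {F G : Ω → ℝ≥0∞}
    (hF : Measurable F) (hG : Measurable G)
    (hFG : ∀ A, MeasurableSet A → ∫⁻ ω in R ⁻¹' A, F ω ∂P = ∫⁻ ω in R ⁻¹' A, G ω ∂P)
    {h : 𝒴 → ℝ≥0∞} (hh : Measurable h) :
    ∫⁻ ω, h (R ω) * F ω ∂P = ∫⁻ ω, h (R ω) * G ω ∂P := by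
  have hmap : (P.withDensity F).map R = (P.withDensity G).map R := by
    ext A hA
    rw [Measure.map_apply hR hA, Measure.map_apply hR hA, withDensity_apply _ (hR hA),
      withDensity_apply _ (hR hA), hFG A hA]
  have h1 : ∀ F : Ω → ℝ≥0∞, Measurable F →
      ∫⁻ ω, h (R ω) * F ω ∂P = ∫⁻ r, h r ∂((P.withDensity F).map R) := by
    intro F hF
    have hhR : Measurable fun ω => h (R ω) := hh.comp hR
    rw [lintegral_map hh hR, lintegral_withDensity_eq_lintegral_mul _ hF hhR]
    exact lintegral_congr fun ω => mul_comm _ _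
  rw [h1 F hF, h1 G hG, hmap]

end Marks

theorem tsum_ite_lt_eq_sum_add (K : ℕ) (α β : ℕ → ℝ≥0∞) :
    ∑' l, (if l < K then α l else β l) =
      ∑ k : Fin K, α k + ∑' l, if K ≤ l then β l else 0 := by
  have h1 : ∀ l, (if l < K then α l else β l) =
      (if l < K then α l else 0) + if K ≤ l then β l else 0 := by
    intro l
    by_cases hl : l < K
    · simp [hl, not_le.2 hl]
    · simp [hl, not_lt.1 hl]
  simp_rw [h1]
  rw [ENNReal.tsum_add, Fin.sum_univ_eq_sum_range,
    tsum_eq_sum (s := Finset.range K) fun l hl => by simp_all]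
  congr 1
  exact Finset.sum_congr rfl fun l hl => by simp_all

/-- The Laplace transform of an exponential random variable with mean `μ`. -/
theorem lintegral_eneg_expMeasure {μ x : ℝ} (hμ : 0 < μ) (hx : 0 ≤ x) :
    ∫⁻ y, eneg (ENNReal.ofReal (x * y)) ∂(expMeasure μ⁻¹) = ENNReal.ofReal (1 / (1 + μ * x)) := by
  have hr : 0 < μ⁻¹ + x := by positivity
  have h0 : expMeasure μ⁻¹ = volume.withDensity (exponentialPDF μ⁻¹) := rfl
  have hm : ∀ r, Measurable (exponentialPDF r) := fun r =>
    (measurable_exponentialPDFReal r).ennreal_ofReal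
  rw [h0, lintegral_withDensity_eq_lintegral_mul _ (hm _) (by fun_prop)]
  have h1 : ∀ y, (exponentialPDF μ⁻¹ * fun y => eneg (ENNReal.ofReal (x * y))) y =
      ENNReal.ofReal (1 / (1 + μ * x)) * exponentialPDF (μ⁻¹ + x) y := by
    intro y
    simp only [Pi.mul_apply]
    rcases lt_or_ge y 0 with hy | hy
    · rw [exponentialPDF_of_neg hy, exponentialPDF_of_neg hy]; simp
    · rw [exponentialPDF_of_nonneg hy, exponentialPDF_of_nonneg hy, eneg_ofReal (by positivity),
        ← ENNReal.ofReal_mul (by positivity), ← ENNReal.ofReal_mul (by positivity)]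
      congr 1
      rw [mul_assoc, ← Real.exp_add]
      have : μ⁻¹ = 1 / (1 + μ * x) * (μ⁻¹ + x) := by field_simp
      rw [← mul_assoc, ← this]
      congr 2; ring
  simp_rw [h1]
  rw [lintegral_const_mul _ (hm _), lintegral_exponentialPDF_eq_one hr, mul_one]

namespace VCParams

variable (N : VCParams)

@[fun_prop] theorem measurable_pathLoss (c : Bool) : Measurable (N.pathLoss c) := by
  unfold pathLoss pathLossL pathLossN; cases c <;> simp <;> fun_prop

@[fun_prop] theorem measurable_pathLossL : Measurable N.pathLossL := by
  unfold pathLossL; fun_prop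

theorem pathLossL_nonneg {r : ℝ} (hr : 0 ≤ r) : 0 ≤ N.pathLossL r :=
  mul_nonneg N.CL_pos.le (Real.rpow_nonneg hr _)

theorem pathLossN_nonneg {r : ℝ} (hr : 0 ≤ r) : 0 ≤ N.pathLossN r :=
  mul_nonneg N.CN_pos.le (Real.rpow_nonneg hr _)

theorem pathLoss_nonneg (c : Bool) {r : ℝ} (hr : 0 ≤ r) : 0 ≤ N.pathLoss c r := by
  cases c
  · exact N.pathLossN_nonneg hr
  · exact N.pathLossL_nonneg hr

@[fun_prop] theorem measurable_antennaGain : Measurable N.antennaGain := by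
  unfold antennaGain
  exact Measurable.ite (measurableSet_lt measurable_abs measurable_const) measurable_const
    measurable_const

theorem a_nonneg (n : Fin 2) : 0 ≤ N.a n := by
  fin_cases n
  · exact N.M_pos.le
  · exact N.m_nonneg

theorem thetaB_div_le_one : N.thetaB / (2 * Real.pi) ≤ 1 :=
  div_le_one_of_le₀ N.thetaB_le (by positivity)

theorem b_nonneg (n : Fin 2) : 0 ≤ N.b n := by
  fin_cases n
  · have := N.thetaB_pos.le
    simp only [b, Fin.zero_eta, Matrix.cons_val_zero]
    positivity
  · simpa [b] using N.thetaB_div_le_one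

theorem sum_ofReal_b : ∑ n, ENNReal.ofReal (N.b n) = 1 := by
  rw [← ENNReal.ofReal_sum_of_nonneg fun n _ => N.b_nonneg n]
  simp [b]

/-- The Laplace transform at `x` of the product of the gain and the fading power of an interfering
link. -/
noncomputable def gainLaplace (x : ℝ) : ℝ≥0∞ :=
  ∑ n, ENNReal.ofReal (N.b n) * ENNReal.ofReal (1 / (1 + N.mu * (x * N.a n)))

theorem one_sub_gainLaplace {x : ℝ} (hx : 0 ≤ x) : 1 - N.gainLaplace x =
    ∑ n, ENNReal.ofReal (N.b n) * ENNReal.ofReal (rayleighH (N.mu * (x * N.a n))) := by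
  have hsum : N.gainLaplace x +
      ∑ n, ENNReal.ofReal (N.b n) * ENNReal.ofReal (rayleighH (N.mu * (x * N.a n))) = 1 := by
    rw [gainLaplace, ← Finset.sum_add_distrib, ← N.sum_ofReal_b]
    refine Finset.sum_congr rfl fun n _ => ?_
    have h0 : 0 ≤ N.mu * (x * N.a n) := mul_nonneg N.mu_pos.le (mul_nonneg hx (N.a_nonneg n))
    have h1 : 1 / (1 + N.mu * (x * N.a n)) ≤ 1 := by
      rw [div_le_one (by linarith)]; linarith
    rw [← mul_add, ← ENNReal.ofReal_add (by positivity) (by unfold rayleighH; linarith)]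
    simp [rayleighH]
  refine ENNReal.sub_eq_of_eq_add ?_ (by rw [← hsum, add_comm])
  refine ne_top_of_le_ne_top ENNReal.one_ne_top (b := 1) ?_
  exact (le_add_right le_rfl).trans hsum.le

theorem gainLaplace_le_one {x : ℝ} (hx : 0 ≤ x) : N.gainLaplace x ≤ 1 := by
  rw [← N.sum_ofReal_b]
  refine Finset.sum_le_sum fun n _ => ?_
  refine mul_le_of_le_one_right' ?_
  rw [ENNReal.ofReal_le_one]
  have h0 : 0 ≤ N.mu * (x * N.a n) := mul_nonneg N.mu_pos.le (mul_nonneg hx (N.a_nonneg n))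
  rw [div_le_one (by linarith)]; linarith

@[fun_prop] theorem measurable_gainLaplace : Measurable N.gainLaplace := by
  unfold gainLaplace; fun_prop

end VCParams

namespace RayleighNetwork

variable {N : VCParams} {Ω : Type*} [MeasurableSpace Ω] {P : Measure Ω}
  (S : RayleighNetwork N P)

theorem lintegral_eneg_fading (l : ℕ) {x : ℝ} (hx : 0 ≤ x) :
    ∫⁻ ω, eneg (ENNReal.ofReal (x * ‖S.ξ l ω‖ ^ 2)) ∂P = ENNReal.ofReal (1 / (1 + N.mu * x)) := by
  rw [(S.fading_law l).lintegral_comp (f := fun y => eneg (ENNReal.ofReal (x * y))) (by fun_prop),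
    lintegral_eneg_expMeasure N.mu_pos hx]

/-- The angle lies in the main lobe with probability `b 0 = thetaB / (2 * π)`. -/
theorem measure_mainLobe [IsProbabilityMeasure P] (l : ℕ) :
    P {ω | |S.Θ l ω| < N.thetaB / 2} = ENNReal.ofReal (N.b 0) := by
  have hm : MeasurableSet {θ : ℝ | |θ| < N.thetaB / 2} :=
    measurableSet_lt measurable_abs measurable_const
  have h1 : P {ω | |S.Θ l ω| < N.thetaB / 2} = P.map (S.Θ l) {θ : ℝ | |θ| < N.thetaB / 2} :=
    (Measure.map_apply (S.measurable_Θ l) hm).symm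
  have h2 : Ioc (-Real.pi) Real.pi ∩ {θ : ℝ | |θ| < N.thetaB / 2} =
      Ioo (-(N.thetaB / 2)) (N.thetaB / 2) := by
    ext θ
    have := N.thetaB_le
    simp only [mem_inter_iff, mem_Ioc, mem_ofPred_eq, abs_lt, mem_Ioo]
    constructor
    · exact fun h => h.2
    · exact fun h => ⟨⟨by linarith [h.1], by linarith [h.2]⟩, h⟩
  have hu : P.map (S.Θ l) = ProbabilityTheory.cond volume (Ioc (-Real.pi) Real.pi) :=
    S.angle_uniform l
  rw [h1, hu, cond_apply measurableSet_Ioc, h2, Real.volume_Ioc, Real.volume_Ioo,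
    ← ENNReal.ofReal_inv_of_pos (by linarith [Real.pi_pos]),
    ← ENNReal.ofReal_mul (inv_nonneg.2 (by linarith [Real.pi_pos]))]
  congr 1
  simp only [VCParams.b, Matrix.cons_val_zero]
  have := Real.pi_pos
  field_simp

theorem lintegral_eneg_gain [IsProbabilityMeasure P] (l : ℕ) {x : ℝ} (hx : 0 ≤ x) :
    ∫⁻ ω, eneg (ENNReal.ofReal (x * N.antennaGain (S.Θ l ω) * ‖S.ξ l ω‖ ^ 2)) ∂P =
      N.gainLaplace x := by
  let A : Set Ω := {ω | |S.Θ l ω| < N.thetaB / 2}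
  have hAm : MeasurableSet {θ : ℝ | |θ| < N.thetaB / 2} :=
    measurableSet_lt measurable_abs measurable_const
  have hA : MeasurableSet A := S.measurable_Θ l hAm
  have hind : IndepFun (S.Θ l) (S.ξ l) P :=
    S.indep_angle_fading.comp (measurable_pi_apply l) (measurable_pi_apply l)
  have hξ : Measurable (S.ξ l) := S.measurable_ξ l
  -- On the event that the gain equals `y`, only the fading remains random.
  have hpart : ∀ (B : Set ℝ) (y : ℝ), MeasurableSet B → 0 ≤ y →
      ∫⁻ ω in S.Θ l ⁻¹' B, eneg (ENNReal.ofReal (x * y * ‖S.ξ l ω‖ ^ 2)) ∂P =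
        P (S.Θ l ⁻¹' B) * ENNReal.ofReal (1 / (1 + N.mu * (x * y))) := by
    intro B y hB hy
    have hBm : MeasurableSet (S.Θ l ⁻¹' B) := S.measurable_Θ l hB
    have hψ : Measurable fun z : ℂ => eneg (ENNReal.ofReal (x * y * ‖z‖ ^ 2)) := by fun_prop
    have hφ : Measurable (B.indicator (1 : ℝ → ℝ≥0∞)) := measurable_one.indicator hB
    have h1 : ∀ ω, (S.Θ l ⁻¹' B).indicator
        (fun ω => eneg (ENNReal.ofReal (x * y * ‖S.ξ l ω‖ ^ 2))) ω =
        B.indicator 1 (S.Θ l ω) * eneg (ENNReal.ofReal (x * y * ‖S.ξ l ω‖ ^ 2)) := by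
      intro ω
      by_cases hω : S.Θ l ω ∈ B
      · rw [indicator_of_mem (by exact hω), indicator_of_mem hω]; simp
      · rw [indicator_of_notMem (by exact hω), indicator_of_notMem hω]; simp
    rw [← lintegral_indicator hBm]
    simp_rw [h1]
    have h2 := lintegral_mul_eq_lintegral_mul_lintegral_of_indepFun (hφ.comp (S.measurable_Θ l))
      (hψ.comp hξ) (hind.comp hφ hψ)
    simp only [Pi.mul_apply, Function.comp] at h2
    rw [h2, S.lintegral_eneg_fading l (mul_nonneg hx hy)]
    congr 1
    rw [← lintegral_indicator_one hBm]
    rfl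
  have hAc : P Aᶜ = ENNReal.ofReal (N.b 1) := by
    rw [prob_compl_eq_one_sub hA, S.measure_mainLobe l, ← ENNReal.ofReal_one,
      ← ENNReal.ofReal_sub _ (N.b_nonneg 0)]
    simp [VCParams.b]
  rw [← lintegral_add_compl _ hA, VCParams.gainLaplace, Fin.sum_univ_two]
  congr 1
  · rw [← S.measure_mainLobe l]
    refine Eq.trans (setLIntegral_congr_fun hA fun ω hω => ?_)
      (hpart {θ | |θ| < N.thetaB / 2} N.M hAm N.M_pos.le)
    simp only [VCParams.antennaGain]
    rw [if_pos (show |S.Θ l ω| < N.thetaB / 2 from hω)]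
  · rw [← hAc]
    refine Eq.trans (setLIntegral_congr_fun hA.compl fun ω hω => ?_)
      (hpart {θ | |θ| < N.thetaB / 2}ᶜ N.m hAm.compl N.m_nonneg)
    simp only [VCParams.antennaGain]
    rw [if_neg (show ¬ |S.Θ l ω| < N.thetaB / 2 from hω)]

end RayleighNetwork

/-! ### The joint Laplace transform of signal and interference -/

namespace VCParams

variable (N : VCParams)

theorem measurable_pathLoss_pair : Measurable fun q : ℝ × Bool => N.pathLoss q.2 q.1 :=
  measurable_from_prod_countable_left fun c => N.measurable_pathLoss c

/-- The interference exponents `VL` and `VN` combine to the Laplace exponent of the Poisson process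
of interfering access points. -/
theorem lintegral_one_sub_gainLaplace {r : Fin N.K → ℝ} (hr : 0 ≤ N.rK r) {s : ℝ} (hs : 0 ≤ s) :
    ∫⁻ q in {q : ℝ × Bool | N.rK r < q.1}, (1 - N.gainLaplace (s * N.pathLoss q.2 q.1))
      ∂N.radialIntensity = N.VL r s + N.VN r s := by
  have hB : MeasurableSet {q : ℝ × Bool | N.rK r < q.1} :=
    measurableSet_lt measurable_const measurable_fst
  have hg : Measurable fun q : ℝ × Bool => 1 - N.gainLaplace (s * N.pathLoss q.2 q.1) := by
    have := N.measurable_pathLoss_pair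
    fun_prop
  have hl := N.lam_pos
  have key : ∀ c, ∫⁻ x in Ioi (0 : ℝ), ENNReal.ofReal (N.radialDensity c x) *
      {q : ℝ × Bool | N.rK r < q.1}.indicator
        (fun q => 1 - N.gainLaplace (s * N.pathLoss q.2 q.1)) (x, c) =
      ENNReal.ofReal (2 * Real.pi * N.lam) * ∑ n, ENNReal.ofReal (N.b n) *
        ∫⁻ x in Ioi (N.rK r), ENNReal.ofReal
          (rayleighH (N.mu * (s * N.pathLoss c x * N.a n)) * N.typeProb c x * x) := by
    intro c
    have hm : ∀ n, Measurable fun x => ENNReal.ofReal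
        (rayleighH (N.mu * (s * N.pathLoss c x * N.a n)) * N.typeProb c x * x) := by
      intro n; unfold rayleighH; fun_prop
    have h1 : ∀ x ∈ Ioi (0 : ℝ), ENNReal.ofReal (N.radialDensity c x) *
        {q : ℝ × Bool | N.rK r < q.1}.indicator
          (fun q => 1 - N.gainLaplace (s * N.pathLoss q.2 q.1)) (x, c) =
        (Ioi (N.rK r)).indicator (fun x => ENNReal.ofReal (2 * Real.pi * N.lam) *
          ∑ n, ENNReal.ofReal (N.b n) * ENNReal.ofReal
          (rayleighH (N.mu * (s * N.pathLoss c x * N.a n)) * N.typeProb c x * x)) x := by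
      intro x hx
      have hx : 0 < x := hx
      have ht := N.typeProb_nonneg c hx.le
      have hp := mul_nonneg hs (N.pathLoss_nonneg c hx.le)
      by_cases hxr : x ∈ Ioi (N.rK r)
      · rw [indicator_of_mem hxr, indicator_of_mem (by exact hxr), N.one_sub_gainLaplace hp,
          Finset.mul_sum, Finset.mul_sum]
        refine Finset.sum_congr rfl fun n _ => ?_
        have hH : 0 ≤ rayleighH (N.mu * (s * N.pathLoss c x * N.a n)) := by
          have h0 : 0 ≤ N.mu * (s * N.pathLoss c x * N.a n) :=
            mul_nonneg N.mu_pos.le (mul_nonneg hp (N.a_nonneg n))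
          have : 1 / (1 + N.mu * (s * N.pathLoss c x * N.a n)) ≤ 1 := by
            rw [div_le_one (by linarith)]; linarith
          unfold rayleighH; linarith
        have e : ENNReal.ofReal (N.radialDensity c x) *
            ENNReal.ofReal (rayleighH (N.mu * (s * N.pathLoss c x * N.a n))) =
            ENNReal.ofReal (2 * Real.pi * N.lam) * ENNReal.ofReal
              (rayleighH (N.mu * (s * N.pathLoss c x * N.a n)) * N.typeProb c x * x) := by
          rw [← ENNReal.ofReal_mul' hH, ← ENNReal.ofReal_mul (by positivity)]
          congr 1
          unfold radialDensity; ring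
        rw [mul_left_comm, e, mul_left_comm]
      · rw [indicator_of_notMem hxr, indicator_of_notMem (by exact hxr), mul_zero]
    have h2 : Ioi (N.rK r) ∩ Ioi 0 = Ioi (N.rK r) := by
      rw [inter_eq_left]; exact fun x hx => hr.trans_lt hx
    rw [setLIntegral_congr_fun measurableSet_Ioi h1, setLIntegral_indicator measurableSet_Ioi, h2,
      lintegral_const_mul _ (by fun_prop), lintegral_finsetSum _ (by fun_prop)]
    congr 1
    exact Finset.sum_congr rfl fun n _ => lintegral_const_mul _ (hm n)
  rw [← lintegral_indicator hB, N.lintegral_radialIntensity (hg.indicator hB), Fintype.sum_bool,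
    key, key]
  congr 1
  · unfold VL
    congr 1
    refine Finset.sum_congr rfl fun n _ => ?_
    congr 1
    refine lintegral_congr fun x => ?_
    simp only [pathLoss, typeProb, if_true, pathLossL]
    congr 4; ring
  · unfold VN
    congr 1
    refine Finset.sum_congr rfl fun n _ => ?_
    congr 1
    refine lintegral_congr fun x => ?_
    simp only [pathLoss, typeProb, Bool.false_eq_true, if_false, pathLossN]
    congr 4; ring

end VCParams

namespace RayleighNetwork

variable {N : VCParams} {Ω : Type*} [MeasurableSpace Ω] {P : Measure Ω}
  (S : RayleighNetwork N P)

theorem interference_add (ω : Ω) : S.interferenceL ω + S.interferenceN ω =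
    ∑' l, if N.K ≤ l then ENNReal.ofReal (N.antennaGain (S.Θ l ω) *
      N.pathLoss (S.los l ω) ‖S.X l ω‖ * ‖S.ξ l ω‖ ^ 2) else 0 := by
  rw [interferenceL, interferenceN, ← ENNReal.tsum_add]
  refine tsum_congr fun l => ?_
  by_cases hl : N.K ≤ l
  · rcases h : S.los l ω with _ | _ <;> simp [hl, VCParams.pathLoss]
  · simp [hl]

theorem signal_nonneg (ω : Ω) : 0 ≤ S.signal ω :=
  Finset.sum_nonneg fun k _ => mul_nonneg (mul_nonneg N.M_pos.le
    (N.pathLossL_nonneg (norm_nonneg _))) (by positivity)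

theorem measurable_servingDist : Measurable S.servingDist :=
  measurable_pi_lambda _ fun _ => (S.measurable_X _).norm

@[fun_prop] theorem measurable_signal : Measurable S.signal := by
  unfold signal
  refine Finset.measurable_sum _ fun k _ => ?_
  have h1 := (measurable_pi_apply k).comp S.measurable_servingDist
  have h2 := S.measurable_ξ k
  exact ((N.measurable_pathLossL.comp h1).const_mul _).mul (h2.norm.pow_const 2)

@[fun_prop] theorem measurable_interference :
    Measurable fun ω => S.interferenceL ω + S.interferenceN ω := by
  simp_rw [S.interference_add]
  refine Measurable.tsum fun l => ?_
  split_ifs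
  · refine Measurable.ennreal_ofReal ?_
    refine ((N.measurable_antennaGain.comp (S.measurable_Θ l)).mul ?_).mul
      ((S.measurable_ξ l).norm.pow_const 2)
    exact N.measurable_pathLoss_pair.comp (S.measurable_distType l)
  · exact measurable_const

/-- The joint Laplace transform of the signal at `s'` and the interference at `s`, conditionally on
the serving distances. -/
theorem lintegral_mul_eneg_signal_add_interference [IsProbabilityMeasure P] {s s' : ℝ}
    (hs : 0 ≤ s) (hs' : 0 ≤ s') {h : (Fin N.K → ℝ) → ℝ≥0∞} (hh : Measurable h) :
    ∫⁻ ω, h (S.servingDist ω) * eneg (ENNReal.ofReal (s' * S.signal ω) +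
        ENNReal.ofReal s * (S.interferenceL ω + S.interferenceN ω)) ∂P =
      ∫⁻ ω, h (S.servingDist ω) *
        (∏ k, ENNReal.ofReal (1 / (1 + N.mu * (s' * (N.M * N.pathLossL (S.servingDist ω k)))))) *
        eneg (N.VL (S.servingDist ω) s + N.VN (S.servingDist ω) s) ∂P := by
  let W : ℕ → Ω → ℝ × ℂ := fun l ω => (S.Θ l ω, S.ξ l ω)
  have hWm : ∀ l, Measurable (W l) := fun l => (S.measurable_Θ l).prodMk (S.measurable_ξ l)
  have hW : iIndepFun W P := iIndepFun_prodMk S.measurable_Θ S.measurable_ξ S.angle_indep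
    S.fading_indep S.indep_angle_fading
  let Z : Ω → ℕ → ℝ × Bool := fun ω l => S.distType l ω
  have hZ : Measurable Z := measurable_pi_lambda _ S.measurable_distType
  have hφ : Measurable fun (z : ℕ → Plane × Bool) l => (‖(z l).1‖, (z l).2) :=
    measurable_pi_lambda _ fun l => by fun_prop
  have hZW : IndepFun Z (fun ω l => W l ω) P := S.indep_ap_marks.comp hφ measurable_id
  -- The power of the `l`-th link, multiplied by `s'` for a serving and by `s` for an
  -- interfering access point.
  let G : ℕ → (ℕ → ℝ × Bool) → ℝ × ℂ → ℝ≥0∞ := fun l y w =>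
    if l < N.K then ENNReal.ofReal (s' * (N.M * N.pathLossL (y l).1) * ‖w.2‖ ^ 2)
    else ENNReal.ofReal (s * N.pathLoss (y l).2 (y l).1 * N.antennaGain w.1 * ‖w.2‖ ^ 2)
  have hG : ∀ l, Measurable fun q : (ℕ → ℝ × Bool) × (ℝ × ℂ) => G l q.1 q.2 := by
    intro l
    have h1 : Measurable fun q : (ℕ → ℝ × Bool) × (ℝ × ℂ) => N.pathLoss (q.1 l).2 (q.1 l).1 :=
      N.measurable_pathLoss_pair.comp ((measurable_pi_apply l).comp measurable_fst)
    simp only [G]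
    split_ifs <;> fun_prop
  have hGsum : ∀ ω, ∑' l, G l (Z ω) (W l ω) = ENNReal.ofReal (s' * S.signal ω) +
      ENNReal.ofReal s * (S.interferenceL ω + S.interferenceN ω) := by
    intro ω
    rw [tsum_ite_lt_eq_sum_add, S.interference_add, ← ENNReal.tsum_mul_left]
    congr 1
    · rw [signal, Finset.mul_sum, ENNReal.ofReal_sum_of_nonneg]
      · refine Finset.sum_congr rfl fun k _ => ?_
        rw [mul_assoc s']; rfl
      · exact fun k _ => mul_nonneg hs' (mul_nonneg (mul_nonneg N.M_pos.le
          (N.pathLossL_nonneg (norm_nonneg _))) (by positivity))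
    · refine tsum_congr fun l => ?_
      split_ifs
      · rw [← ENNReal.ofReal_mul hs]
        congr 1
        simp only [Z, W, distType]; ring
      · simp
  let h' : (ℕ → ℝ × Bool) → ℝ≥0∞ := fun y => h fun k => (y k).1
  have hh' : Measurable h' := hh.comp (measurable_pi_lambda _ fun k => by fun_prop)
  have hmarks := lintegral_mul_eneg_tsum hW hWm hZ hZW hh' hG
  have hhZ : ∀ ω, h' (Z ω) = h (S.servingDist ω) := fun ω => rfl
  simp_rw [hGsum, hhZ] at hmarks
  rw [hmarks]
  let u : ℝ × Bool → ℝ≥0∞ := fun q => negLog (N.gainLaplace (s * N.pathLoss q.2 q.1))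
  have hu : Measurable u := by
    have := N.measurable_pathLoss_pair
    fun_prop
  have hexp : ∀ ω, (∑' l, negLog (∫⁻ ω', eneg (G l (Z ω) (W l ω')) ∂P)) =
      ∑ k : Fin N.K, negLog (ENNReal.ofReal
        (1 / (1 + N.mu * (s' * (N.M * N.pathLossL (S.servingDist ω k)))))) +
      ∑' l, if N.K ≤ l then u (S.distType l ω) else 0 := by
    intro ω
    refine Eq.trans ?_ (tsum_ite_lt_eq_sum_add N.K (fun k => negLog (ENNReal.ofReal
        (1 / (1 + N.mu * (s' * (N.M * N.pathLossL ‖S.X k ω‖)))))) fun l => u (S.distType l ω))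
    refine tsum_congr fun l => ?_
    simp only [G]
    split_ifs
    · rw [← S.lintegral_eneg_fading l (mul_nonneg hs' (mul_nonneg N.M_pos.le
          (N.pathLossL_nonneg (norm_nonneg (S.X l ω)))))]
      rfl
    · have := S.lintegral_eneg_gain l (mul_nonneg hs
        (N.pathLoss_nonneg (S.los l ω) (norm_nonneg (S.X l ω))))
      simp only [u, distType]
      rw [← this]
      rfl
  have hprod : ∀ ω, eneg (∑ k : Fin N.K, negLog (ENNReal.ofReal
        (1 / (1 + N.mu * (s' * (N.M * N.pathLossL (S.servingDist ω k))))))) =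
      ∏ k, ENNReal.ofReal (1 / (1 + N.mu * (s' * (N.M * N.pathLossL (S.servingDist ω k))))) := by
    intro ω
    rw [eneg_sum]
    refine Finset.prod_congr rfl fun k _ => eneg_negLog ?_
    rw [ENNReal.ofReal_le_one]
    have h0 : 0 ≤ N.mu * (s' * (N.M * N.pathLossL (S.servingDist ω k))) :=
      mul_nonneg N.mu_pos.le (mul_nonneg hs' (mul_nonneg N.M_pos.le
        (N.pathLossL_nonneg (norm_nonneg _))))
    rw [div_le_one (by linarith)]; linarith
  have hQ : Measurable fun ω => ∑' l, if N.K ≤ l then u (S.distType l ω) else 0 := by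
    refine Measurable.tsum fun l => ?_
    split_ifs
    · exact hu.comp (S.measurable_distType l)
    · exact measurable_const
  have hVm : Measurable fun ω => ∫⁻ q in {q : ℝ × Bool | N.rK (S.servingDist ω) < q.1},
      (1 - N.gainLaplace (s * N.pathLoss q.2 q.1)) ∂N.radialIntensity := by
    have hanti : Antitone fun t : ℝ => ∫⁻ q in {q : ℝ × Bool | t < q.1},
        (1 - N.gainLaplace (s * N.pathLoss q.2 q.1)) ∂N.radialIntensity := fun t t' htt' =>
      lintegral_mono_set fun q hq => lt_of_le_of_lt htt' hq
    exact hanti.measurable.comp ((measurable_pi_apply _).comp S.measurable_servingDist)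
  have hVeq : ∀ ω, ∫⁻ q in {q : ℝ × Bool | N.rK (S.servingDist ω) < q.1},
      (1 - N.gainLaplace (s * N.pathLoss q.2 q.1)) ∂N.radialIntensity =
      N.VL (S.servingDist ω) s + N.VN (S.servingDist ω) s := fun ω =>
    N.lintegral_one_sub_gainLaplace (r := S.servingDist ω) (norm_nonneg (S.X (N.K - 1) ω)) hs
  have hmarkov := lintegral_comp_mul_eq_of_setLIntegral (P := P) S.measurable_servingDist
    (F := fun ω => eneg (∑' l, if N.K ≤ l then u (S.distType l ω) else 0))
    (G := fun ω => eneg (∫⁻ q in {q : ℝ × Bool | N.rK (S.servingDist ω) < q.1},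
      (1 - N.gainLaplace (s * N.pathLoss q.2 q.1)) ∂N.radialIntensity))
    (measurable_eneg.comp hQ) (measurable_eneg.comp hVm) ?_
    (h := fun r => h r *
      ∏ k, ENNReal.ofReal (1 / (1 + N.mu * (s' * (N.M * N.pathLossL (r k)))))) (by fun_prop)
  · simp_rw [hVeq] at hmarkov
    refine Eq.trans (lintegral_congr fun ω => ?_) hmarkov
    rw [hexp, eneg_add, hprod, mul_assoc]
  · intro A hA
    have := setLIntegral_eneg_tsum_ge S.isPoissonProcess_distType S.measurable_distType
      measurable_fst S.ordered N.K_pos hu hA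
    refine Eq.trans this (lintegral_congr fun ω => ?_)
    congr 1
    have hrK : (S.distType (N.K - 1) ω).1 = N.rK (S.servingDist ω) := rfl
    rw [hrK]
    have hm : MeasurableSet {q : ℝ × Bool | N.rK (S.servingDist ω) < q.1} :=
      measurableSet_lt measurable_const measurable_fst
    have hne : ∀ᵐ q ∂N.radialIntensity, ¬ q.1 ≤ 0 := by
      rw [ae_iff]; simpa using N.radialIntensity_nonpos
    refine lintegral_congr_ae (ae_restrict_of_ae ?_)
    filter_upwards [hne] with q hq
    have := N.gainLaplace_le_one (mul_nonneg hs (N.pathLoss_nonneg q.2 (not_le.1 hq).le))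
    simp only [u]
    rw [eneg_negLog this]

end RayleighNetwork

/-! ### Frullani's formula for the spectral efficiency -/

theorem lintegral_Ioi_exp_neg_mul {a : ℝ} (ha : 0 < a) :
    ∫⁻ s in Ioi (0 : ℝ), ENNReal.ofReal (Real.exp (-s * a)) = ENNReal.ofReal (1 / a) := by
  have hd : ∀ x ∈ Ici (0 : ℝ), HasDerivAt (fun s => -(Real.exp (-s * a) / a))
      (Real.exp (-x * a)) x := by
    intro x _
    have h1 : HasDerivAt (fun s : ℝ => -s * a) (-1 * a) x := (hasDerivAt_id x).neg.mul_const a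
    have h2 := (h1.exp.div_const a).neg
    have e : -(Real.exp (-x * a) * (-1 * a) / a) = Real.exp (-x * a) := by field_simp
    rwa [e] at h2
  have hpos : ∀ x ∈ Ioi (0 : ℝ), 0 ≤ Real.exp (-x * a) := fun x _ => (Real.exp_pos _).le
  have hlim : Tendsto (fun s => -(Real.exp (-s * a) / a)) atTop (𝓝 0) := by
    have h1 : Tendsto (fun s : ℝ => -s * a) atTop atBot :=
      tendsto_neg_atTop_atBot.atBot_mul_const ha
    simpa using ((Real.tendsto_exp_atBot.comp h1).div_const a).neg
  rw [← ofReal_integral_eq_lintegral_ofReal (integrableOn_Ioi_deriv_of_nonneg' hd hpos hlim)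
    ((ae_restrict_iff' measurableSet_Ioi).2 (Eventually.of_forall hpos)),
    integral_Ioi_of_hasDerivAt_of_nonneg' hd hpos hlim]
  simp

theorem lintegral_Ioc_ofReal_of_hasDerivAt {y : ℝ} (hy : 0 ≤ y) {F f : ℝ → ℝ}
    (hF : ∀ t ∈ Icc 0 y, HasDerivAt F (f t) t) (hf : ContinuousOn f (Icc 0 y))
    (hf0 : ∀ t ∈ Ioc 0 y, 0 ≤ f t) :
    ∫⁻ t in Ioc 0 y, ENNReal.ofReal (f t) = ENNReal.ofReal (F y - F 0) := by
  rw [← ofReal_integral_eq_lintegral_ofReal (hf.integrableOn_Icc.mono_set Ioc_subset_Icc_self)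
    ((ae_restrict_iff' measurableSet_Ioc).2 (Eventually.of_forall hf0)),
    ← intervalIntegral.integral_of_le hy, intervalIntegral.integral_eq_sub_of_hasDerivAt]
  · rwa [uIcc_of_le hy]
  · exact ContinuousOn.intervalIntegrable (by rwa [uIcc_of_le hy])

/-- Frullani's formula, obtained from `(1 - exp (-s * y)) / s = ∫ t in 0..y, exp (-s * t)`. -/
theorem lintegral_Ioi_exp_mul_one_sub_exp {c y : ℝ} (hc : 0 < c) (hy : 0 ≤ y) :
    ∫⁻ s in Ioi (0 : ℝ), ENNReal.ofReal (Real.exp (-s * c) / s * (1 - Real.exp (-(s * y)))) =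
      ENNReal.ofReal (Real.log (1 + y / c)) := by
  have h1 : ∀ s ∈ Ioi (0 : ℝ),
      ENNReal.ofReal (Real.exp (-s * c) / s * (1 - Real.exp (-(s * y)))) =
      ∫⁻ t in Ioc 0 y, ENNReal.ofReal (Real.exp (-s * (c + t))) := by
    intro s hs
    have hs : 0 < s := hs
    rw [lintegral_Ioc_ofReal_of_hasDerivAt hy (F := fun t => -(Real.exp (-s * (c + t)) / s))]
    · congr 1
      have : Real.exp (-s * (c + y)) = Real.exp (-s * c) * Real.exp (-(s * y)) := by
        rw [← Real.exp_add]; congr 1; ring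
      rw [this, add_zero]; ring
    · intro t _
      have h1 : HasDerivAt (fun t : ℝ => -s * (c + t)) (-s * 1) t :=
        ((hasDerivAt_id t).const_add c).const_mul (-s)
      have h2 := (h1.exp.div_const s).neg
      have e : -(Real.exp (-s * (c + t)) * (-s * 1) / s) = Real.exp (-s * (c + t)) := by
        field_simp
      rwa [e] at h2
    · fun_prop
    · exact fun t _ => (Real.exp_pos _).le
  rw [setLIntegral_congr_fun measurableSet_Ioi h1, lintegral_lintegral_swap (by fun_prop)]
  have h2 : ∀ t ∈ Ioc 0 y, ∫⁻ s in Ioi (0 : ℝ), ENNReal.ofReal (Real.exp (-s * (c + t))) =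
      ENNReal.ofReal (1 / (c + t)) := fun t ht =>
    lintegral_Ioi_exp_neg_mul (by linarith [ht.1])
  rw [setLIntegral_congr_fun measurableSet_Ioc h2,
    lintegral_Ioc_ofReal_of_hasDerivAt hy (F := fun t => Real.log (c + t))]
  · congr 1
    rw [add_zero, ← Real.log_div (by linarith) hc.ne']
    congr 1; field_simp
  · intro t ht
    have : c + t ≠ 0 := by linarith [ht.1]
    exact ((hasDerivAt_id t).const_add c).log this
  · refine ContinuousOn.div continuousOn_const (by fun_prop) fun t ht => ?_
    linarith [ht.1]
  · intro t ht
    have : 0 < c + t := by linarith [ht.1]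
    positivity

theorem lintegral_mul_mul_one_sub {Ω : Type*} [MeasurableSpace Ω] {P : Measure Ω}
    [IsProbabilityMeasure P] {a x y x' y' : Ω → ℝ≥0∞} (ha : Measurable a) (hx : Measurable x)
    (hy : Measurable y) (hx' : Measurable x') (hy' : Measurable y') (ha1 : ∀ ω, a ω ≤ 1)
    (hx1 : ∀ ω, x ω ≤ 1) (hy1 : ∀ ω, y ω ≤ 1) (hy1' : ∀ ω, y' ω ≤ 1)
    (h : ∫⁻ ω, a ω * x ω ∂P = ∫⁻ ω, a ω * x' ω ∂P)
    (hxy : ∫⁻ ω, a ω * (x ω * y ω) ∂P = ∫⁻ ω, a ω * (x' ω * y' ω) ∂P) :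
    ∫⁻ ω, a ω * (x ω * (1 - y ω)) ∂P = ∫⁻ ω, a ω * (x' ω * (1 - y' ω)) ∂P := by
  have hsplit : ∀ a x y : ℝ≥0∞, y ≤ 1 → a * (x * (1 - y)) + a * (x * y) = a * x := by
    intro a x y hy
    rw [← mul_add, ← mul_add, tsub_add_cancel_of_le hy, mul_one]
  have hfin : ∫⁻ ω, a ω * (x ω * y ω) ∂P ≠ ∞ := by
    refine ((lintegral_mono (g := fun _ => 1) fun ω => ?_).trans_lt ?_).ne
    · exact mul_le_one' (ha1 ω) (mul_le_one' (hx1 ω) (hy1 ω))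
    · simp
  have e1 : ∫⁻ ω, a ω * (x ω * (1 - y ω)) ∂P + ∫⁻ ω, a ω * (x ω * y ω) ∂P =
      ∫⁻ ω, a ω * x ω ∂P := by
    rw [← lintegral_add_right _ (g := fun ω => a ω * (x ω * y ω)) (ha.mul (hx.mul hy))]
    exact lintegral_congr fun ω => hsplit _ _ _ (hy1 ω)
  have e2 : ∫⁻ ω, a ω * (x' ω * (1 - y' ω)) ∂P + ∫⁻ ω, a ω * (x' ω * y' ω) ∂P =
      ∫⁻ ω, a ω * x' ω ∂P := by
    rw [← lintegral_add_right _ (g := fun ω => a ω * (x' ω * y' ω)) (ha.mul (hx'.mul hy'))]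
    exact lintegral_congr fun ω => hsplit _ _ _ (hy1' ω)
  refine (ENNReal.add_left_inj hfin).1 ?_
  rw [e1, h, ← e2, hxy]

namespace VCParams

variable (N : VCParams)

theorem measurable_rK : Measurable N.rK := measurable_pi_apply _

theorem measurable_lintegral_Ioi_rK {f : ℝ × ℝ → ℝ≥0∞} (hf : Measurable f) :
    Measurable fun q : (Fin N.K → ℝ) × ℝ => ∫⁻ x in Ioi (N.rK q.1), f (q.2, x) := by
  have h1 : ∀ q : (Fin N.K → ℝ) × ℝ, ∫⁻ x in Ioi (N.rK q.1), f (q.2, x) =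
      ∫⁻ x, {z : ((Fin N.K → ℝ) × ℝ) × ℝ | N.rK z.1.1 < z.2}.indicator
        (fun z => f (z.1.2, z.2)) (q, x) := fun q =>
    (lintegral_indicator measurableSet_Ioi _).symm
  simp_rw [h1]
  refine Measurable.lintegral_prod_right' (f := fun z => _) ?_
  refine Measurable.indicator (by fun_prop) (measurableSet_lt ?_ measurable_snd)
  exact N.measurable_rK.comp (measurable_fst.comp measurable_fst)

theorem measurable_VL : Measurable fun q : (Fin N.K → ℝ) × ℝ => N.VL q.1 q.2 := by
  unfold VL
  refine Measurable.const_mul (Finset.measurable_sum _ fun n _ => Measurable.const_mul ?_ _) _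
  refine N.measurable_lintegral_Ioi_rK (f := fun z => ENNReal.ofReal
    (rayleighH (N.mu * z.1 * N.a n * N.CL * z.2 ^ (-N.alphaL)) * N.p z.2 * z.2)) ?_
  unfold rayleighH
  fun_prop

theorem measurable_VN : Measurable fun q : (Fin N.K → ℝ) × ℝ => N.VN q.1 q.2 := by
  unfold VN
  refine Measurable.const_mul (Finset.measurable_sum _ fun n _ => Measurable.const_mul ?_ _) _
  refine N.measurable_lintegral_Ioi_rK (f := fun z => ENNReal.ofReal
    (rayleighH (N.mu * z.1 * N.a n * N.CN * z.2 ^ (-N.alphaN)) * (1 - N.p z.2) * z.2)) ?_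
  unfold rayleighH
  fun_prop

theorem measurable_eneg_VL_add_VN (s : ℝ) :
    Measurable fun r : Fin N.K → ℝ => eneg (N.VL r s + N.VN r s) := by
  have h1 : Measurable fun q : (Fin N.K → ℝ) × ℝ => eneg (N.VL q.1 q.2 + N.VN q.1 q.2) :=
    measurable_eneg.comp (N.measurable_VL.add N.measurable_VN)
  exact Measurable.of_uncurry_right
    (f := fun (r : Fin N.K → ℝ) s => eneg (N.VL r s + N.VN r s)) h1

theorem measurable_capacityIntegrand :
    Measurable fun q : (Fin N.K → ℝ) × ℝ => N.capacityIntegrand q.1 q.2 := by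
  unfold capacityIntegrand
  have h1 : Measurable fun q : (Fin N.K → ℝ) × ℝ => expNeg (N.VL q.1 q.2 + N.VN q.1 q.2) := by
    simp_rw [← eneg_toReal]
    exact (measurable_eneg.comp (N.measurable_VL.add N.measurable_VN)).ennreal_toReal
  unfold rayleighH
  fun_prop

theorem rayleighH_nonneg {x : ℝ} (hx : 0 ≤ x) : 0 ≤ rayleighH x := by
  have : 1 / (1 + x) ≤ 1 := by rw [div_le_one (by linarith)]; linarith
  unfold rayleighH; linarith

theorem rayleighH_le_self {x : ℝ} (hx : 0 ≤ x) : rayleighH x ≤ x := by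
  have : rayleighH x = x / (1 + x) := by unfold rayleighH; field_simp; ring
  rw [this]
  exact div_le_self hx (by linarith)

theorem one_sub_rayleighH_nonneg {x : ℝ} (hx : 0 ≤ x) : 0 ≤ 1 - rayleighH x := by
  unfold rayleighH
  have : 0 ≤ 1 / (1 + x) := by positivity
  linarith

theorem ofReal_capacityIntegrand {r : Fin N.K → ℝ} (hr : ∀ k, 0 ≤ r k) {s : ℝ} (hs : 0 < s) :
    ENNReal.ofReal (N.capacityIntegrand r s) = ENNReal.ofReal (Real.exp (-s * N.sigma2) / s) *
      (eneg (N.VL r s + N.VN r s) *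
        (1 - ∏ k, ENNReal.ofReal (1 / (1 + N.mu * (s * (N.M * N.pathLossL (r k))))))) := by
  have hnn : ∀ k, 0 ≤ N.mu * (s * (N.M * N.pathLossL (r k))) := fun k =>
    mul_nonneg N.mu_pos.le (mul_nonneg hs.le (mul_nonneg N.M_pos.le (N.pathLossL_nonneg (hr k))))
  have h1 : ∀ k, 0 ≤ 1 / (1 + N.mu * (s * (N.M * N.pathLossL (r k)))) := fun k => by
    have := hnn k
    positivity
  rw [← ENNReal.ofReal_prod_of_nonneg fun k _ => h1 k, ← ENNReal.ofReal_one,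
    ← ENNReal.ofReal_sub _ (Finset.prod_nonneg fun k _ => h1 k), eneg,
    ← ENNReal.ofReal_mul (expNeg_nonneg _), ← ENNReal.ofReal_mul (by positivity)]
  congr 1
  unfold capacityIntegrand
  rw [mul_assoc]
  congr 3
  refine Finset.prod_congr rfl fun k _ => ?_
  unfold rayleighH pathLossL
  rw [sub_sub_cancel]
  congr 2; ring

end VCParams

namespace RayleighNetwork

variable {N : VCParams} {Ω : Type*} [MeasurableSpace Ω] {P : Measure Ω}
  (S : RayleighNetwork N P)

theorem servingDist_nonneg (ω : Ω) (k : Fin N.K) : 0 ≤ S.servingDist ω k := norm_nonneg _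

@[fun_prop] theorem measurable_sinr : Measurable S.sinr := by
  unfold sinr
  have := S.measurable_interference
  fun_prop

theorem sinr_nonneg (ω : Ω) : 0 ≤ S.sinr ω := ENNReal.toReal_nonneg

/-- The spectral efficiency as an integral of Laplace factors; if the interference is infinite, both
sides vanish. -/
theorem lintegral_Ioi_eneg_interference (ω : Ω) :
    ∫⁻ s in Ioi (0 : ℝ), ENNReal.ofReal (Real.exp (-s * N.sigma2) / s) *
      (eneg (ENNReal.ofReal s * (S.interferenceL ω + S.interferenceN ω)) *
        (1 - eneg (ENNReal.ofReal (s * S.signal ω)))) =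
      ENNReal.ofReal (Real.log (1 + S.sinr ω)) := by
  have hσ := N.sigma2_pos
  have hS := S.signal_nonneg ω
  by_cases hI : S.interferenceL ω + S.interferenceN ω = ∞
  · have h0 : S.sinr ω = 0 := by simp [sinr, hI]
    rw [h0, setLIntegral_congr_fun (g := fun _ => 0) measurableSet_Ioi]
    · simp
    · intro s hs
      have hs : 0 < s := hs
      have : ENNReal.ofReal s ≠ 0 := by simpa using hs
      beta_reduce
      rw [hI, ENNReal.mul_top this]
      simp
  · set i := (S.interferenceL ω + S.interferenceN ω).toReal with hi
    have hi0 : 0 ≤ i := ENNReal.toReal_nonneg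
    have hIi : S.interferenceL ω + S.interferenceN ω = ENNReal.ofReal i :=
      (ENNReal.ofReal_toReal hI).symm
    have hsinr : S.sinr ω = S.signal ω / (i + N.sigma2) := by
      rw [sinr, hIi, ← ENNReal.ofReal_add hi0 hσ.le, ← ENNReal.ofReal_div_of_pos (by linarith),
        ENNReal.toReal_ofReal (by positivity)]
    rw [hsinr, ← lintegral_Ioi_exp_mul_one_sub_exp (by linarith) hS]
    refine setLIntegral_congr_fun measurableSet_Ioi fun s hs => ?_
    have hs : 0 < s := hs
    rw [hIi, ← ENNReal.ofReal_mul hs.le, eneg_ofReal (by positivity), eneg_ofReal (by positivity),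
      ← ENNReal.ofReal_one, ← ENNReal.ofReal_sub _ (Real.exp_pos _).le,
      ← ENNReal.ofReal_mul (Real.exp_pos _).le, ← ENNReal.ofReal_mul (by positivity)]
    congr 1
    have : Real.exp (-s * (i + N.sigma2)) = Real.exp (-s * N.sigma2) * Real.exp (-(s * i)) := by
      rw [← Real.exp_add]; congr 1; ring
    rw [this]; ring

/-- Conditionally on the serving distances, the Laplace factors of interference and signal average
to their Laplace transforms. -/
theorem lintegral_eneg_mul_one_sub [IsProbabilityMeasure P] {s : ℝ} (hs : 0 ≤ s)
    {A : Set (Fin N.K → ℝ)} (hA : MeasurableSet A) :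
    ∫⁻ ω, A.indicator 1 (S.servingDist ω) *
        (eneg (ENNReal.ofReal s * (S.interferenceL ω + S.interferenceN ω)) *
          (1 - eneg (ENNReal.ofReal (s * S.signal ω)))) ∂P =
      ∫⁻ ω, A.indicator 1 (S.servingDist ω) *
        (eneg (N.VL (S.servingDist ω) s + N.VN (S.servingDist ω) s) *
          (1 - ∏ k, ENNReal.ofReal
            (1 / (1 + N.mu * (s * (N.M * N.pathLossL (S.servingDist ω k))))))) ∂P := by
  have hind : Measurable (A.indicator (1 : (Fin N.K → ℝ) → ℝ≥0∞)) := measurable_one.indicator hA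
  have h0 := S.lintegral_mul_eneg_signal_add_interference hs le_rfl hind
  have h1 := S.lintegral_mul_eneg_signal_add_interference hs hs hind
  simp only [zero_mul, ENNReal.ofReal_zero, zero_add, mul_zero, add_zero, div_one,
    ENNReal.ofReal_one, Finset.prod_const_one, mul_one] at h0
  have hle : ∀ ω, ∏ k, ENNReal.ofReal
      (1 / (1 + N.mu * (s * (N.M * N.pathLossL (S.servingDist ω k))))) ≤ 1 := by
    intro ω
    refine Finset.prod_le_one' fun k _ => ?_
    rw [ENNReal.ofReal_le_one]
    have h0 : 0 ≤ N.mu * (s * (N.M * N.pathLossL (S.servingDist ω k))) :=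
      mul_nonneg N.mu_pos.le (mul_nonneg hs (mul_nonneg N.M_pos.le
        (N.pathLossL_nonneg (norm_nonneg _))))
    rw [div_le_one (by linarith)]; linarith
  have hm1 : Measurable fun ω => A.indicator (1 : (Fin N.K → ℝ) → ℝ≥0∞) (S.servingDist ω) :=
    hind.comp S.measurable_servingDist
  have hm2 : Measurable fun ω =>
      eneg (ENNReal.ofReal s * (S.interferenceL ω + S.interferenceN ω)) :=
    measurable_eneg.comp (by fun_prop)
  have hm3 : Measurable fun ω => eneg (ENNReal.ofReal (s * S.signal ω)) :=
    measurable_eneg.comp (by fun_prop)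
  have hm4 : Measurable fun ω => eneg (N.VL (S.servingDist ω) s + N.VN (S.servingDist ω) s) :=
    (N.measurable_eneg_VL_add_VN s).comp S.measurable_servingDist
  have hm5 : Measurable fun ω => ∏ k, ENNReal.ofReal
      (1 / (1 + N.mu * (s * (N.M * N.pathLossL (S.servingDist ω k))))) := by
    refine Finset.measurable_prod _ fun k _ => Measurable.ennreal_ofReal ?_
    have h := N.measurable_pathLossL.comp
      ((measurable_pi_apply k).comp S.measurable_servingDist)
    exact measurable_const.div ((((h.const_mul _).const_mul _).const_mul _).const_add _)
  refine lintegral_mul_mul_one_sub hm1 hm2 hm3 hm4 hm5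
    (fun ω => indicator_le_self' (f := (1 : (Fin N.K → ℝ) → ℝ≥0∞)) (by simp) _)
    (fun ω => eneg_le_one _) (fun ω => eneg_le_one _) hle h0 ?_
  refine Eq.trans (lintegral_congr fun ω => ?_) (h1.trans (lintegral_congr fun ω => ?_))
  · rw [eneg_add, mul_comm (eneg _)]
  · rw [mul_assoc, mul_comm (eneg _)]

/-- The integrated form of the formula for the conditional ergodic capacity. -/
theorem setLIntegral_log_one_add_sinr [IsProbabilityMeasure P] {A : Set (Fin N.K → ℝ)}
    (hA : MeasurableSet A) :
    ∫⁻ ω in S.servingDist ⁻¹' A, ENNReal.ofReal (Real.log (1 + S.sinr ω)) ∂P =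
      ∫⁻ ω in S.servingDist ⁻¹' A, (∫⁻ s in Ioi (0 : ℝ),
        ENNReal.ofReal (N.capacityIntegrand (S.servingDist ω) s)) ∂P := by
  have hR := S.measurable_servingDist
  have hset : ∀ F : Ω → ℝ≥0∞, ∫⁻ ω in S.servingDist ⁻¹' A, F ω ∂P =
      ∫⁻ ω, A.indicator 1 (S.servingDist ω) * F ω ∂P := by
    intro F
    rw [← lintegral_indicator (hR hA)]
    refine lintegral_congr fun ω => ?_
    by_cases hω : S.servingDist ω ∈ A
    · rw [indicator_of_mem (by exact hω), indicator_of_mem hω]; simp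
    · rw [indicator_of_notMem (by exact hω), indicator_of_notMem hω]; simp
  have hm1 : Measurable fun q : Ω × ℝ => S.interferenceL q.1 + S.interferenceN q.1 :=
    S.measurable_interference.comp measurable_fst
  have hm2 : Measurable fun q : Ω × ℝ => S.signal q.1 := S.measurable_signal.comp measurable_fst
  have hmF : Measurable fun q : Ω × ℝ => ENNReal.ofReal (Real.exp (-q.2 * N.sigma2) / q.2) *
      (eneg (ENNReal.ofReal q.2 * (S.interferenceL q.1 + S.interferenceN q.1)) *
        (1 - eneg (ENNReal.ofReal (q.2 * S.signal q.1)))) := by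
    have h0 : Measurable fun q : Ω × ℝ => ENNReal.ofReal (Real.exp (-q.2 * N.sigma2) / q.2) := by
      fun_prop
    have h1 : Measurable fun q : Ω × ℝ =>
        eneg (ENNReal.ofReal q.2 * (S.interferenceL q.1 + S.interferenceN q.1)) :=
      measurable_eneg.comp (by fun_prop)
    have h2 : Measurable fun q : Ω × ℝ => 1 - eneg (ENNReal.ofReal (q.2 * S.signal q.1)) :=
      measurable_const.sub (measurable_eneg.comp (by fun_prop))
    exact h0.mul (h1.mul h2)
  have hmC : Measurable fun q : Ω × ℝ =>
      ENNReal.ofReal (N.capacityIntegrand (S.servingDist q.1) q.2) :=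
    (N.measurable_capacityIntegrand.comp
      ((hR.comp measurable_fst).prodMk measurable_snd)).ennreal_ofReal
  have hF : ∫⁻ ω in S.servingDist ⁻¹' A, ENNReal.ofReal (Real.log (1 + S.sinr ω)) ∂P =
      ∫⁻ s in Ioi (0 : ℝ), ∫⁻ ω in S.servingDist ⁻¹' A,
        ENNReal.ofReal (Real.exp (-s * N.sigma2) / s) *
        (eneg (ENNReal.ofReal s * (S.interferenceL ω + S.interferenceN ω)) *
        (1 - eneg (ENNReal.ofReal (s * S.signal ω)))) ∂P := by
    rw [← lintegral_lintegral_swap hmF.aemeasurable]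
    exact lintegral_congr fun ω => (S.lintegral_Ioi_eneg_interference ω).symm
  refine hF.trans (Eq.trans ?_ (lintegral_lintegral_swap hmC.aemeasurable).symm)
  refine setLIntegral_congr_fun measurableSet_Ioi fun s hs => ?_
  have hs : 0 < s := hs
  have e1 : ∀ ω, ENNReal.ofReal (N.capacityIntegrand (S.servingDist ω) s) = _ :=
    fun ω => N.ofReal_capacityIntegrand (S.servingDist_nonneg ω) hs
  simp_rw [e1]
  rw [lintegral_const_mul' _ _ ENNReal.ofReal_ne_top,
    lintegral_const_mul' _ _ ENNReal.ofReal_ne_top, hset, hset,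
    S.lintegral_eneg_mul_one_sub hs.le hA]

end RayleighNetwork

/-! ### Integrability -/

theorem log_one_add_sum_le {ι : Type*} (s : Finset ι) {x : ι → ℝ} (hx : ∀ i, 0 ≤ x i) :
    Real.log (1 + ∑ i ∈ s, x i) ≤ ∑ i ∈ s, Real.log (1 + x i) := by
  classical
  induction s using Finset.induction_on with
  | empty => simp
  | insert i s hi ih =>
    rw [Finset.sum_insert hi, Finset.sum_insert hi]
    have hs : 0 ≤ ∑ i ∈ s, x i := Finset.sum_nonneg fun i _ => hx i
    have hi := hx i
    have h1 : Real.log (1 + (x i + ∑ i ∈ s, x i)) ≤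
        Real.log ((1 + x i) * (1 + ∑ i ∈ s, x i)) := by
      refine Real.log_le_log (by positivity) ?_
      nlinarith [mul_nonneg hi hs]
    rw [Real.log_mul (by positivity) (by positivity)] at h1
    linarith

theorem one_sub_prod_one_sub_le_sum {ι : Type*} (s : Finset ι) {x : ι → ℝ} (hx : ∀ i, 0 ≤ x i)
    (hx1 : ∀ i, x i ≤ 1) : 1 - ∏ i ∈ s, (1 - x i) ≤ ∑ i ∈ s, x i := by
  classical
  induction s using Finset.induction_on with
  | empty => simp
  | insert i s hi ih =>
    rw [Finset.sum_insert hi, Finset.prod_insert hi]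
    have h1 : ∏ i ∈ s, (1 - x i) ≤ 1 :=
      Finset.prod_le_one (fun i _ => by linarith [hx1 i]) fun i _ => by linarith [hx i]
    nlinarith [hx i, hx1 i]

/-- At `x = 0` both sides take their junk values `0 ^ (-α) = 0` and `0⁻¹ = 0`. -/
theorem log_one_add_rpow_neg_le {α x : ℝ} (hα : 0 < α) (hx : 0 ≤ x) :
    Real.log (1 + x ^ (-α)) ≤ 1 + α * x⁻¹ := by
  rcases hx.eq_or_lt with rfl | hx
  · rw [Real.zero_rpow (by linarith)]; simp
  have hp : 0 < x ^ (-α) := Real.rpow_pos_of_pos hx _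
  have hi : 0 < x⁻¹ := inv_pos.2 hx
  have h2 : Real.log 2 ≤ 1 := by linarith [Real.log_two_lt_d9]
  have h3 := mul_pos hα hi
  rcases le_total 1 x with h | h
  · have : x ^ (-α) ≤ 1 := Real.rpow_le_one_of_one_le_of_nonpos h (by linarith)
    have := Real.log_le_log (by positivity) (show 1 + x ^ (-α) ≤ 2 by linarith)
    linarith
  · have : 1 ≤ x ^ (-α) := Real.one_le_rpow_of_pos_of_le_one_of_nonpos hx h (by linarith)
    have h4 := Real.log_le_log (by positivity) (show 1 + x ^ (-α) ≤ 2 * x ^ (-α) by linarith)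
    rw [Real.log_mul two_ne_zero hp.ne', Real.log_rpow hx] at h4
    have h5 := Real.log_le_sub_one_of_pos hi
    rw [Real.log_inv] at h5
    nlinarith

theorem log_one_add_rpow_neg_mul_le {α x y : ℝ} (hα : 0 < α) (hx : 0 ≤ x) (hy : 0 ≤ y) :
    Real.log (1 + x ^ (-α) * y) ≤ 1 + α * x⁻¹ + y := by
  have hp : 0 ≤ x ^ (-α) := Real.rpow_nonneg hx _
  have h1 : Real.log (1 + x ^ (-α) * y) ≤ Real.log ((1 + x ^ (-α)) * (1 + y)) := by
    refine Real.log_le_log (by positivity) ?_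
    linarith
  rw [Real.log_mul (by positivity) (by positivity)] at h1
  have h2 := log_one_add_rpow_neg_le hα hx
  have h3 := Real.log_le_sub_one_of_pos (show 0 < 1 + y by positivity)
  linarith

theorem integrable_id_expMeasure {r : ℝ} (hr : 0 < r) :
    Integrable (fun y : ℝ => y) (expMeasure r) := by
  have h0 : expMeasure r = volume.withDensity (exponentialPDF r) := rfl
  have hm : ∀ r, Measurable (exponentialPDF r) := fun r =>
    (measurable_exponentialPDFReal r).ennreal_ofReal
  refine ⟨by fun_prop, ?_⟩
  rw [HasFiniteIntegral, h0, lintegral_withDensity_eq_lintegral_mul _ (hm _) (by fun_prop)]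
  -- The factor `y` is absorbed by halving the rate of the exponential density.
  refine lt_of_le_of_lt (lintegral_mono (g := fun y =>
    ENNReal.ofReal (4 / r) * exponentialPDF (r / 2) y) fun y => ?_) ?_
  · simp only [Pi.mul_apply]
    rcases lt_or_ge y 0 with hy | hy
    · rw [exponentialPDF_of_neg hy]; simp
    · rw [exponentialPDF_of_nonneg hy, exponentialPDF_of_nonneg hy, Real.enorm_eq_ofReal hy,
        ← ENNReal.ofReal_mul (by positivity), ← ENNReal.ofReal_mul (by positivity)]
      refine ENNReal.ofReal_le_ofReal ?_
      have h1 : r * y / 2 ≤ Real.exp (r * y / 2) := by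
        linarith [Real.add_one_le_exp (r * y / 2)]
      have h2 : Real.exp (-(r / 2 * y)) = Real.exp (-(r * y)) * Real.exp (r * y / 2) := by
        rw [← Real.exp_add]; congr 1; ring
      rw [h2]
      have h3 : 4 / r * (r / 2 * (Real.exp (-(r * y)) * Real.exp (r * y / 2))) =
          2 * (Real.exp (-(r * y)) * Real.exp (r * y / 2)) := by field_simp; ring
      rw [h3]
      have h4 := mul_le_mul_of_nonneg_left h1 (Real.exp_pos (-(r * y))).le
      nlinarith
  · rw [lintegral_const_mul _ (hm _), lintegral_exponentialPDF_eq_one (by positivity), mul_one]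
    exact ENNReal.ofReal_lt_top

namespace VCParams

variable (N : VCParams)

theorem lastDist_eq_rK (r : Fin N.K → ℝ) : lastDist N.K r = N.rK r := by
  simp [lastDist, N.K_pos, rK]

theorem orderedDensity_eq : orderedDensity (Real.pi * N.lam) N.K =
    N.D.indicator fun r => ENNReal.ofReal (N.distDensity r) := by
  funext r
  have hD : orderedDist N.K = N.D := rfl
  rw [orderedDensity, hD]
  congr 1
  funext r
  rw [distDensity, N.lastDist_eq_rK]
  congr 3
  · ring
  · congr 1; ring

theorem measurableSet_D : MeasurableSet N.D := measurableSet_orderedDist N.K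

theorem measurable_distDensity : Measurable N.distDensity := by
  have := N.measurable_rK
  unfold distDensity
  fun_prop

theorem prod_one_sub_rayleighH_le_one {r : Fin N.K → ℝ} (hr : ∀ k, 0 ≤ r k) {s : ℝ} (hs : 0 ≤ s) :
    ∏ k, (1 - rayleighH (N.mu * s * N.M * N.CL * r k ^ (-N.alphaL))) ≤ 1 := by
  have hx : ∀ k, 0 ≤ N.mu * s * N.M * N.CL * r k ^ (-N.alphaL) := fun k => by
    have h1 := N.mu_pos
    have h2 := N.M_pos
    have h3 := N.CL_pos
    have h4 := Real.rpow_nonneg (hr k) (-N.alphaL)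
    positivity
  exact Finset.prod_le_one (fun k _ => one_sub_rayleighH_nonneg (hx k))
    fun k _ => by linarith [rayleighH_nonneg (hx k)]

theorem capacityIntegrand_nonneg {r : Fin N.K → ℝ} (hr : ∀ k, 0 ≤ r k) {s : ℝ} (hs : 0 ≤ s) :
    0 ≤ N.capacityIntegrand r s := by
  have := N.prod_one_sub_rayleighH_le_one hr hs
  exact mul_nonneg (mul_nonneg (div_nonneg (Real.exp_pos _).le hs) (expNeg_nonneg _)) (by linarith)

/-- The singularity of `exp (-s * sigma2) / s` at `0` is cancelled by the last factor, which is at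
most linear in `s`. -/
theorem capacityIntegrand_le {r : Fin N.K → ℝ} (hr : ∀ k, 0 ≤ r k) {s : ℝ} (hs : 0 < s) :
    N.capacityIntegrand r s ≤
      (∑ k, N.mu * N.M * N.CL * r k ^ (-N.alphaL)) * Real.exp (-N.sigma2 * s) := by
  have hx : ∀ k, 0 ≤ N.mu * s * N.M * N.CL * r k ^ (-N.alphaL) := fun k => by
    have h1 := N.mu_pos
    have h2 := N.M_pos
    have h3 := N.CL_pos
    have h4 := Real.rpow_nonneg (hr k) (-N.alphaL)
    positivity
  have h1 : 1 - ∏ k, (1 - rayleighH (N.mu * s * N.M * N.CL * r k ^ (-N.alphaL))) ≤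
      s * ∑ k, N.mu * N.M * N.CL * r k ^ (-N.alphaL) := by
    refine (one_sub_prod_one_sub_le_sum _ (fun k => rayleighH_nonneg (hx k))
      fun k => by linarith [one_sub_rayleighH_nonneg (hx k)]).trans ?_
    rw [Finset.mul_sum]
    refine Finset.sum_le_sum fun k _ => (rayleighH_le_self (hx k)).trans_eq ?_
    ring
  have h0 := N.prod_one_sub_rayleighH_le_one hr hs.le
  have he : 0 ≤ Real.exp (-s * N.sigma2) / s := by positivity
  calc N.capacityIntegrand r s
      ≤ Real.exp (-s * N.sigma2) / s * 1 *
          (1 - ∏ k, (1 - rayleighH (N.mu * s * N.M * N.CL * r k ^ (-N.alphaL)))) := by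
        refine mul_le_mul_of_nonneg_right ?_ (by linarith)
        exact mul_le_mul_of_nonneg_left (expNeg_le_one _) he
    _ ≤ Real.exp (-s * N.sigma2) / s * 1 * (s * ∑ k, N.mu * N.M * N.CL * r k ^ (-N.alphaL)) :=
        mul_le_mul_of_nonneg_left h1 (by positivity)
    _ = _ := by
        have : -N.sigma2 * s = -s * N.sigma2 := by ring
        rw [this]
        field_simp

theorem integrableOn_capacityIntegrand {r : Fin N.K → ℝ} (hr : ∀ k, 0 ≤ r k) :
    IntegrableOn (N.capacityIntegrand r) (Ioi 0) := by
  have hm : Measurable (N.capacityIntegrand r) :=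
    Measurable.of_uncurry_left (f := N.capacityIntegrand) N.measurable_capacityIntegrand
  refine Integrable.mono' ((exp_neg_integrableOn_Ioi 0 N.sigma2_pos).const_mul
    (∑ k, N.mu * N.M * N.CL * r k ^ (-N.alphaL))) hm.aestronglyMeasurable
    ((ae_restrict_iff' measurableSet_Ioi).2 (Eventually.of_forall fun s hs => ?_))
  have hs : 0 < s := hs
  rw [Real.norm_of_nonneg (N.capacityIntegrand_nonneg hr hs.le)]
  exact N.capacityIntegrand_le hr hs

theorem setIntegral_capacityIntegrand_nonneg {r : Fin N.K → ℝ} (hr : ∀ k, 0 ≤ r k) :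
    0 ≤ ∫ s in Ioi (0 : ℝ), N.capacityIntegrand r s :=
  setIntegral_nonneg measurableSet_Ioi fun _ hs =>
    N.capacityIntegrand_nonneg hr (le_of_lt (by exact hs))

theorem ofReal_setIntegral_capacityIntegrand {r : Fin N.K → ℝ} (hr : ∀ k, 0 ≤ r k) :
    ENNReal.ofReal (∫ s in Ioi (0 : ℝ), N.capacityIntegrand r s) =
      ∫⁻ s in Ioi (0 : ℝ), ENNReal.ofReal (N.capacityIntegrand r s) :=
  ofReal_integral_eq_lintegral_ofReal (N.integrableOn_capacityIntegrand hr)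
    ((ae_restrict_iff' measurableSet_Ioi).2 (Eventually.of_forall fun _ hs =>
      N.capacityIntegrand_nonneg hr (le_of_lt (by exact hs))))

/-- The conditional ergodic capacity as a function of the serving distances. -/
noncomputable def condCapacity (r : Fin N.K → ℝ) : ℝ :=
  1 / Real.log 2 * ∫ s in Ioi (0 : ℝ), N.capacityIntegrand r s

theorem condCapacity_nonneg {r : Fin N.K → ℝ} (hr : ∀ k, 0 ≤ r k) : 0 ≤ N.condCapacity r :=
  mul_nonneg (by positivity) (N.setIntegral_capacityIntegrand_nonneg hr)

theorem measurable_condCapacity : Measurable N.condCapacity :=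
  (StronglyMeasurable.integral_prod_right (f := N.capacityIntegrand)
    N.measurable_capacityIntegrand.stronglyMeasurable).measurable.const_mul _

theorem distDensity_nonneg {r : Fin N.K → ℝ} (hr : ∀ k, 0 ≤ r k) : 0 ≤ N.distDensity r := by
  have h1 := N.lam_pos
  have h2 := Finset.prod_nonneg fun k (_ : k ∈ Finset.univ) => hr k
  unfold distDensity
  positivity

theorem distDensity_mul_condCapacity (r : Fin N.K → ℝ) :
    N.distDensity r * N.condCapacity r = (2 * Real.pi * N.lam) ^ N.K / Real.log 2 *
      ((∏ k, r k) * Real.exp (-Real.pi * N.lam * N.rK r ^ 2) *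
        ∫ s in Ioi (0 : ℝ), N.capacityIntegrand r s) := by
  unfold distDensity condCapacity; ring

end VCParams

namespace RayleighNetwork

variable {N : VCParams} {Ω : Type*} [MeasurableSpace Ω] {P : Measure Ω}
  (S : RayleighNetwork N P)

theorem map_norm_eq_withDensity [IsProbabilityMeasure P] (K : ℕ) :
    P.map (fun ω (j : Fin K) => ‖S.X j ω‖) =
      volume.withDensity (orderedDensity (Real.pi * N.lam) K) :=
  map_dist_eq_withDensity (ρ := Prod.fst) S.isPoissonProcess_distType S.measurable_distType
    measurable_fst S.ordered (fun k ω => norm_nonneg (S.X k ω))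
    (mul_pos Real.pi_pos N.lam_pos) (fun _ _ => N.radialIntensity_annulus)
    N.radialIntensity_nonpos K

/-- The joint density of the serving distances. -/
theorem hasLaw_servingDist [IsProbabilityMeasure P] : HasLaw S.servingDist
    ((volume.restrict N.D).withDensity fun r => ENNReal.ofReal (N.distDensity r)) P := by
  refine ⟨S.measurable_servingDist.aemeasurable, ?_⟩
  rw [← withDensity_indicator N.measurableSet_D, ← N.orderedDensity_eq]
  exact S.map_norm_eq_withDensity N.K

theorem servingDist_mem_D [IsProbabilityMeasure P] : ∀ᵐ ω ∂P, S.servingDist ω ∈ N.D := by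
  have h : ∀ᵐ r ∂P.map S.servingDist, r ∈ N.D := by
    rw [S.hasLaw_servingDist.map_eq]
    exact (withDensity_absolutelyContinuous _ _).ae_le (ae_restrict_mem N.measurableSet_D)
  exact ae_of_ae_map S.measurable_servingDist.aemeasurable h

/-- The factor `r` in the density of the nearest distance compensates the singularity of `1 / r`. -/
theorem integrable_inv_norm_X_zero [IsProbabilityMeasure P] :
    Integrable (fun ω => ‖S.X 0 ω‖⁻¹) P := by
  have hc : 0 < Real.pi * N.lam := mul_pos Real.pi_pos N.lam_pos
  set c := Real.pi * N.lam
  refine ⟨((S.measurable_X 0).norm.inv).aestronglyMeasurable, ?_⟩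
  have hf : Measurable fun r : Fin 1 → ℝ => ENNReal.ofReal (r 0)⁻¹ := by fun_prop
  have hR : Measurable fun ω (j : Fin 1) => ‖S.X j ω‖ :=
    measurable_pi_lambda _ fun j => (S.measurable_X j).norm
  have h1 : ∫⁻ ω, ‖‖S.X 0 ω‖⁻¹‖ₑ ∂P =
      ∫⁻ r : Fin 1 → ℝ, orderedDensity c 1 r * ENNReal.ofReal (r 0)⁻¹ := by
    have := lintegral_map (μ := P) hf hR
    rw [S.map_norm_eq_withDensity 1,
      lintegral_withDensity_eq_lintegral_mul _ (measurable_orderedDensity _ _) hf] at this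
    refine Eq.trans (lintegral_congr fun ω => ?_) this.symm
    exact Real.enorm_eq_ofReal (by positivity)
  rw [HasFiniteIntegral, h1]
  have h2 : ∀ r : Fin 1 → ℝ, orderedDensity c 1 r * ENNReal.ofReal (r 0)⁻¹ ≤
      ENNReal.ofReal (2 * c * Real.exp (-c * (r 0) ^ 2)) := by
    intro r
    by_cases hr : r ∈ orderedDist 1
    · have h0 : 0 < r 0 := hr.1 0
      rw [orderedDensity, indicator_of_mem hr, ← ENNReal.ofReal_mul' (by positivity)]
      refine ENNReal.ofReal_le_ofReal (le_of_eq ?_)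
      have : lastDist 1 r = r 0 := by simp [lastDist]
      rw [this]
      simp only [pow_one, Finset.univ_unique, Finset.prod_singleton, Fin.default_eq_zero]
      field_simp
    · rw [orderedDensity, indicator_of_notMem hr, zero_mul]; exact zero_le
  refine (lintegral_mono h2).trans_lt ?_
  have h3 := (volume_preserving_funUnique (Fin 1) ℝ).lintegral_comp
    (f := fun x => ENNReal.ofReal (2 * c * Real.exp (-c * x ^ 2))) (by fun_prop)
  refine lt_of_eq_of_lt h3 ?_
  exact ((integrable_exp_neg_mul_sq hc).const_mul (2 * c)).lintegral_lt_top

theorem integrable_fading (k : ℕ) : Integrable (fun ω => ‖S.ξ k ω‖ ^ 2) P := by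
  have h := integrable_id_expMeasure (inv_pos.2 N.mu_pos)
  rw [← (S.fading_law k).map_eq] at h
  exact h.comp_aemeasurable (S.fading_law k).aemeasurable

theorem sinr_le_signal_div (ω : Ω) : S.sinr ω ≤ S.signal ω / N.sigma2 := by
  have hS := S.signal_nonneg ω
  have hσ := N.sigma2_pos
  rw [sinr, ← ENNReal.toReal_ofReal (div_nonneg hS hσ.le)]
  refine ENNReal.toReal_mono ENNReal.ofReal_ne_top ?_
  rw [ENNReal.ofReal_div_of_pos hσ]
  exact ENNReal.div_le_div_left le_add_self _

/-- The fading powers and the distance of the nearest access point dominate the spectral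
efficiency. -/
theorem log_one_add_sinr_le {ω : Ω} (hω : S.servingDist ω ∈ N.D) :
    Real.log (1 + S.sinr ω) ≤ ∑ k : Fin N.K, (1 + N.alphaL * ‖S.X 0 ω‖⁻¹ +
      N.M * N.CL / N.sigma2 * ‖S.ξ k ω‖ ^ 2) := by
  have hσ := N.sigma2_pos
  have hM := N.M_pos
  have hC := N.CL_pos
  have hα := N.alphaL_pos
  have h0 := S.sinr_nonneg ω
  have hp : ∀ k : Fin N.K, 0 ≤ S.servingDist ω k ^ (-N.alphaL) := fun k =>
    Real.rpow_nonneg (S.servingDist_nonneg ω k) _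
  have hx : ∀ k : Fin N.K, 0 ≤ N.M * N.CL / N.sigma2 * ‖S.ξ k ω‖ ^ 2 := fun k => by positivity
  have h1 : S.signal ω / N.sigma2 = ∑ k : Fin N.K,
      S.servingDist ω k ^ (-N.alphaL) * (N.M * N.CL / N.sigma2 * ‖S.ξ k ω‖ ^ 2) := by
    rw [signal, Finset.sum_div]
    refine Finset.sum_congr rfl fun k _ => ?_
    unfold VCParams.pathLossL; ring
  have h2 := S.sinr_le_signal_div ω
  rw [h1] at h2
  refine (Real.log_le_log (by linarith) (add_le_add_right h2 1)).trans
    ((log_one_add_sum_le _ fun k => mul_nonneg (hp k) (hx k)).trans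
      (Finset.sum_le_sum fun k _ => ?_))
  have h3 := log_one_add_rpow_neg_mul_le hα (S.servingDist_nonneg ω k) (hx k)
  have e : S.servingDist ω ⟨0, N.K_pos⟩ = ‖S.X 0 ω‖ := rfl
  have h4 := hω.1 ⟨0, N.K_pos⟩
  have h : (⟨0, N.K_pos⟩ : Fin N.K) ≤ k := Fin.mk_le_of_le_val (Nat.zero_le _)
  have h5 := hω.2 h
  rw [e] at h4 h5
  have h6 := mul_le_mul_of_nonneg_left (inv_anti₀ h4 h5) hα.le
  linarith

theorem measurable_rate : Measurable S.rate := by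
  unfold rate Real.logb
  fun_prop

theorem rate_eq (ω : Ω) : S.rate ω = 1 / Real.log 2 * Real.log (1 + S.sinr ω) := by
  unfold rate Real.logb; ring

theorem rate_nonneg (ω : Ω) : 0 ≤ S.rate ω :=
  Real.logb_nonneg one_lt_two (by linarith [S.sinr_nonneg ω])

theorem integrable_rate [IsProbabilityMeasure P] : Integrable S.rate P := by
  have hb : Integrable (fun ω => ∑ k : Fin N.K, (1 + N.alphaL * ‖S.X 0 ω‖⁻¹ +
      N.M * N.CL / N.sigma2 * ‖S.ξ k ω‖ ^ 2)) P :=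
    integrable_finsetSum Finset.univ fun k _ =>
      ((integrable_const 1).add (S.integrable_inv_norm_X_zero.const_mul N.alphaL)).add
        ((S.integrable_fading k).const_mul (N.M * N.CL / N.sigma2))
  have hm : Measurable fun ω => Real.log (1 + S.sinr ω) :=
    (S.measurable_sinr.const_add 1).log
  have h : Integrable (fun ω => 1 / Real.log 2 * Real.log (1 + S.sinr ω)) P := by
    refine Integrable.const_mul (hb.mono' hm.aestronglyMeasurable ?_) _
    filter_upwards [S.servingDist_mem_D] with ω hω
    rw [Real.norm_of_nonneg (Real.log_nonneg (by linarith [S.sinr_nonneg ω]))]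
    exact S.log_one_add_sinr_le hω
  exact h.congr (Eventually.of_forall fun ω => (S.rate_eq ω).symm)

/-! ### The capacity formulas -/

theorem setLIntegral_rate [IsProbabilityMeasure P] {A : Set (Fin N.K → ℝ)} (hA : MeasurableSet A) :
    ∫⁻ ω in S.servingDist ⁻¹' A, ENNReal.ofReal (S.rate ω) ∂P =
      ∫⁻ ω in S.servingDist ⁻¹' A, ENNReal.ofReal (N.condCapacity (S.servingDist ω)) ∂P := by
  have hl : 0 ≤ 1 / Real.log 2 := by positivity
  have h := congrArg (ENNReal.ofReal (1 / Real.log 2) * ·) (S.setLIntegral_log_one_add_sinr hA)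
  beta_reduce at h
  rw [← lintegral_const_mul' _ _ ENNReal.ofReal_ne_top,
    ← lintegral_const_mul' _ _ ENNReal.ofReal_ne_top] at h
  refine Eq.trans (lintegral_congr fun ω => ?_) (h.trans (lintegral_congr fun ω => ?_))
  · rw [S.rate_eq, ENNReal.ofReal_mul hl]
  · rw [VCParams.condCapacity, ENNReal.ofReal_mul hl,
      N.ofReal_setIntegral_capacityIntegrand (S.servingDist_nonneg ω)]

theorem integrable_condCapacity [IsProbabilityMeasure P] :
    Integrable (fun ω => N.condCapacity (S.servingDist ω)) P := by
  have hm : Measurable fun ω => N.condCapacity (S.servingDist ω) :=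
    N.measurable_condCapacity.comp S.measurable_servingDist
  refine (lintegral_ofReal_ne_top_iff_integrable hm.aestronglyMeasurable
    (Eventually.of_forall fun ω => N.condCapacity_nonneg (S.servingDist_nonneg ω))).1 ?_
  have h := S.setLIntegral_rate MeasurableSet.univ
  simp only [preimage_univ, Measure.restrict_univ] at h
  rw [← h]
  exact S.integrable_rate.lintegral_lt_top.ne

theorem setIntegral_rate [IsProbabilityMeasure P] {A : Set (Fin N.K → ℝ)} (hA : MeasurableSet A) :
    ∫ ω in S.servingDist ⁻¹' A, S.rate ω ∂P =
      ∫ ω in S.servingDist ⁻¹' A, N.condCapacity (S.servingDist ω) ∂P := by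
  rw [integral_eq_lintegral_of_nonneg_ae (Eventually.of_forall S.rate_nonneg)
      S.measurable_rate.aestronglyMeasurable,
    integral_eq_lintegral_of_nonneg_ae
      (Eventually.of_forall fun ω => N.condCapacity_nonneg (S.servingDist_nonneg ω))
      S.integrable_condCapacity.integrableOn.aestronglyMeasurable, S.setLIntegral_rate hA]

theorem condErgodicCapacity_ae_eq [IsProbabilityMeasure P] :
    S.condErgodicCapacity =ᵐ[P] fun ω => N.condCapacity (S.servingDist ω) := by
  refine (ae_eq_condExp_of_forall_setIntegral_eq S.measurable_servingDist.comap_le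
    S.integrable_rate (fun _ _ _ => S.integrable_condCapacity.integrableOn) ?_ ?_).symm
  · rintro _ ⟨A, hA, rfl⟩ _
    exact (S.setIntegral_rate hA).symm
  · exact (N.measurable_condCapacity.comp
      (comap_measurable S.servingDist)).stronglyMeasurable.aestronglyMeasurable

theorem ergodicCapacity_eq [IsProbabilityMeasure P] :
    S.ergodicCapacity = ∫ r in N.D, N.distDensity r * N.condCapacity r := by
  have h := S.setIntegral_rate MeasurableSet.univ
  simp only [preimage_univ, Measure.restrict_univ] at h
  have h2 := S.hasLaw_servingDist.integral_comp (f := N.condCapacity)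
    N.measurable_condCapacity.aestronglyMeasurable
  rw [ergodicCapacity, h]
  refine h2.trans ?_
  rw [integral_withDensity_eq_integral_toReal_smul N.measurable_distDensity.ennreal_ofReal
    (Eventually.of_forall fun _ => ENNReal.ofReal_lt_top)]
  refine setIntegral_congr_fun N.measurableSet_D fun r hr => ?_
  simp only [smul_eq_mul]
  rw [ENNReal.toReal_ofReal (N.distDensity_nonneg fun k => (hr.1 k).le)]

theorem integrableOn_distDensity_mul_condCapacity [IsProbabilityMeasure P]
    (S : RayleighNetwork N P) :
    IntegrableOn (fun r => N.distDensity r * N.condCapacity r) N.D := by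
  have h := S.integrable_condCapacity
  have h2 : Integrable N.condCapacity (P.map S.servingDist) :=
    (integrable_map_measure N.measurable_condCapacity.aestronglyMeasurable
      S.measurable_servingDist.aemeasurable).2 h
  rw [S.hasLaw_servingDist.map_eq, integrable_withDensity_iff_integrable_smul'
    N.measurable_distDensity.ennreal_ofReal
    (Eventually.of_forall fun _ => ENNReal.ofReal_lt_top)] at h2
  refine IntegrableOn.congr_fun h2 (fun r hr => ?_) N.measurableSet_D
  simp only [smul_eq_mul]
  rw [ENNReal.toReal_ofReal (N.distDensity_nonneg fun k => (hr.1 k).le)]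

end RayleighNetwork

theorem theorem2 (N : VCParams) {Ω : Type*} [MeasurableSpace Ω] (P : Measure Ω)
    [IsProbabilityMeasure P] (S : RayleighNetwork N P) :
    -- all expectations and integrals below converge
    Integrable S.rate P ∧
    (∀ r ∈ N.D, IntegrableOn (N.capacityIntegrand r) (Ioi 0)) ∧
    IntegrableOn
      (fun r => (∏ k, r k) * Real.exp (-Real.pi * N.lam * N.rK r ^ 2) *
        ∫ s in Ioi (0 : ℝ), N.capacityIntegrand r s) N.D ∧
    -- the conditional ergodic capacity given the serving distances
    (S.condErgodicCapacity =ᵐ[P] fun ω =>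
      1 / Real.log 2 * ∫ s in Ioi (0 : ℝ), N.capacityIntegrand (S.servingDist ω) s) ∧
    -- the joint density of the `K` nearest distances
    HasLaw S.servingDist
      ((volume.restrict N.D).withDensity (fun r => ENNReal.ofReal (N.distDensity r))) P ∧
    -- the ergodic capacity
    S.ergodicCapacity =
      (2 * Real.pi * N.lam) ^ N.K / Real.log 2 *
        ∫ r in N.D, (∏ k, r k) * Real.exp (-Real.pi * N.lam * N.rK r ^ 2) *
          ∫ s in Ioi (0 : ℝ), N.capacityIntegrand r s := by
  have hc : (2 * Real.pi * N.lam) ^ N.K / Real.log 2 ≠ 0 := by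
    have h1 := N.lam_pos
    have h2 := Real.log_pos one_lt_two
    positivity
  refine ⟨S.integrable_rate, fun r hr => N.integrableOn_capacityIntegrand fun k => (hr.1 k).le,
    ?_, S.condErgodicCapacity_ae_eq, S.hasLaw_servingDist, ?_⟩
  · have h := S.integrableOn_distDensity_mul_condCapacity
    simp_rw [N.distDensity_mul_condCapacity] at h
    exact (integrable_const_mul_iff (isUnit_iff_ne_zero.2 hc) _).1 h
  · rw [S.ergodicCapacity_eq]
    simp_rw [N.distDensity_mul_condCapacity]
    exact integral_const_mul _ _
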